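/- Let $S$ be a smooth (Hausdorff, second countable) $3$-manifold, $I\subset\mathbb R$ an interval, and let $\mathcal M_I=I\times S$ carry the Lorentzian metric $\mathbf g=-n^2dt^2+g_t$, where the lapse $n>0$ and the Riemannian metrics $g_t$ on $S$ depend smoothly on $(t,x)$ (on $J\times S$ for some open $J\supset I$). The leaves are $\Sigma_t=\{t\}\times S$, with unit future normal $\mathbf T=n^{-1}\partial_t$, and $t(p)$ is the time of $p\in\mathcal M_I$. Assume that every $(\Sigma_t,g_t)$, $t\in I$, is complete (for example compact or asymptotically flat), that $N_0^{-1}\le n\le N_0$, and that the deformation tensor $\pi=\mathcal L_{\mathbf T}\mathbf g$ satisfies $|\pi(v,v)|\le K_0\,g_t(v,v)$ for all $v$ tangent to the leaves, for some constants $N_0,K_0$. For $p\in\mathcal M_I$ and a $g_{t(p)}$-unit vector $\omega\in T_p\Sigma_{t(p)}$ let $\gamma_\omega$ be the past directed null geodesic from $p$ with initial velocity $\ell_\omega=\omega-\mathbf T_p$ (so $\mathbf g(\ell_\omega,\mathbf T_p)=1$), and let $\mathcal G_p(t,\omega)$ be its point on $\Sigma_t$, $t\in I$, $t<t(p)$.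 Let $\ell_*(p,t)\in[0,\infty]$ be the infimum of the values $t(p)-t$ for which two geodesics $\gamma_{\omega_1},\gamma_{\omega_2}$ with $\omega_1\ne\omega_2$ meet at a point of $\Sigma_t$, and let $s_*(p,t)\in[0,\infty]$ be the supremum of the $\sigma$ such that $\mathcal G_p(t,\cdot)$ is an immersion of the unit sphere for all $t\in I$ with $t(p)-\sigma<t<t(p)$. Assume A4: there are a compact set $\mathcal D\subset\mathcal M_I$ and $\delta_0>0$ such that $\ell_*(p,t)>\delta_0$ for every $p\in\mathcal M_I\setminus\mathcal D$. Let $0<\delta_*\le\delta_0$ be a constant with $$s_*(p,t)>\min(\ell_*(p,t),\delta_*)\qquad\text{for all }p\in\mathcal M_I .$$ Suppose that two distinct null geodesics $\lambda_0,\gamma_0$ in $\mathcal M_I$ meet at two points $p_0,q_0$ with $0<t(p_0)-t(q_0)<\delta_*$. Then there are two null geodesics $\lambda,\gamma$ in $\mathcal M_I$ that meet at points $p,q$ with $t(q_0)\le t(q)<t(p)\le t(p_0)$ and that are opposite both at $p$ and at $q$; that is, at $p$ and at $q$ the projections of their (past directed) tangent vectors to the tangent space of the leaf through that point are nonzero,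 lie on the same line and point in opposite directions. -/

import Mathlib

open scoped Manifold ContDiff Topology

noncomputable section

/-- The model space of the three-dimensional slices. -/
abbrev E3 : Type := EuclideanSpace ℝ (Fin 3)

/-- A space-time region `M_I = I × S` foliated by the leaves `Σ_t = {t} × S` of a time function
`t`, written in transported coordinates: the space-time metric is `- n² dt² + g_t`, with lapse `n`
and with `g_t` a Riemannian metric on the 3-manifold `S`. The metric is smooth on `J × S` for an
open `J ⊇ I`, so that the interval `I` may contain its endpoints (`J = I` if `I` is open). -/
structure FoliatedSpacetime (S : Type*) [TopologicalSpace S] [ChartedSpace E3 S] where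
  I : Set ℝ
  J : Set ℝ
  ordConnected_I : I.OrdConnected
  isOpen_J : IsOpen J
  I_subset_J : I ⊆ J
  /-- the lapse function `n` -/
  lapse : ℝ → S → ℝ
  /-- the metric `g_t` on `S` -/
  metric : ℝ → (x : S) → TangentSpace 𝓘(ℝ, E3) x →L[ℝ] TangentSpace 𝓘(ℝ, E3) x →L[ℝ] ℝ
  lapse_pos : ∀ t ∈ J, ∀ x, 0 < lapse t x
  metric_symm : ∀ t ∈ J, ∀ x v w, metric t x v w = metric t x w v
  metric_pos : ∀ t ∈ J, ∀ x v, v ≠ 0 → 0 < metric t x v v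
  /-- the lapse is smooth in every chart -/
  lapse_smooth : ∀ x₀ : S, ContDiffOn ℝ ∞
    (fun z : ℝ × E3 => lapse z.1 ((extChartAt 𝓘(ℝ, E3) x₀).symm z.2))
    (J ×ˢ (extChartAt 𝓘(ℝ, E3) x₀).target)
  /-- the components of `g_t` are smooth in every chart -/
  metric_smooth : ∀ (x₀ : S) (v w : E3), ContDiffOn ℝ ∞
    (fun z : ℝ × E3 => metric z.1 ((extChartAt 𝓘(ℝ, E3) x₀).symm z.2)
      (mfderiv 𝓘(ℝ, E3) 𝓘(ℝ, E3) (extChartAt 𝓘(ℝ, E3) x₀).symm z.2 v)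
      (mfderiv 𝓘(ℝ, E3) 𝓘(ℝ, E3) (extChartAt 𝓘(ℝ, E3) x₀).symm z.2 w))
    (J ×ˢ (extChartAt 𝓘(ℝ, E3) x₀).target)

namespace FoliatedSpacetime

variable {S : Type*} [TopologicalSpace S] [ChartedSpace E3 S] (M : FoliatedSpacetime S)

/-- The region `M_I`, as a subset of `ℝ × S`; the time function is the first coordinate. -/
def region : Set (ℝ × S) := {p | p.1 ∈ M.I}

/-- The space-time metric `- n² dt² + g_t` in the coordinates `(t, y)` given by the chart of `S`
around `x₀`: its value at the coordinate point `z` on the coordinate vectors `X`, `Y`. -/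
def coordMetric (x₀ : S) (z X Y : ℝ × E3) : ℝ :=
  -(M.lapse z.1 ((extChartAt 𝓘(ℝ, E3) x₀).symm z.2)) ^ 2 * X.1 * Y.1 +
    M.metric z.1 ((extChartAt 𝓘(ℝ, E3) x₀).symm z.2)
      (mfderiv 𝓘(ℝ, E3) 𝓘(ℝ, E3) (extChartAt 𝓘(ℝ, E3) x₀).symm z.2 X.2)
      (mfderiv 𝓘(ℝ, E3) 𝓘(ℝ, E3) (extChartAt 𝓘(ℝ, E3) x₀).symm z.2 Y.2)

/-- A curve in the coordinates `(t, y)` given by the chart of `S` around `x₀`. -/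
def coordCurve (x₀ : S) (γ : ℝ → ℝ × S) (s : ℝ) : ℝ × E3 :=
  ((γ s).1, extChartAt 𝓘(ℝ, E3) x₀ (γ s).2)

/-- `𝐠(D_{c'} c', W)` at the parameter `s`, where `c` is the coordinate expression of `γ` and `D`
is the Levi-Civita connection of the space-time metric:
`𝐠(c'', W) + Γ(W; c', c')` with the Christoffel symbols of the first kind
`Γ(W; X, X) = (∂_X 𝐠)(X, W) - (1/2) (∂_W 𝐠)(X, X)`. -/
def covariantAcceleration (x₀ : S) (γ : ℝ → ℝ × S) (s : ℝ) (W : ℝ × E3) : ℝ :=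
  M.coordMetric x₀ (coordCurve x₀ γ s) (deriv (deriv (coordCurve x₀ γ)) s) W
    + fderiv ℝ (fun z => M.coordMetric x₀ z (deriv (coordCurve x₀ γ) s) W)
        (coordCurve x₀ γ s) (deriv (coordCurve x₀ γ) s)
    - (1 / 2) * fderiv ℝ
        (fun z => M.coordMetric x₀ z (deriv (coordCurve x₀ γ) s) (deriv (coordCurve x₀ γ) s))
        (coordCurve x₀ γ s) W

/-- The time component `d(t ∘ γ)/ds` of the velocity. -/
def timeVelocity (γ : ℝ → ℝ × S) (s : ℝ) : ℝ := deriv (fun s' => (γ s').1) s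

/-- The component of the velocity of `γ` tangent to the leaf through `γ s`. As the unit normal of
the leaves is `n⁻¹ ∂_t`, this is the projection of the velocity onto the tangent space of the
leaf. (It is an element of `TangentSpace 𝓘(ℝ, E3) (γ s).2`, which unfolds to `E3`.) -/
def leafVelocity (γ : ℝ → ℝ × S) (s : ℝ) : E3 :=
  mfderiv 𝓘(ℝ, ℝ) 𝓘(ℝ, E3) (fun s' => (γ s').2) s (1 : ℝ)

/-- `γ`, restricted to `[0, b]`, is an affinely parametrized past directed null geodesic segment
in `M_I`. -/
structure IsPastNullGeodesic (γ : ℝ → ℝ × S) (b : ℝ) : Prop where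
  pos : 0 < b
  mem_region : ∀ s ∈ Set.Icc 0 b, γ s ∈ M.region
  contMDiffAt : ∀ s ∈ Set.Icc 0 b,
    ContMDiffAt 𝓘(ℝ, ℝ) (𝓘(ℝ, ℝ).prod 𝓘(ℝ, E3)) 2 γ s
  geodesic : ∀ s ∈ Set.Icc 0 b, ∀ x₀ : S, (γ s).2 ∈ (extChartAt 𝓘(ℝ, E3) x₀).source →
    ∀ W, M.covariantAcceleration x₀ γ s W = 0
  past : ∀ s ∈ Set.Icc 0 b, timeVelocity γ s < 0
  null : ∀ s ∈ Set.Icc 0 b,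
    -(M.lapse (γ s).1 (γ s).2) ^ 2 * timeVelocity γ s ^ 2 +
      M.metric (γ s).1 (γ s).2 (leafVelocity γ s) (leafVelocity γ s) = 0

/-- The past directed null geodesic segment `γ` on `[0, b]` runs from `p` to `q`. -/
def Joins (γ : ℝ → ℝ × S) (b : ℝ) (p q : ℝ × S) : Prop :=
  M.IsPastNullGeodesic γ b ∧ γ 0 = p ∧ γ b = q

/-- The past null geodesic from `p` whose initial velocity has leaf component `v` passes through
the point `y` of the leaf at time `t`. -/
def Reaches (p : ℝ × S) (v : E3) (t : ℝ) (y : S) : Prop :=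
  ∃ γ b, M.Joins γ b p (t, y) ∧ leafVelocity γ 0 = v

/-- The unit sphere of the tangent space at `p` of the leaf through `p`. For `ξ` in it, the past
null vector `ℓ_ξ` with leaf component `ξ` satisfies `𝐠(ℓ_ξ, T) = 1`. -/
def unitSphere (p : ℝ × S) : Set E3 := {ξ | M.metric p.1 p.2 ξ ξ = 1}

open Classical in
/-- The null exponential map `𝓖_p(t, ξ) = γ_ξ(t)` relative to the time foliation. It is extended
from unit vectors to all nonzero `v`, by the same description (it depends only on the direction of
`v`), and by a default value where the geodesic does not reach time `t`. -/
def nullExp (p : ℝ × S) (t : ℝ) (v : E3) : S :=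
  if h : ∃ y, M.Reaches p v t y then h.choose else p.2

/-- `𝓖_p` is nonsingular at `(t, ξ)`: the differential of `𝓖_p(t, ·)` on the unit sphere is
injective at `ξ`. -/
def NonsingularAt (p : ℝ × S) (t : ℝ) (ξ : E3) : Prop :=
  ∀ w : E3, M.metric p.1 p.2 ξ w = 0 →
    mfderiv 𝓘(ℝ, E3) 𝓘(ℝ, E3) (M.nullExp p t) ξ w = 0 → w = 0

/-- The null radius of conjugacy `s_*(p, t)`: the supremum of the `σ` such that `𝓖_p` is a local
diffeomorphism onto its image (an immersion) in the time slab `(t(p) - σ, t(p))`. -/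
def conjugacyRadius (p : ℝ × S) : EReal :=
  sSup {σ : EReal | ∀ t ∈ M.I, t < p.1 → ((p.1 - t : ℝ) : EReal) < σ →
    ∀ ξ ∈ M.unitSphere p, (∃ y, M.Reaches p ξ t y) → M.NonsingularAt p t ξ}

/-- `ℓ_*(p, t)`: the infimum of the `t(p) - t` such that two distinct past null geodesics from `p`
meet on the leaf at time `t < t(p)` (it is `⊤` if there are none). -/
def intersectionRadius (p : ℝ × S) : EReal :=
  sInf {σ : EReal | ∃ t ∈ M.I, t < p.1 ∧ σ = ((p.1 - t : ℝ) : EReal) ∧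
    ∃ ξ₁ ∈ M.unitSphere p, ∃ ξ₂ ∈ M.unitSphere p, ξ₁ ≠ ξ₂ ∧
      ∃ y, M.Reaches p ξ₁ t y ∧ M.Reaches p ξ₂ t y}

/-- The Riemannian distance of the leaf at time `t`. -/
def leafEDist (t : ℝ) (x y : S) : ENNReal :=
  letI : ∀ x : S, ENorm (TangentSpace 𝓘(ℝ, E3) x) :=
    fun x => ⟨fun v => ENNReal.ofReal (Real.sqrt (M.metric t x v v))⟩
  Manifold.riemannianEDist 𝓘(ℝ, E3) x y

/-- The leaf at time `t` is complete: Cauchy sequences for the Riemannian distance converge. -/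
def IsCompleteLeaf (t : ℝ) : Prop :=
  ∀ u : ℕ → S, (∀ ε : ENNReal, 0 < ε → ∃ N, ∀ i ≥ N, ∀ j ≥ N, M.leafEDist t (u i) (u j) < ε) →
    ∃ x, Filter.Tendsto u Filter.atTop (𝓝 x)

/-- The components tangent to the leaves of the deformation tensor `π = 𝓛_T 𝐠` of the unit normal
`T = n⁻¹ ∂_t`. -/
def deformation (t : ℝ) (x : S) (v w : TangentSpace 𝓘(ℝ, E3) x) : ℝ :=
  (M.lapse t x)⁻¹ * deriv (fun t' => M.metric t' x v w) t

/-- At a common point `γ s = lam s'`, the projections of the two velocities to the tangent space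
of the leaf lie on one line and point in opposite directions. -/
def OppositeAt (γ : ℝ → ℝ × S) (s : ℝ) (lam : ℝ → ℝ × S) (s' : ℝ) : Prop :=
  leafVelocity γ s ≠ 0 ∧ ∃ κ : ℝ, 0 < κ ∧ leafVelocity lam s' = -κ • leafVelocity γ s

end FoliatedSpacetime

end

/-! Call two different past null geodesics from p to q a crossing. Among all crossings between the
times t(q₀) and t(p₀), take one for which t(p) - t(q) is least; the claim is that this crossing is
opposite at both ends.

Existence of the minimum (`exists_minimal_crossing`). A4 confines the upper vertices of a minimizing
sequence to the compact set, since their extents eventually fall below δ_* ≤ δ₀. The initial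
directions range over a compact sphere, and completeness together with the bounds on lapse and
deformation makes every past null geodesic reach every earlier leaf (`exists_reaches`). Hence the
two geodesics converge along an ultrafilter (`Joins.exists_limit`). The danger is that the two
limits coincide. If the limit extent is zero, both limiting velocities vanish, and there the
derivative of the end point in the velocity is the identity. If it is positive, minimality says that
no crossing from the limit vertex arrives later than the limit time, so ℓ_* is at least the limit
extent, which is also below δ_*; thus s_* exceeds this extent and the null exponential map is
nonsingular. In both cases the end point map is locally injective in the velocity, uniformly in the
vertex, which excludes two different geodesics from one vertex to one end point near a common limit.

Opposite directions (`Crossing.exists_multipliers`). Fix the leaf of the upper vertex, and vary the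
vertex in it and the two velocities, subject to both being null and both geodesics ending at the
same space-time point at parameter 1. The minimal crossing has locally the latest arrival time.
Lagrange multipliers and the first variation formula for the geodesic flow give numbers c₁, c₂, not
both zero, for which c₁ v₁ + c₂ v₂ = 0 holds for the leaf velocities at the top and, with the same
coefficients, at the bottom. Two geodesics of a crossing cannot start in the same direction, so
c₁/c₂ > 0, and the velocities are opposite at both ends.

All variations are made in the full four-dimensional velocity space, with geodesics normalized to
the parameter interval [0, 1]. `IsFlowMap.injective_of_nonsingularAt` passes from nonsingularity of
the null exponential map on the sphere of directions to nonsingularity of the end point map there;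
its inputs are the first variation formula, which keeps a kernel vector tangent to the null cone,
and homogeneity of the flow. -/

section LocalFlow

/-! ### Local flows of vector fields and their differentiability in the initial value. -/

open Metric Set NNReal

variable {E : Type*} [NormedAddCommGroup E] [NormedSpace ℝ E]

lemma HasDerivAt.fst_comp {F : Type*} [NormedAddCommGroup F] [NormedSpace ℝ F] {f : ℝ → E × F}
    {f' : E × F} {t : ℝ} (h : HasDerivAt f f' t) : HasDerivAt (fun t => (f t).1) f'.1 t :=
  (ContinuousLinearMap.fst ℝ E F).hasFDerivAt.comp_hasDerivAt t h

lemma HasDerivAt.snd_comp {F : Type*} [NormedAddCommGroup F] [NormedSpace ℝ F] {f : ℝ → E × F}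
    {f' : E × F} {t : ℝ} (h : HasDerivAt f f' t) : HasDerivAt (fun t => (f t).2) f'.2 t :=
  (ContinuousLinearMap.snd ℝ E F).hasFDerivAt.comp_hasDerivAt t h

lemma gronwallBound_zero_left (K e t : ℝ) :
    gronwallBound 0 K e t = e * gronwallBound 0 K 1 t := by
  by_cases hK : K = 0
  · subst hK; simp [gronwallBound_K0]
  · simp only [gronwallBound_of_K_ne_0 hK]; ring

/-- The flow of a vector field with Lipschitz derivative is strictly differentiable in the initial
value, with derivative the solution of the linearized equation. -/
lemma hasStrictFDerivAt_flow {V : E → E} {s : Set E} (hs : Convex ℝ s) {K L : ℝ≥0}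
    (hd : ∀ y ∈ s, DifferentiableAt ℝ V y) (hK : ∀ y ∈ s, ‖fderiv ℝ V y‖ ≤ K)
    (hL : LipschitzOnWith L (fderiv ℝ V) s) {φ : E → ℝ → E} {A : ℝ → E →L[ℝ] E} {x : E} {t : ℝ}
    (ht : 0 ≤ t)
    (hφ : ∀ᶠ y in 𝓝 x, φ y 0 = y ∧ ∀ τ ∈ Icc 0 t, φ y τ ∈ s ∧
      HasDerivAt (φ y) (V (φ y τ)) τ)
    (hA0 : A 0 = ContinuousLinearMap.id ℝ E)
    (hA : ∀ τ ∈ Icc 0 t, HasDerivAt A ((fderiv ℝ V (φ x τ)).comp (A τ)) τ) :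
    HasStrictFDerivAt (fun y => φ y t) (A t) x := by
  have hlip : LipschitzOnWith K V s :=
    hs.lipschitzOnWith_of_nnnorm_fderiv_le hd (fun y hy => by exact_mod_cast hK y hy)
  obtain ⟨hx0, hx⟩ := hφ.self_of_nhds
  set C : ℝ := Real.exp (K * t) with hC
  have hC0 : 0 < C := Real.exp_pos _
  have hdist : ∀ y z, (φ y 0 = y ∧ ∀ τ ∈ Icc 0 t, φ y τ ∈ s ∧ HasDerivAt (φ y) (V (φ y τ)) τ) →
      (φ z 0 = z ∧ ∀ τ ∈ Icc 0 t, φ z τ ∈ s ∧ HasDerivAt (φ z) (V (φ z τ)) τ) →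
      ∀ τ ∈ Icc 0 t, ‖φ y τ - φ z τ‖ ≤ C * ‖y - z‖ := by
    intro y z hy hz τ hτ
    have h := dist_le_of_trajectories_ODE_of_mem (v := fun _ => V) (s := fun _ => s) (K := K)
      (f := φ y) (g := φ z) (a := 0) (b := t) (δ := ‖y - z‖) (fun _ _ => hlip)
      (fun τ hτ => (hy.2 τ hτ).2.continuousAt.continuousWithinAt)
      (fun τ hτ => (hy.2 τ (Ico_subset_Icc_self hτ)).2.hasDerivWithinAt)
      (fun τ hτ => (hy.2 τ (Ico_subset_Icc_self hτ)).1)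
      (fun τ hτ => (hz.2 τ hτ).2.continuousAt.continuousWithinAt)
      (fun τ hτ => (hz.2 τ (Ico_subset_Icc_self hτ)).2.hasDerivWithinAt)
      (fun τ hτ => (hz.2 τ (Ico_subset_Icc_self hτ)).1)
      (by rw [hy.1, hz.1, dist_eq_norm]) τ hτ
    rw [dist_eq_norm] at h
    refine h.trans ?_
    rw [mul_comm C]
    gcongr
    simp only [sub_zero, hC]
    gcongr
    exact hτ.2
  set D : ℝ := gronwallBound 0 K 1 t with hD
  -- Comparing two arbitrary nearby trajectories, not just one with the trajectory of x, is what
  -- yields strict differentiability: the remainder is bounded by the distance to x times ‖y - z‖.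
  have key : ∀ y z, (φ y 0 = y ∧ ∀ τ ∈ Icc 0 t, φ y τ ∈ s ∧ HasDerivAt (φ y) (V (φ y τ)) τ) →
      (φ z 0 = z ∧ ∀ τ ∈ Icc 0 t, φ z τ ∈ s ∧ HasDerivAt (φ z) (V (φ z τ)) τ) →
      ‖φ y t - φ z t - A t (y - z)‖ ≤
        (L * C * max ‖y - x‖ ‖z - x‖ * (C * ‖y - z‖)) * D := by
    intro y z hy hz
    set ρ := max ‖y - x‖ ‖z - x‖ with hρ
    have hderiv : ∀ τ ∈ Icc 0 t, HasDerivAt (fun τ => φ y τ - φ z τ - A τ (y - z))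
        (V (φ y τ) - V (φ z τ) - fderiv ℝ V (φ x τ) (A τ (y - z))) τ := fun τ hτ =>
      ((hy.2 τ hτ).2.sub (hz.2 τ hτ).2).sub (by
        have h1 := (hA τ hτ).clm_apply (hasDerivAt_const τ (y - z))
        simpa using h1)
    have := norm_le_gronwallBound_of_norm_deriv_right_le (δ := 0) (K := K)
      (ε := L * C * ρ * (C * ‖y - z‖)) (a := 0) (b := t)
      (f := fun τ => φ y τ - φ z τ - A τ (y - z))
      (fun τ hτ => (hderiv τ hτ).continuousAt.continuousWithinAt)
      (fun τ hτ => (hderiv τ (Ico_subset_Icc_self hτ)).hasDerivWithinAt)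
      (by simp [hy.1, hz.1, hA0]) ?_ t ⟨ht, le_rfl⟩
    · rw [sub_zero, gronwallBound_zero_left] at this
      exact this
    · intro τ hτ
      replace hτ := Ico_subset_Icc_self hτ
      have hyx := hdist y x hy ⟨hx0, hx⟩ τ hτ
      have hzx := hdist z x hz ⟨hx0, hx⟩ τ hτ
      have hyz := hdist y z hy hz τ hτ
      have hy' : φ y τ ∈ s ∩ closedBall (φ x τ) (C * ρ) := by
        refine ⟨(hy.2 τ hτ).1, ?_⟩
        rw [mem_closedBall_iff_norm]
        exact hyx.trans (by gcongr; exact le_max_left _ _)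
      have hz' : φ z τ ∈ s ∩ closedBall (φ x τ) (C * ρ) := by
        refine ⟨(hz.2 τ hτ).1, ?_⟩
        rw [mem_closedBall_iff_norm]
        exact hzx.trans (by gcongr; exact le_max_right _ _)
      -- Mean value inequality for V minus its linearization at φ x τ, on a ball that contains both
      -- trajectories; the Lipschitz bound on the derivative makes the constant proportional to ρ.
      have hmv := (hs.inter (convex_closedBall (φ x τ) (C * ρ))).norm_image_sub_le_of_norm_fderiv_le'
        (𝕜 := ℝ) (f := V) (φ := fderiv ℝ V (φ x τ)) (C := L * (C * ρ))
        (fun w hw => hd w hw.1) (fun w hw => by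
          have h1 := hL.dist_le_mul w hw.1 (φ x τ) (hx τ hτ).1
          rw [dist_eq_norm] at h1
          refine h1.trans ?_
          gcongr
          exact hw.2) hz' hy'
      have : V (φ y τ) - V (φ z τ) - fderiv ℝ V (φ x τ) (A τ (y - z)) =
          fderiv ℝ V (φ x τ) (φ y τ - φ z τ - A τ (y - z)) +
          (V (φ y τ) - V (φ z τ) - fderiv ℝ V (φ x τ) (φ y τ - φ z τ)) := by
        simp only [map_sub]; abel
      rw [this]
      refine (norm_add_le _ _).trans (add_le_add ?_ ?_)
      · exact (ContinuousLinearMap.le_opNorm _ _).trans (by gcongr; exact hK _ (hx τ hτ).1)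
      · refine hmv.trans ?_
        calc L * (C * ρ) * ‖φ y τ - φ z τ‖ ≤ L * (C * ρ) * (C * ‖y - z‖) := by
              have : 0 ≤ ρ := (norm_nonneg _).trans (le_max_left _ _)
              gcongr
          _ = _ := by ring
  refine .of_isLittleO ?_
  rw [Asymptotics.isLittleO_iff]
  intro c hc
  have hcont : Filter.Tendsto (fun p : E × E => L * C * max ‖p.1 - x‖ ‖p.2 - x‖ * C * D)
      (𝓝 (x, x)) (𝓝 0) := by
    have : Continuous (fun p : E × E => L * C * max ‖p.1 - x‖ ‖p.2 - x‖ * C * D) := by fun_prop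
    simpa using this.tendsto (x, x)
  filter_upwards [hcont.eventually (gt_mem_nhds hc), nhds_prod_eq (x := x) (y := x) ▸ Filter.Eventually.prod_mk hφ hφ] with p hp hp'
  refine (key p.1 p.2 hp'.1 hp'.2).trans ?_
  calc _ = (L * C * max ‖p.1 - x‖ ‖p.2 - x‖ * C * D) * ‖p.1 - p.2‖ := by ring
    _ ≤ _ := by gcongr

/-- Local flow of a `C²` vector field, with its derivative with respect to the initial value. -/
theorem ContDiffAt.exists_local_flow [CompleteSpace E] {V : E → E} {a₀ : E} {U : Set E}
    (hV : ContDiffAt ℝ 2 V a₀) (hU : U ∈ 𝓝 a₀) :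
    ∃ r > (0 : ℝ), ∃ ε > (0 : ℝ), ∃ (φ : E → ℝ → E) (A : E → ℝ → E →L[ℝ] E),
      ∀ x ∈ ball a₀ r, φ x 0 = x ∧ A x 0 = ContinuousLinearMap.id ℝ E ∧
        ∀ t ∈ Ioo (-ε) ε, φ x t ∈ U ∧ HasDerivAt (φ x) (V (φ x t)) t ∧
          HasDerivAt (A x) ((fderiv ℝ V (φ x t)).comp (A x t)) t ∧
          (0 ≤ t → HasStrictFDerivAt (fun y => φ y t) (A x t) x) := by
  have hdV : ContDiffAt ℝ 1 (fderiv ℝ V) a₀ := hV.fderiv_right (by norm_num)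
  -- The vector field and its linearized equation are solved as one system. It is C¹ because V is
  -- C², so Picard–Lindelöf applies, and the initial value (x, id) produces the candidate derivative
  -- along with the flow.
  set W : E × (E →L[ℝ] E) → E × (E →L[ℝ] E) := fun p => (V p.1, (fderiv ℝ V p.1).comp p.2)
  have hW : ContDiffAt ℝ 1 W (a₀, ContinuousLinearMap.id ℝ E) := by
    refine ContDiffAt.prodMk ?_ ?_
    · exact (hV.of_le (by norm_num)).comp (a₀, ContinuousLinearMap.id ℝ E) contDiffAt_fst
    · exact ContDiffAt.clm_comp (hdV.comp (a₀, ContinuousLinearMap.id ℝ E) contDiffAt_fst)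
        contDiffAt_snd
  obtain ⟨ε, hε, a, r, L, K, hr, hpl⟩ := IsPicardLindelof.of_contDiffAt_one hW
  obtain ⟨α, hα, hαc⟩ := (hpl 0).exists_forall_mem_closedBall_eq_hasDerivWithinAt_continuousOn
  obtain ⟨L₂, s₂, hs₂, hL₂⟩ := hdV.exists_lipschitzOnWith
  have hbdd : ∀ᶠ y in 𝓝 a₀, ‖fderiv ℝ V y‖ < ‖fderiv ℝ V a₀‖ + 1 :=
    hdV.continuousAt.norm.eventually (gt_mem_nhds (by linarith))
  have hdiff : ∀ᶠ y in 𝓝 a₀, DifferentiableAt ℝ V y :=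
    (hV.eventually (by simp)).mono fun y hy => hy.differentiableAt (by norm_num)
  obtain ⟨R, hR, hRs⟩ := Metric.mem_nhds_iff.1
    (Filter.inter_mem (Filter.inter_mem hU hs₂) (Filter.inter_mem hbdd hdiff))
  set K₁ : ℝ≥0 := ⟨‖fderiv ℝ V a₀‖ + 1, by positivity⟩ with hK₁
  simp only [zero_sub, zero_add] at hα hαc
  have hc : ContinuousAt α ((a₀, ContinuousLinearMap.id ℝ E), 0) := by
    refine hαc.continuousAt ?_
    exact prod_mem_nhds (closedBall_mem_nhds _ hr) (Icc_mem_nhds (by linarith) hε)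
  have hα0 : α ((a₀, ContinuousLinearMap.id ℝ E), 0) = (a₀, ContinuousLinearMap.id ℝ E) :=
    (hα _ (mem_closedBall_self r.2)).1
  have hin : ∀ᶠ q : (E × (E →L[ℝ] E)) × ℝ in 𝓝 ((a₀, ContinuousLinearMap.id ℝ E), 0),
      (α q).1 ∈ ball a₀ R := by
    have h1 : ContinuousAt (fun q => (α q).1) ((a₀, ContinuousLinearMap.id ℝ E), (0 : ℝ)) :=
      continuous_fst.continuousAt.comp hc
    refine h1.eventually (isOpen_ball.mem_nhds ?_)
    change (α _).1 ∈ _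
    rw [hα0]; exact mem_ball_self hR
  rw [nhds_prod_eq, nhds_prod_eq] at hin
  obtain ⟨pa, hpa, pb, hpb, hab⟩ := Filter.eventually_prod_iff.1 hin
  obtain ⟨pc, hpc, pd, hpd, hcd⟩ := Filter.eventually_prod_iff.1 hpa
  obtain ⟨r₁, hr₁, hr₁'⟩ := Metric.eventually_nhds_iff_ball.1 hpc
  obtain ⟨ε₁, hε₁, hε₁'⟩ := Metric.eventually_nhds_iff_ball.1 hpb
  have hid := hpd.self_of_nhds
  refine ⟨min r r₁, lt_min hr hr₁, min ε ε₁, lt_min hε hε₁,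
    fun x t => (α ((x, ContinuousLinearMap.id ℝ E), t)).1,
    fun x t => (α ((x, ContinuousLinearMap.id ℝ E), t)).2, ?_⟩
  have hmem : ∀ x ∈ ball a₀ (min (r : ℝ) r₁),
      ((x, ContinuousLinearMap.id ℝ E) : E × (E →L[ℝ] E)) ∈
        closedBall (a₀, ContinuousLinearMap.id ℝ E) (r : ℝ) := by
    intro x hx
    rw [mem_closedBall, Prod.dist_eq, dist_self, max_eq_left dist_nonneg]
    exact (mem_ball.1 hx).le.trans (min_le_left _ _)
  have hball : ∀ x ∈ ball a₀ (min (r : ℝ) r₁), ∀ t ∈ Ioo (-(min ε ε₁)) (min ε ε₁),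
      (α ((x, ContinuousLinearMap.id ℝ E), t)).1 ∈ ball a₀ R := by
    intro x hx t ht
    refine hab (hcd (hr₁' x (ball_subset_ball (min_le_right _ _) hx)) hid) (hε₁' t ?_)
    rw [mem_ball, Real.dist_eq, sub_zero, abs_lt]
    exact ⟨(neg_le_neg (min_le_right _ _)).trans_lt ht.1, ht.2.trans_le (min_le_right _ _)⟩
  have hder : ∀ x ∈ ball a₀ (min (r : ℝ) r₁), ∀ t ∈ Ioo (-(min ε ε₁)) (min ε ε₁),
      HasDerivAt (fun t => α ((x, ContinuousLinearMap.id ℝ E), t))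
        (W (α ((x, ContinuousLinearMap.id ℝ E), t))) t := by
    intro x hx t ht
    have h1 : -ε < t := (neg_le_neg (min_le_left _ _)).trans_lt ht.1
    have h2 : t < ε := ht.2.trans_le (min_le_left _ _)
    exact ((hα _ (hmem x hx)).2 t ⟨h1.le, h2.le⟩).hasDerivAt (Icc_mem_nhds h1 h2)
  have hφ : ∀ x ∈ ball a₀ (min (r : ℝ) r₁), ∀ t ∈ Ioo (-(min ε ε₁)) (min ε ε₁),
      HasDerivAt (fun t => (α ((x, ContinuousLinearMap.id ℝ E), t)).1)
        (V (α ((x, ContinuousLinearMap.id ℝ E), t)).1) t := fun x hx t ht =>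
    (hder x hx t ht).fst_comp
  have hA : ∀ x ∈ ball a₀ (min (r : ℝ) r₁), ∀ t ∈ Ioo (-(min ε ε₁)) (min ε ε₁),
      HasDerivAt (fun t => (α ((x, ContinuousLinearMap.id ℝ E), t)).2)
        ((fderiv ℝ V (α ((x, ContinuousLinearMap.id ℝ E), t)).1).comp
          (α ((x, ContinuousLinearMap.id ℝ E), t)).2) t := fun x hx t ht =>
    (hder x hx t ht).snd_comp
  have h0 : ∀ x ∈ ball a₀ (min (r : ℝ) r₁), α ((x, ContinuousLinearMap.id ℝ E), 0) =
      (x, ContinuousLinearMap.id ℝ E) := fun x hx => (hα _ (hmem x hx)).1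
  intro x hx
  refine ⟨by simp only [h0 x hx], by simp only [h0 x hx], fun t ht => ⟨(hRs (hball x hx t ht)).1.1,
    hφ x hx t ht, hA x hx t ht, fun ht0 => ?_⟩⟩
  have hsub : ∀ τ ∈ Icc 0 t, τ ∈ Ioo (-(min ε ε₁)) (min ε ε₁) := fun τ hτ =>
    ⟨(by have := lt_min hε hε₁; linarith [hτ.1]), hτ.2.trans_lt ht.2⟩
  refine hasStrictFDerivAt_flow (K := K₁) (L := L₂) (convex_ball a₀ R)
    (fun y hy => (hRs hy).2.2) (fun y hy => le_of_lt (hRs hy).2.1)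
    (hL₂.mono fun y hy => (hRs hy).1.2) ht0
    (φ := fun x t => (α ((x, ContinuousLinearMap.id ℝ E), t)).1) ?_
    (A := fun t => (α ((x, ContinuousLinearMap.id ℝ E), t)).2) (by simp only [h0 x hx])
    (fun τ hτ => hA x hx τ (hsub τ hτ))
  filter_upwards [isOpen_ball.mem_nhds hx] with y hy
  exact ⟨by simp only [h0 y hy], fun τ hτ => ⟨hball y hy τ (hsub τ hτ), hφ y hy τ (hsub τ hτ)⟩⟩

end LocalFlow

/-! ### The geodesic equation of a metric on a normed space. -/

noncomputable section

section CoordinateGeometry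

set_option maxSynthPendingDepth 3

variable {F : Type*} [NormedAddCommGroup F] [NormedSpace ℝ F]

/-- `𝐠(A, W) + Γ(W; X, X)` at `z`, for a metric `G` on a normed space. -/
def accelForm (G : F → F →L[ℝ] F →L[ℝ] ℝ) (z X A W : F) : ℝ :=
  G z A W + fderiv ℝ G z X X W - (1 / 2) * fderiv ℝ G z W X X

/-- The acceleration of a geodesic through `z` with velocity `X`. -/
def geodesicAccel (G : F → F →L[ℝ] F →L[ℝ] ℝ) (z X : F) : F :=
  (G z).inverse (-(fderiv ℝ G z X X) + (1 / 2 : ℝ) • ((fderiv ℝ G z).flip X).flip X)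

/-- The geodesic vector field on phase space. -/
def geodesicSpray (G : F → F →L[ℝ] F →L[ℝ] ℝ) (a : F × F) : F × F :=
  (a.2, geodesicAccel G a.1 a.2)

lemma accelForm_geodesicAccel {G : F → F →L[ℝ] F →L[ℝ] ℝ} {z : F} (h : (G z).IsInvertible)
    (X W : F) : accelForm G z X (geodesicAccel G z X) W = 0 := by
  unfold accelForm geodesicAccel
  rw [h.self_apply_inverse]
  simp

/-- Nondegeneracy turns the equation tested against every W into an explicit second order equation,
to which the theory of ordinary differential equations applies. -/
lemma eq_geodesicAccel {G : F → F →L[ℝ] F →L[ℝ] ℝ} {z : F} (h : (G z).IsInvertible)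
    {X A : F} (hA : ∀ W, accelForm G z X A W = 0) : A = geodesicAccel G z X := by
  apply h.injective
  ext W
  have h1 := hA W
  have h2 := accelForm_geodesicAccel h X W
  unfold accelForm at h1 h2
  linarith

lemma contDiffAt_geodesicSpray [CompleteSpace F] {G : F → F →L[ℝ] F →L[ℝ] ℝ} {a : F × F}
    (hG : ContDiffAt ℝ ∞ G a.1) (h : (G a.1).IsInvertible) :
    ContDiffAt ℝ 2 (geodesicSpray G) a := by
  have hG2 : ContDiffAt ℝ 2 G a.1 := hG.of_le (by norm_cast)
  have hD : ContDiffAt ℝ 2 (fderiv ℝ G) a.1 :=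
    (hG.of_le (n := ∞) (m := 3) (by norm_cast)).fderiv_right (by norm_num)
  have hD1 : ContDiffAt ℝ 2 (fun a : F × F => fderiv ℝ G a.1) a := hD.comp a contDiffAt_fst
  have hflip : ContDiffAt ℝ 2 (fun a : F × F => (fderiv ℝ G a.1).flip) a :=
    (ContinuousLinearMap.flipₗᵢ ℝ F F (F →L[ℝ] ℝ)).contDiff.contDiffAt.comp a hD1
  have hflip2 : ContDiffAt ℝ 2 (fun a : F × F => ((fderiv ℝ G a.1).flip a.2).flip) a :=
    (ContinuousLinearMap.flipₗᵢ ℝ F F ℝ).contDiff.contDiffAt.comp a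
      (hflip.clm_apply contDiffAt_snd)
  refine contDiffAt_snd.prodMk ?_
  have hinv : ContDiffAt ℝ 2 (fun a : F × F => (G a.1).inverse) a :=
    ContDiffAt.comp (g := ContinuousLinearMap.inverse) a h.contDiffAt_map_inverse
      (hG2.comp a contDiffAt_fst)
  have hsm : ContDiffAt ℝ 2
      (fun a : F × F => (1 / 2 : ℝ) • ((fderiv ℝ G a.1).flip a.2).flip a.2) a :=
    (hflip2.clm_apply contDiffAt_snd).const_smul _
  exact hinv.clm_apply
    ((((hD1.clm_apply contDiffAt_snd).clm_apply contDiffAt_snd).neg).add hsm)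

/-- The acceleration is a tensor: it transforms by the differential of a coordinate change. -/
lemma accelForm_transform {G G₁ : F → F →L[ℝ] F →L[ℝ] ℝ} {τ : F → F} {z : F}
    (hτ : ContDiffAt ℝ 2 τ z) (hG₁ : DifferentiableAt ℝ G₁ (τ z))
    (hsymm : ∀ X Y, G₁ (τ z) X Y = G₁ (τ z) Y X)
    (hGG : ∀ᶠ z' in 𝓝 z, ∀ X Y, G z' X Y = G₁ (τ z') (fderiv ℝ τ z' X) (fderiv ℝ τ z' Y))
    (X A W : F) :
    accelForm G₁ (τ z) (fderiv ℝ τ z X) (fderiv ℝ (fderiv ℝ τ) z X X + fderiv ℝ τ z A)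
      (fderiv ℝ τ z W) = accelForm G z X A W := by
  have hdτ : DifferentiableAt ℝ (fderiv ℝ τ) z :=
    (hτ.fderiv_right (m := 1) (by norm_num)).differentiableAt (by norm_num)
  have hτ1 : DifferentiableAt ℝ τ z := hτ.differentiableAt (by norm_num)
  set H : F → F →L[ℝ] F →L[ℝ] ℝ := fun z' =>
    (G₁ (τ z')).bilinearComp (fderiv ℝ τ z') (fderiv ℝ τ z') with hH
  have hGH : G =ᶠ[𝓝 z] H := by
    filter_upwards [hGG] with z' hz'
    ext X Y
    simp [hH, hz']
  have hsnd : ∀ U V : F, fderiv ℝ (fderiv ℝ τ) z U V = fderiv ℝ (fderiv ℝ τ) z V U := by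
    intro U V
    exact hτ.isSymmSndFDerivAt (by simp) U V
  -- derivative of `H`, evaluated on fixed vectors
  have hHd : DifferentiableAt ℝ H z := by
    have : H = fun z' => ((ContinuousLinearMap.compL ℝ F F ℝ).flip (fderiv ℝ τ z')).comp
        ((G₁ (τ z')).comp (fderiv ℝ τ z')) := by
      funext z'; ext X Y; simp [hH]
    rw [this]
    refine DifferentiableAt.clm_comp ?_ (DifferentiableAt.clm_comp (hG₁.comp z hτ1) hdτ)
    exact ((ContinuousLinearMap.compL ℝ F F ℝ).flip).differentiableAt.comp z hdτ
  have hval : ∀ U X Y : F, fderiv ℝ H z U X Y =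
      fderiv ℝ G₁ (τ z) (fderiv ℝ τ z U) (fderiv ℝ τ z X) (fderiv ℝ τ z Y)
        + G₁ (τ z) (fderiv ℝ (fderiv ℝ τ) z U X) (fderiv ℝ τ z Y)
        + G₁ (τ z) (fderiv ℝ τ z X) (fderiv ℝ (fderiv ℝ τ) z U Y) := by
    intro U X Y
    have h1 : HasFDerivAt (fun z' => H z' X Y)
        (((ContinuousLinearMap.apply ℝ ℝ Y).comp
          (ContinuousLinearMap.apply ℝ (F →L[ℝ] ℝ) X)).comp (fderiv ℝ H z)) z :=
      ((ContinuousLinearMap.apply ℝ ℝ Y).comp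
          (ContinuousLinearMap.apply ℝ (F →L[ℝ] ℝ) X)).hasFDerivAt.comp z hHd.hasFDerivAt
    have hX : HasFDerivAt (fun z' => fderiv ℝ τ z' X) ((fderiv ℝ (fderiv ℝ τ) z).flip X) z := by
      have := hdτ.hasFDerivAt.clm_apply (hasFDerivAt_const X z)
      simpa using this
    have hY : HasFDerivAt (fun z' => fderiv ℝ τ z' Y) ((fderiv ℝ (fderiv ℝ τ) z).flip Y) z := by
      have := hdτ.hasFDerivAt.clm_apply (hasFDerivAt_const Y z)
      simpa using this
    have h2 := ((hG₁.hasFDerivAt.comp z hτ1.hasFDerivAt).clm_apply hX).clm_apply hY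
    have h3 := h1.unique h2
    have h4 := congrArg (fun L => L U) h3
    simp at h4
    rw [h4]
    ring
  unfold accelForm
  rw [hGH.fderiv_eq, hval, hval, hGH.self_of_nhds]
  simp only [hH, ContinuousLinearMap.bilinearComp_apply, map_add, add_apply]
  -- By symmetry of second derivatives and of the metric, the terms containing D²τ(X, W) cancel. The
  -- term D²τ(X, X) that survives is exactly the inhomogeneous part in the transformation of the
  -- second derivative of a curve.
  rw [hsnd W X, hsymm (fderiv ℝ (fderiv ℝ τ) z X W)]
  ring

/-- A nondegenerate bilinear form on a finite-dimensional space is invertible. -/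
lemma isInvertible_of_nondegenerate [FiniteDimensional ℝ F] (B : F →L[ℝ] F →L[ℝ] ℝ)
    (h : ∀ X, (∀ W, B X W = 0) → X = 0) : B.IsInvertible := by
  have hinj : Function.Injective B.toLinearMap := by
    rw [← LinearMap.ker_eq_bot, LinearMap.ker_eq_bot']
    intro X hX
    exact h X fun W => by
      have := congrArg (fun L : F →L[ℝ] ℝ => L W) hX
      simpa using this
  have hfin : Module.finrank ℝ F = Module.finrank ℝ (F →L[ℝ] ℝ) := by
    rw [← (LinearMap.toContinuousLinearMap (𝕜 := ℝ) (E := F) (F' := ℝ)).finrank_eq]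
    exact (Subspace.dual_finrank_eq (K := ℝ) (V := F)).symm
  let e := LinearEquiv.ofInjectiveOfFinrankEq B.toLinearMap hinj hfin
  refine ⟨e.toContinuousLinearEquiv, ?_⟩
  ext X W
  rfl

end CoordinateGeometry

end

/-! ### Charts of S and the space-time metric in coordinates. -/

noncomputable section

namespace FoliatedSpacetime

set_option maxSynthPendingDepth 3

variable {S : Type*} [TopologicalSpace S] [ChartedSpace E3 S]

/-- The chart of `S` around `x₀`. -/
abbrev chart (x₀ : S) : PartialEquiv S E3 := extChartAt 𝓘(ℝ, E3) x₀

/-- The differential of a chart. -/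
def chartDeriv (x₀ x : S) : E3 →L[ℝ] E3 := mfderiv 𝓘(ℝ, E3) 𝓘(ℝ, E3) (chart x₀) x

/-- The differential of an inverse chart. -/
def chartSymmDeriv (x₀ : S) (y : E3) : E3 →L[ℝ] E3 :=
  mfderiv 𝓘(ℝ, E3) 𝓘(ℝ, E3) (chart x₀).symm y

lemma isOpen_chart_target (x₀ : S) : IsOpen (chart x₀).target := isOpen_extChartAt_target x₀

/-- The set of coordinate points of the chart around `x₀` lying in the chart around `x₁`. -/
def overlap (x₀ x₁ : S) : Set (ℝ × E3) :=
  {z | z.2 ∈ (chart x₀).target ∧ (chart x₀).symm z.2 ∈ (chart x₁).source}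

/-- The change of coordinates of `ℝ × S` between two charts of `S`. -/
def chartChange (x₀ x₁ : S) (z : ℝ × E3) : ℝ × E3 := (z.1, chart x₁ ((chart x₀).symm z.2))

/-- The differential of `chartChange`. -/
def chartChangeDeriv (x₀ x₁ : S) (z : ℝ × E3) : ℝ × E3 →L[ℝ] ℝ × E3 :=
  (ContinuousLinearMap.id ℝ ℝ).prodMap
    ((chartDeriv x₁ ((chart x₀).symm z.2)).comp (chartSymmDeriv x₀ z.2))

lemma isOpen_overlap (x₀ x₁ : S) : IsOpen (overlap x₀ x₁) := by
  have h : IsOpen ((chart x₀).target ∩ (chart x₀).symm ⁻¹' (chart x₁).source) :=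
    (continuousOn_extChartAt_symm x₀).isOpen_inter_preimage (isOpen_chart_target x₀)
      (isOpen_extChartAt_source x₁)
  exact h.preimage continuous_snd

lemma chart_symm_chartChange {x₀ x₁ : S} {z : ℝ × E3} (hz : z ∈ overlap x₀ x₁) :
    (chart x₁).symm (chartChange x₀ x₁ z).2 = (chart x₀).symm z.2 :=
  (chart x₁).left_inv hz.2

section Charts

variable [IsManifold 𝓘(ℝ, E3) ∞ S]

lemma mdifferentiableAt_chart_symm {x₀ : S} {y : E3} (hy : y ∈ (chart x₀).target) :
    MDifferentiableAt 𝓘(ℝ, E3) 𝓘(ℝ, E3) (chart x₀).symm y := by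
  have h := mdifferentiableWithinAt_extChartAt_symm (I := 𝓘(ℝ, E3)) hy
  rwa [ModelWithCorners.range_eq_univ, mdifferentiableWithinAt_univ] at h

lemma mdifferentiableAt_chart {x₀ x : S} (hx : x ∈ (chart x₀).source) :
    MDifferentiableAt 𝓘(ℝ, E3) 𝓘(ℝ, E3) (chart x₀) x :=
  mdifferentiableAt_extChartAt (by rwa [extChartAt_source] at hx)

lemma chartSymmDeriv_chartDeriv {x₀ x : S} (hx : x ∈ (chart x₀).source) (v : E3) :
    chartSymmDeriv x₀ (chart x₀ x) (chartDeriv x₀ x v) = v := by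
  have h := mfderivWithin_extChartAt_symm_comp_mfderiv_extChartAt' (I := 𝓘(ℝ, E3)) hx
  rw [ModelWithCorners.range_eq_univ, mfderivWithin_univ] at h
  exact congrArg (fun L => L v) h

lemma chartDeriv_chartSymmDeriv {x₀ x : S} (hx : x ∈ (chart x₀).source) (v : E3) :
    chartDeriv x₀ x (chartSymmDeriv x₀ (chart x₀ x) v) = v := by
  have h := mfderiv_extChartAt_comp_mfderivWithin_extChartAt_symm' (I := 𝓘(ℝ, E3)) hx
  rw [ModelWithCorners.range_eq_univ, mfderivWithin_univ] at h
  exact congrArg (fun L => L v) h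

lemma chartDeriv_chartSymmDeriv' {x₀ : S} {y : E3} (hy : y ∈ (chart x₀).target) (v : E3) :
    chartDeriv x₀ ((chart x₀).symm y) (chartSymmDeriv x₀ y v) = v := by
  have h := chartDeriv_chartSymmDeriv ((chart x₀).map_target hy) v
  rwa [(chart x₀).right_inv hy] at h

lemma chartSymmDeriv_chartDeriv' {x₀ : S} {y : E3} (hy : y ∈ (chart x₀).target) (v : E3) :
    chartSymmDeriv x₀ y (chartDeriv x₀ ((chart x₀).symm y) v) = v := by
  have h := chartSymmDeriv_chartDeriv ((chart x₀).map_target hy) v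
  rwa [(chart x₀).right_inv hy] at h

lemma contDiffAt_chartChange {x₀ x₁ : S} {z : ℝ × E3} (hz : z ∈ overlap x₀ x₁) :
    ContDiffAt ℝ ∞ (chartChange x₀ x₁) z := by
  have h := contDiffWithinAt_ext_coord_change (I := 𝓘(ℝ, E3)) (n := ∞) x₁ x₀ (y := z.2)
    (by simp only [PartialEquiv.trans_source, PartialEquiv.symm_source]; exact hz)
  rw [ModelWithCorners.range_eq_univ, contDiffWithinAt_univ] at h
  exact contDiffAt_fst.prodMk (h.comp z contDiffAt_snd)

lemma hasFDerivAt_chartChange {x₀ x₁ : S} {z : ℝ × E3} (hz : z ∈ overlap x₀ x₁) :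
    HasFDerivAt (chartChange x₀ x₁) (chartChangeDeriv x₀ x₁ z) z := by
  have h : HasMFDerivAt 𝓘(ℝ, E3) 𝓘(ℝ, E3) (chart x₁ ∘ (chart x₀).symm) z.2
      ((chartDeriv x₁ ((chart x₀).symm z.2)).comp (chartSymmDeriv x₀ z.2)) :=
    (mdifferentiableAt_chart hz.2).hasMFDerivAt.comp z.2
      (mdifferentiableAt_chart_symm hz.1).hasMFDerivAt
  exact HasFDerivAt.prodMap z (hasFDerivAt_id z.1) h.hasFDerivAt

lemma fderiv_chartChange {x₀ x₁ : S} {z : ℝ × E3} (hz : z ∈ overlap x₀ x₁) :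
    fderiv ℝ (chartChange x₀ x₁) z = chartChangeDeriv x₀ x₁ z :=
  (hasFDerivAt_chartChange hz).fderiv

lemma chartSymmDeriv_chartChangeDeriv {x₀ x₁ : S} {z : ℝ × E3} (hz : z ∈ overlap x₀ x₁)
    (X : ℝ × E3) :
    chartSymmDeriv x₁ (chartChange x₀ x₁ z).2 (chartChangeDeriv x₀ x₁ z X).2 =
      chartSymmDeriv x₀ z.2 X.2 :=
  chartSymmDeriv_chartDeriv hz.2 _

lemma chartChangeDeriv_surjective {x₀ x₁ : S} {z : ℝ × E3} (hz : z ∈ overlap x₀ x₁) :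
    Function.Surjective (chartChangeDeriv x₀ x₁ z) := by
  intro Y
  refine ⟨(Y.1, chartDeriv x₀ ((chart x₀).symm z.2)
    (chartSymmDeriv x₁ (chart x₁ ((chart x₀).symm z.2)) Y.2)), ?_⟩
  refine Prod.ext rfl ?_
  change chartDeriv x₁ _ (chartSymmDeriv x₀ z.2 (chartDeriv x₀ _ _)) = Y.2
  rw [chartSymmDeriv_chartDeriv' hz.1, chartDeriv_chartSymmDeriv hz.2]

lemma chartSymmDeriv_eq_zero {x₀ : S} {y : E3} (hy : y ∈ (chart x₀).target) {v : E3}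
    (h : chartSymmDeriv x₀ y v = 0) : v = 0 := by
  rw [← chartDeriv_chartSymmDeriv' hy v, h, map_zero]

end Charts

variable (M : FoliatedSpacetime S)

/-- The coordinate domain of the chart around `x₀`. -/
def coordDomain (x₀ : S) : Set (ℝ × E3) := M.J ×ˢ (chart x₀).target

/-- The metric `g_t`, as a bilinear form on the model space. -/
def leafMetric (t : ℝ) (x : S) : E3 →L[ℝ] E3 →L[ℝ] ℝ := M.metric t x

/-- The space-time metric in a chart, as a bilinear form. -/
def chartMetric (x₀ : S) (z : ℝ × E3) : ℝ × E3 →L[ℝ] ℝ × E3 →L[ℝ] ℝ :=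
  (-(M.lapse z.1 ((chart x₀).symm z.2)) ^ 2) •
      (ContinuousLinearMap.fst ℝ ℝ E3).smulRight (ContinuousLinearMap.fst ℝ ℝ E3) +
    (M.leafMetric z.1 ((chart x₀).symm z.2)).bilinearComp
      ((chartSymmDeriv x₀ z.2).comp (ContinuousLinearMap.snd ℝ ℝ E3))
      ((chartSymmDeriv x₀ z.2).comp (ContinuousLinearMap.snd ℝ ℝ E3))

lemma chartMetric_apply (x₀ : S) (z X Y : ℝ × E3) :
    M.chartMetric x₀ z X Y = -(M.lapse z.1 ((chart x₀).symm z.2)) ^ 2 * X.1 * Y.1 +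
      M.leafMetric z.1 ((chart x₀).symm z.2) (chartSymmDeriv x₀ z.2 X.2)
        (chartSymmDeriv x₀ z.2 Y.2) := by
  simp [chartMetric, mul_assoc]

lemma chartMetric_eq_coordMetric (x₀ : S) (z X Y : ℝ × E3) :
    M.chartMetric x₀ z X Y = M.coordMetric x₀ z X Y := M.chartMetric_apply x₀ z X Y

lemma isOpen_coordDomain (x₀ : S) : IsOpen (M.coordDomain x₀) :=
  M.isOpen_J.prod (isOpen_chart_target x₀)

lemma contDiffAt_chartMetric {x₀ : S} {z : ℝ × E3} (hz : z ∈ M.coordDomain x₀) :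
    ContDiffAt ℝ ∞ (M.chartMetric x₀) z := by
  suffices h : ContDiffOn ℝ ∞ (M.chartMetric x₀) (M.coordDomain x₀) from
    h.contDiffAt ((M.isOpen_coordDomain x₀).mem_nhds hz)
  rw [contDiffOn_clm_apply]
  intro X
  rw [contDiffOn_clm_apply]
  intro Y
  simp only [chartMetric_eq_coordMetric]
  exact ((((M.lapse_smooth x₀).pow 2).neg.mul contDiffOn_const).mul contDiffOn_const).add
    (M.metric_smooth x₀ X.2 Y.2)

lemma chartMetric_symm {x₀ : S} {z : ℝ × E3} (hz : z ∈ M.coordDomain x₀) (X Y : ℝ × E3) :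
    M.chartMetric x₀ z X Y = M.chartMetric x₀ z Y X := by
  rw [chartMetric_apply, chartMetric_apply]
  have := M.metric_symm z.1 hz.1 ((chart x₀).symm z.2) (chartSymmDeriv x₀ z.2 X.2)
    (chartSymmDeriv x₀ z.2 Y.2)
  change M.leafMetric z.1 ((chart x₀).symm z.2) (chartSymmDeriv x₀ z.2 X.2)
    (chartSymmDeriv x₀ z.2 Y.2) = M.leafMetric z.1 ((chart x₀).symm z.2)
    (chartSymmDeriv x₀ z.2 Y.2) (chartSymmDeriv x₀ z.2 X.2) at this
  rw [this]
  ring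

lemma leafMetric_pos {t : ℝ} (ht : t ∈ M.J) (x : S) {v : E3} (hv : v ≠ 0) :
    0 < M.leafMetric t x v v := M.metric_pos t ht x v hv

lemma leafMetric_nonneg {t : ℝ} (ht : t ∈ M.J) (x : S) (v : E3) :
    0 ≤ M.leafMetric t x v v := by
  by_cases hv : v = 0
  · simp [hv]
  · exact (M.leafMetric_pos ht x hv).le

section Manifold

variable [IsManifold 𝓘(ℝ, E3) ∞ S]

/-- The metric is block diagonal: pairing with ∂_t kills the time component because the lapse is
positive, and pairing with the own spatial part kills the rest because g_t is positive definite. -/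
lemma isInvertible_chartMetric {x₀ : S} {z : ℝ × E3} (hz : z ∈ M.coordDomain x₀) :
    (M.chartMetric x₀ z).IsInvertible := by
  refine isInvertible_of_nondegenerate _ fun X hX => ?_
  have h1 := hX (1, 0)
  have h2 := hX (0, X.2)
  rw [chartMetric_apply] at h1 h2
  have hn := M.lapse_pos z.1 hz.1 ((chart x₀).symm z.2)
  simp only [map_zero, mul_one, add_zero, mul_zero, zero_add] at h1 h2
  refine Prod.ext ?_ ?_
  · rcases mul_eq_zero.1 h1 with h | h
    · exact absurd h (neg_ne_zero.2 (pow_ne_zero 2 hn.ne'))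
    · exact h
  · by_contra hne
    have : chartSymmDeriv x₀ z.2 X.2 ≠ 0 := fun h => hne (chartSymmDeriv_eq_zero hz.2 h)
    exact (M.leafMetric_pos hz.1 _ this).ne' h2

lemma contDiffAt_spray {x₀ : S} {a : (ℝ × E3) × (ℝ × E3)} (ha : a.1 ∈ M.coordDomain x₀) :
    ContDiffAt ℝ 2 (geodesicSpray (M.chartMetric x₀)) a :=
  contDiffAt_geodesicSpray (M.contDiffAt_chartMetric ha) (M.isInvertible_chartMetric ha)

lemma chartMetric_chartChange {x₀ x₁ : S} {z : ℝ × E3} (hz : z ∈ overlap x₀ x₁) (X Y : ℝ × E3) :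
    M.chartMetric x₁ (chartChange x₀ x₁ z) (chartChangeDeriv x₀ x₁ z X)
      (chartChangeDeriv x₀ x₁ z Y) = M.chartMetric x₀ z X Y := by
  rw [chartMetric_apply, chartMetric_apply, chartSymmDeriv_chartChangeDeriv hz,
    chartSymmDeriv_chartChangeDeriv hz, chart_symm_chartChange hz]
  rfl

end Manifold

end FoliatedSpacetime

end

/-! ### Geodesics on the manifold and solutions of the geodesic equation in a chart. -/

noncomputable section

/-- Bootstrapping for solutions of differential equations, used to reach the C² regularity that
`GeodAt` requires. -/
lemma contDiffAt_succ_of_hasDerivAt {F : Type*} [NormedAddCommGroup F] [NormedSpace ℝ F]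
    {f f' : ℝ → F} {s : ℝ} {n : ℕ} (h : ∀ᶠ r in 𝓝 s, HasDerivAt f (f' r) r)
    (hf' : ContDiffAt ℝ n f' s) : ContDiffAt ℝ (n + 1) f s := by
  rw [contDiffAt_succ_iff_hasFDerivAt]
  refine ⟨fun r => ContinuousLinearMap.toSpanSingleton ℝ (f' r), ⟨_, h, fun r hr => ?_⟩, ?_⟩
  · exact hr.hasFDerivAt
  · exact (ContinuousLinearMap.toSpanSingletonCLE (𝕜 := ℝ) (E := F)).contDiff.contDiffAt.comp s hf'

lemma ContDiffAt.differentiableAt_deriv {F : Type*} [NormedAddCommGroup F] [NormedSpace ℝ F]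
    {f : ℝ → F} {s : ℝ} (h : ContDiffAt ℝ 2 f s) : DifferentiableAt ℝ (deriv f) s := by
  have h1 : DifferentiableAt ℝ (fderiv ℝ f) s :=
    (h.fderiv_right (m := 1) (by norm_num)).differentiableAt (by norm_num)
  exact h1.clm_apply (differentiableAt_const 1)

namespace FoliatedSpacetime

set_option maxSynthPendingDepth 3

variable {S : Type*} [TopologicalSpace S] [ChartedSpace E3 S]

/-- Position and velocity of a curve in a chart. -/
def coordState (x₀ : S) (γ : ℝ → ℝ × S) (s : ℝ) : (ℝ × E3) × (ℝ × E3) :=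
  (coordCurve x₀ γ s, deriv (coordCurve x₀ γ) s)

/-- The action of a change of charts on position and velocity. -/
def stateChange (x₀ x₁ : S) (a : (ℝ × E3) × (ℝ × E3)) : (ℝ × E3) × (ℝ × E3) :=
  (chartChange x₀ x₁ a.1, chartChangeDeriv x₀ x₁ a.1 a.2)

/-- The curve in `ℝ × S` with a given coordinate expression. -/
def curveOfCoord (x₀ : S) (c : ℝ → ℝ × E3) (s : ℝ) : ℝ × S := ((c s).1, (chart x₀).symm (c s).2)

lemma coordCurve_congr (x₀ : S) {γ γ' : ℝ → ℝ × S} {s : ℝ} (h : γ =ᶠ[𝓝 s] γ') :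
    coordCurve x₀ γ =ᶠ[𝓝 s] coordCurve x₀ γ' := by
  filter_upwards [h] with r hr
  simp only [coordCurve, hr]

lemma coordState_congr (x₀ : S) {γ γ' : ℝ → ℝ × S} {s : ℝ} (h : γ =ᶠ[𝓝 s] γ') :
    coordState x₀ γ s = coordState x₀ γ' s := by
  have h' := coordCurve_congr x₀ h
  simp only [coordState, h'.self_of_nhds, h'.deriv_eq]

variable (M : FoliatedSpacetime S)

/-- `γ` satisfies the geodesic equation at the parameter `s`. -/
structure GeodAt (γ : ℝ → ℝ × S) (s : ℝ) : Prop where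
  mem_J : (γ s).1 ∈ M.J
  contMDiffAt : ContMDiffAt 𝓘(ℝ, ℝ) (𝓘(ℝ, ℝ).prod 𝓘(ℝ, E3)) 2 γ s
  accel : ∀ x₀ : S, (γ s).2 ∈ (chart x₀).source → ∀ W, M.covariantAcceleration x₀ γ s W = 0

variable {M}

lemma GeodAt.congr {γ γ' : ℝ → ℝ × S} {s : ℝ} (hγ : M.GeodAt γ s) (h : γ' =ᶠ[𝓝 s] γ) :
    M.GeodAt γ' s where
  mem_J := by rw [h.self_of_nhds]; exact hγ.mem_J
  contMDiffAt := hγ.contMDiffAt.congr_of_eventuallyEq h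
  accel x₀ hx W := by
    have h' := coordCurve_congr x₀ h
    rw [h.self_of_nhds] at hx
    rw [← hγ.accel x₀ hx W]
    simp only [covariantAcceleration, h'.self_of_nhds, h'.deriv_eq, h'.deriv.deriv_eq]

lemma coordCurve_mem {x₀ : S} {γ : ℝ → ℝ × S} {s : ℝ} (hJ : (γ s).1 ∈ M.J)
    (hx : (γ s).2 ∈ (chart x₀).source) : coordCurve x₀ γ s ∈ M.coordDomain x₀ :=
  ⟨hJ, (chart x₀).map_source hx⟩

lemma chart_symm_coordCurve {x₀ : S} {γ : ℝ → ℝ × S} {s : ℝ}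
    (hx : (γ s).2 ∈ (chart x₀).source) : (chart x₀).symm (coordCurve x₀ γ s).2 = (γ s).2 :=
  (chart x₀).left_inv hx

/-- Differentiating the number 𝐠(X, Y) with X and Y frozen is evaluating the derivative of the
bilinear form; this links the acceleration of the definitions to `accelForm`. -/
lemma covariantAcceleration_eq {x₀ : S} {γ : ℝ → ℝ × S} {s : ℝ}
    (hz : coordCurve x₀ γ s ∈ M.coordDomain x₀) (W : ℝ × E3) :
    M.covariantAcceleration x₀ γ s W = accelForm (M.chartMetric x₀) (coordCurve x₀ γ s)
      (deriv (coordCurve x₀ γ) s) (deriv (deriv (coordCurve x₀ γ)) s) W := by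
  have hG : DifferentiableAt ℝ (M.chartMetric x₀) (coordCurve x₀ γ s) :=
    (M.contDiffAt_chartMetric hz).differentiableAt (by simp)
  have h : ∀ X Y U, fderiv ℝ (fun z => M.coordMetric x₀ z X Y) (coordCurve x₀ γ s) U =
      fderiv ℝ (M.chartMetric x₀) (coordCurve x₀ γ s) U X Y := by
    intro X Y U
    have h1 := (hG.hasFDerivAt.clm_apply (hasFDerivAt_const X _)).clm_apply
      (hasFDerivAt_const Y (coordCurve x₀ γ s))
    have h2 : (fun z => M.coordMetric x₀ z X Y) = fun z => M.chartMetric x₀ z X Y := by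
      funext z; rw [chartMetric_eq_coordMetric]
    rw [h2, h1.fderiv]
    simp
  unfold covariantAcceleration accelForm
  rw [h, h, chartMetric_eq_coordMetric]

lemma eventually_mem_source {x₀ : S} {γ : ℝ → ℝ × S} {s : ℝ} (hγ : ContinuousAt γ s)
    (hx : (γ s).2 ∈ (chart x₀).source) : ∀ᶠ r in 𝓝 s, (γ r).2 ∈ (chart x₀).source :=
  (continuous_snd.continuousAt.comp hγ).eventually
    ((isOpen_extChartAt_source x₀).mem_nhds hx)

lemma coordCurve_mem_overlap {x₀ x₁ : S} {γ : ℝ → ℝ × S} {s : ℝ}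
    (hx : (γ s).2 ∈ (chart x₀).source) (hx₁ : (γ s).2 ∈ (chart x₁).source) :
    coordCurve x₀ γ s ∈ overlap x₀ x₁ :=
  ⟨(chart x₀).map_source hx, by rw [chart_symm_coordCurve hx]; exact hx₁⟩

lemma coordCurve_chartChange {x₀ x₁ : S} {γ : ℝ → ℝ × S} {s : ℝ}
    (hx : (γ s).2 ∈ (chart x₀).source) :
    coordCurve x₁ γ s = chartChange x₀ x₁ (coordCurve x₀ γ s) := by
  simp only [chartChange, chart_symm_coordCurve hx]
  rfl

lemma coordCurve_curveOfCoord {x₀ : S} {s : ℝ} {c : ℝ → ℝ × E3} (h : (c s).2 ∈ (chart x₀).target) :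
    coordCurve x₀ (curveOfCoord x₀ c) s = c s :=
  Prod.ext rfl ((chart x₀).right_inv h)

lemma eventually_coordCurve_curveOfCoord {x₀ : S} {s : ℝ} {c : ℝ → ℝ × E3} (hc : ContinuousAt c s)
    (h : c s ∈ M.coordDomain x₀) :
    coordCurve x₀ (curveOfCoord x₀ c) =ᶠ[𝓝 s] c := by
  filter_upwards [hc.eventually ((M.isOpen_coordDomain x₀).mem_nhds h)] with r hr
  exact coordCurve_curveOfCoord hr.2

lemma coordState_curveOfCoord {x₀ : S} {σ : ℝ → (ℝ × E3) × (ℝ × E3)} {s : ℝ}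
    (hσ : HasDerivAt σ (geodesicSpray (M.chartMetric x₀) (σ s)) s)
    (h : (σ s).1 ∈ M.coordDomain x₀) :
    coordState x₀ (curveOfCoord x₀ fun r => (σ r).1) s = σ s := by
  have h1 := hσ.fst_comp
  have h2 := eventually_coordCurve_curveOfCoord h1.continuousAt h
  refine Prod.ext h2.self_of_nhds ?_
  change deriv _ s = _
  rw [h2.deriv_eq, h1.deriv]
  rfl

section Manifold

variable [IsManifold 𝓘(ℝ, E3) ∞ S]

lemma contDiffAt_coordCurve {x₀ : S} {γ : ℝ → ℝ × S} {s : ℝ}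
    (hγ : ContMDiffAt 𝓘(ℝ, ℝ) (𝓘(ℝ, ℝ).prod 𝓘(ℝ, E3)) 2 γ s)
    (hx : (γ s).2 ∈ (chart x₀).source) : ContDiffAt ℝ 2 (coordCurve x₀ γ) s := by
  refine ContDiffAt.prodMk hγ.fst.contDiffAt ?_
  refine ContMDiffAt.contDiffAt ?_
  exact (contMDiffAt_extChartAt' (by rwa [extChartAt_source] at hx)).comp s hγ.snd

lemma hasDerivAt_coordCurve_chartChange {x₀ x₁ : S} {γ : ℝ → ℝ × S} {s : ℝ} {c' : ℝ × E3}
    (hγ : HasDerivAt (coordCurve x₀ γ) c' s)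
    (hx : ∀ᶠ r in 𝓝 s, (γ r).2 ∈ (chart x₀).source) (hx₁ : (γ s).2 ∈ (chart x₁).source) :
    HasDerivAt (coordCurve x₁ γ) (chartChangeDeriv x₀ x₁ (coordCurve x₀ γ s) c') s := by
  have h : coordCurve x₁ γ =ᶠ[𝓝 s] chartChange x₀ x₁ ∘ coordCurve x₀ γ := by
    filter_upwards [hx] with r hr
    exact coordCurve_chartChange hr
  exact ((hasFDerivAt_chartChange
    (coordCurve_mem_overlap hx.self_of_nhds hx₁)).comp_hasDerivAt s hγ).congr_of_eventuallyEq h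

lemma coordState_stateChange {x₀ x₁ : S} {γ : ℝ → ℝ × S} {s : ℝ}
    (hγ : ContMDiffAt 𝓘(ℝ, ℝ) (𝓘(ℝ, ℝ).prod 𝓘(ℝ, E3)) 2 γ s)
    (hx : (γ s).2 ∈ (chart x₀).source) (hx₁ : (γ s).2 ∈ (chart x₁).source) :
    coordState x₁ γ s = stateChange x₀ x₁ (coordState x₀ γ s) :=
  Prod.ext (coordCurve_chartChange hx)
    (hasDerivAt_coordCurve_chartChange
      ((contDiffAt_coordCurve hγ hx).differentiableAt (by norm_num)).hasDerivAt
      (eventually_mem_source hγ.continuousAt hx) hx₁).deriv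

lemma deriv_deriv_coordCurve {x₀ x₁ : S} {γ : ℝ → ℝ × S} {s : ℝ}
    (hγ : ContMDiffAt 𝓘(ℝ, ℝ) (𝓘(ℝ, ℝ).prod 𝓘(ℝ, E3)) 2 γ s)
    (hx : (γ s).2 ∈ (chart x₀).source) (hx₁ : (γ s).2 ∈ (chart x₁).source) :
    deriv (deriv (coordCurve x₁ γ)) s =
      fderiv ℝ (fderiv ℝ (chartChange x₀ x₁)) (coordCurve x₀ γ s) (deriv (coordCurve x₀ γ) s)
        (deriv (coordCurve x₀ γ) s) +
      fderiv ℝ (chartChange x₀ x₁) (coordCurve x₀ γ s) (deriv (deriv (coordCurve x₀ γ)) s) := by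
  have hc := contDiffAt_coordCurve hγ hx
  have hev : deriv (coordCurve x₁ γ) =ᶠ[𝓝 s] fun r =>
      fderiv ℝ (chartChange x₀ x₁) (coordCurve x₀ γ r) (deriv (coordCurve x₀ γ) r) := by
    filter_upwards [(eventually_mem_source hγ.continuousAt hx).eventually_nhds,
      eventually_mem_source hγ.continuousAt hx₁, hc.eventually (by simp)] with r hr hr₁ hcr
    rw [fderiv_chartChange (coordCurve_mem_overlap hr.self_of_nhds hr₁)]
    exact (hasDerivAt_coordCurve_chartChange
      (hcr.differentiableAt (by norm_num)).hasDerivAt hr hr₁).deriv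
  have hτ : ContDiffAt ℝ 2 (chartChange x₀ x₁) (coordCurve x₀ γ s) :=
    (contDiffAt_chartChange (coordCurve_mem_overlap hx hx₁)).of_le (by norm_cast)
  have hdτ : DifferentiableAt ℝ (fderiv ℝ (chartChange x₀ x₁)) (coordCurve x₀ γ s) :=
    (hτ.fderiv_right (m := 1) (by norm_num)).differentiableAt (by norm_num)
  have hdc : DifferentiableAt ℝ (deriv (coordCurve x₀ γ)) s := hc.differentiableAt_deriv
  rw [hev.deriv_eq]
  exact ((hdτ.hasFDerivAt.comp_hasDerivAt s
    (hc.differentiableAt (by norm_num)).hasDerivAt).clm_apply hdc.hasDerivAt).deriv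

/-- The geodesic equation may be checked in a single chart. -/
lemma GeodAt.of_chart {x₀ : S} {γ : ℝ → ℝ × S} {s : ℝ} (hJ : (γ s).1 ∈ M.J)
    (hγ : ContMDiffAt 𝓘(ℝ, ℝ) (𝓘(ℝ, ℝ).prod 𝓘(ℝ, E3)) 2 γ s)
    (hx : (γ s).2 ∈ (chart x₀).source)
    (h : ∀ W, accelForm (M.chartMetric x₀) (coordCurve x₀ γ s) (deriv (coordCurve x₀ γ) s)
      (deriv (deriv (coordCurve x₀ γ)) s) W = 0) : M.GeodAt γ s := by
  refine ⟨hJ, hγ, fun x₁ hx₁ W => ?_⟩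
  have hov := coordCurve_mem_overlap hx hx₁
  have hz₁ := coordCurve_mem hJ hx₁
  rw [covariantAcceleration_eq hz₁]
  -- Every test vector in the new chart is the image of one in the old chart, so tensoriality of the
  -- acceleration transfers the equation.
  obtain ⟨W', rfl⟩ := chartChangeDeriv_surjective hov W
  have hd : deriv (coordCurve x₁ γ) s =
      fderiv ℝ (chartChange x₀ x₁) (coordCurve x₀ γ s) (deriv (coordCurve x₀ γ) s) := by
    rw [fderiv_chartChange hov]
    exact congrArg Prod.snd (coordState_stateChange hγ hx hx₁)
  rw [← fderiv_chartChange hov, deriv_deriv_coordCurve hγ hx hx₁, hd,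
    coordCurve_chartChange (x₁ := x₁) hx] 
  rw [coordCurve_chartChange (x₁ := x₁) hx] at hz₁
  rw [accelForm_transform (G := M.chartMetric x₀)
    ((contDiffAt_chartChange hov).of_le (by norm_cast))
    ((M.contDiffAt_chartMetric hz₁).differentiableAt (by simp)) (M.chartMetric_symm hz₁)]
  · exact h W'
  · filter_upwards [(isOpen_overlap x₀ x₁).mem_nhds hov] with z hz X Y
    rw [fderiv_chartChange hz, M.chartMetric_chartChange hz]

lemma GeodAt.hasDerivAt_coordState {x₀ : S} {γ : ℝ → ℝ × S} {s : ℝ} (hγ : M.GeodAt γ s)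
    (hx : (γ s).2 ∈ (chart x₀).source) :
    HasDerivAt (coordState x₀ γ)
      (geodesicSpray (M.chartMetric x₀) (coordState x₀ γ s)) s := by
  have hc := contDiffAt_coordCurve hγ.contMDiffAt hx
  have hz := coordCurve_mem hγ.mem_J hx
  have h1 : HasDerivAt (coordCurve x₀ γ) (deriv (coordCurve x₀ γ) s) s :=
    (hc.differentiableAt (by norm_num)).hasDerivAt
  have h2 := hc.differentiableAt_deriv.hasDerivAt
  have h3 : deriv (deriv (coordCurve x₀ γ)) s =
      geodesicAccel (M.chartMetric x₀) (coordCurve x₀ γ s) (deriv (coordCurve x₀ γ) s) :=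
    eq_geodesicAccel (M.isInvertible_chartMetric hz) fun W => by
      rw [← covariantAcceleration_eq hz]; exact hγ.accel x₀ hx W
  rw [h3] at h2
  exact h1.prodMk h2

/-- A solution of the geodesic equation in a chart is a geodesic. -/
lemma geodAt_curveOfCoord {x₀ : S} {σ : ℝ → (ℝ × E3) × (ℝ × E3)} {s : ℝ}
    (hσ : ∀ᶠ r in 𝓝 s, HasDerivAt σ (geodesicSpray (M.chartMetric x₀) (σ r)) r)
    (h : (σ s).1 ∈ M.coordDomain x₀) : M.GeodAt (curveOfCoord x₀ fun r => (σ r).1) s := by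
  have hσs := hσ.self_of_nhds
  -- The spray is continuous along σ, so σ is C¹; the position, having the C¹ velocity as its
  -- derivative, is then C².
  have hσc : ContDiffAt ℝ 1 σ s := by
    refine contDiffAt_succ_of_hasDerivAt (n := 0) (f' := fun r =>
      geodesicSpray (M.chartMetric x₀) (σ r)) hσ ?_
    have hdom : ∀ᶠ r in 𝓝 s, (σ r).1 ∈ M.coordDomain x₀ :=
      hσs.fst_comp.continuousAt.eventually ((M.isOpen_coordDomain x₀).mem_nhds h)
    refine contDiffAt_zero.2 ⟨_, hσ.and hdom, fun r hr => ?_⟩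
    exact ((M.contDiffAt_spray hr.2).continuousAt.comp hr.1.continuousAt).continuousWithinAt
  have hc : ContDiffAt ℝ 2 (fun r => (σ r).1) s :=
    contDiffAt_succ_of_hasDerivAt (n := 1) (f' := fun r => (σ r).2)
      (hσ.mono fun r hr => hr.fst_comp) (contDiffAt_snd.comp s hσc)
  have hγ : ContMDiffAt 𝓘(ℝ, ℝ) (𝓘(ℝ, ℝ).prod 𝓘(ℝ, E3)) 2
      (curveOfCoord x₀ fun r => (σ r).1) s := by
    refine ContMDiffAt.prodMk (contDiffAt_fst.comp s hc).contMDiffAt ?_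
    have h1 : ContMDiffAt 𝓘(ℝ, E3) 𝓘(ℝ, E3) 2 (chart x₀).symm (σ s).1.2 :=
      (contMDiffOn_extChartAt_symm x₀).contMDiffAt ((isOpen_chart_target x₀).mem_nhds h.2)
    exact h1.comp s (contDiffAt_snd.comp s hc).contMDiffAt
  have hev := eventually_coordCurve_curveOfCoord hσs.fst_comp.continuousAt h
  refine GeodAt.of_chart (x₀ := x₀) h.1 hγ ((chart x₀).map_target h.2) fun W => ?_
  have hd : deriv (coordCurve x₀ (curveOfCoord x₀ fun r => (σ r).1)) =ᶠ[𝓝 s]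
      fun r => (σ r).2 := by
    refine hev.deriv.trans ?_
    filter_upwards [hσ] with r hr
    exact hr.fst_comp.deriv
  rw [hev.self_of_nhds, hd.self_of_nhds, hd.deriv_eq, hσs.snd_comp.deriv]
  exact accelForm_geodesicAccel (M.isInvertible_chartMetric h) _ _

end Manifold

end FoliatedSpacetime
end

/-! ### Affine reparametrization and uniqueness of geodesics. -/

noncomputable section

/-- Induction along a compact interval. -/
lemma Icc_induction {P : ℝ → Prop} {T : ℝ} (hT : 0 ≤ T) (h0 : P 0)
    (hstep : ∀ s ∈ Set.Icc 0 T, ∃ ε > 0, ∀ r ∈ Set.Icc 0 T, ∀ r' ∈ Set.Icc 0 T,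
      |r - s| < ε → |r' - s| < ε → r ≤ r' → P r → P r') : P T := by
  set A : Set ℝ := {s | s ∈ Set.Icc 0 T ∧ P s}
  have h0A : (0 : ℝ) ∈ A := ⟨⟨le_rfl, hT⟩, h0⟩
  have hbdd : BddAbove A := ⟨T, fun s hs => hs.1.2⟩
  have hc0 : 0 ≤ sSup A := le_csSup hbdd h0A
  have hcT : sSup A ≤ T := csSup_le ⟨0, h0A⟩ fun s hs => hs.1.2
  -- The local step at the supremum is used twice from a point of A just below it: to reach the
  -- supremum, which settles the case where it equals T, and to pass beyond it otherwise.
  obtain ⟨ε, hε, h⟩ := hstep (sSup A) ⟨hc0, hcT⟩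
  obtain ⟨r, hrA, hr⟩ := exists_lt_of_lt_csSup ⟨0, h0A⟩ (show sSup A - ε < sSup A by linarith)
  have hrc : r ≤ sSup A := le_csSup hbdd hrA
  have hr' : |r - sSup A| < ε := by rw [abs_lt]; constructor <;> linarith
  by_contra hPT
  set r' := min T (sSup A + ε / 2) with hr'def
  have hlt : sSup A < T := by
    refine lt_of_le_of_ne hcT fun heq => hPT ?_
    have := h r hrA.1 (sSup A) ⟨hc0, hcT⟩ hr' (by simpa using hε) hrc hrA.2
    rwa [heq] at this
  have hcr' : sSup A < r' := lt_min hlt (by linarith)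
  have hr'T : r' ≤ T := min_le_left _ _
  have hr'ε : r' ≤ sSup A + ε / 2 := min_le_right _ _
  have hP := h r hrA.1 r' ⟨by linarith, hr'T⟩ hr' (by rw [abs_lt]; constructor <;> linarith)
    (by linarith) hrA.2
  exact absurd (le_csSup hbdd (show r' ∈ A from ⟨⟨by linarith, hr'T⟩, hP⟩)) (not_le.2 hcr')

lemma accelForm_smul {F : Type*} [NormedAddCommGroup F] [NormedSpace ℝ F]
    (G : F → F →L[ℝ] F →L[ℝ] ℝ) (z X A W : F) (κ : ℝ) :
    accelForm G z (κ • X) (κ • κ • A) W = κ ^ 2 * accelForm G z X A W := by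
  simp [accelForm]
  ring

lemma deriv_comp_affine {F : Type*} [NormedAddCommGroup F] [NormedSpace ℝ F]
    (f : ℝ → F) (κ c s : ℝ) : deriv (fun r => f (κ * r + c)) s = κ • deriv f (κ * s + c) := by
  have h := deriv_comp_mul_left κ (fun r => f (r + c)) s
  rw [deriv_comp_add_const] at h
  exact h

namespace FoliatedSpacetime

set_option maxSynthPendingDepth 3

variable {S : Type*} [TopologicalSpace S] [ChartedSpace E3 S] {M : FoliatedSpacetime S}

lemma coordState_comp_affine (x₀ : S) (γ : ℝ → ℝ × S) (κ c s : ℝ) :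
    coordState x₀ (fun r => γ (κ * r + c)) s =
      ((coordState x₀ γ (κ * s + c)).1, κ • (coordState x₀ γ (κ * s + c)).2) :=
  Prod.ext rfl (deriv_comp_affine (coordCurve x₀ γ) κ c s)

/-- Affine reparametrizations of geodesics are geodesics. -/
lemma GeodAt.comp_affine {γ : ℝ → ℝ × S} {κ c s : ℝ} (h : M.GeodAt γ (κ * s + c)) :
    M.GeodAt (fun r => γ (κ * r + c)) s where
  mem_J := h.mem_J
  contMDiffAt := by
    have h1 : ContMDiffAt 𝓘(ℝ, ℝ) 𝓘(ℝ, ℝ) 2 (fun r : ℝ => κ * r + c) s := by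
      apply ContDiffAt.contMDiffAt; fun_prop
    exact ContMDiffAt.comp (x := s) (g := γ) h.contMDiffAt h1
  accel x₀ hx W := by
    have hz : coordCurve x₀ (fun r => γ (κ * r + c)) s ∈ M.coordDomain x₀ :=
      coordCurve_mem (γ := fun r => γ (κ * r + c)) h.mem_J hx
    have h1 := h.accel x₀ hx W
    rw [covariantAcceleration_eq (coordCurve_mem h.mem_J hx)] at h1
    rw [covariantAcceleration_eq hz]
    have h2 : deriv (coordCurve x₀ fun r => γ (κ * r + c)) =
        fun r => κ • deriv (coordCurve x₀ γ) (κ * r + c) :=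
      funext fun r => deriv_comp_affine (coordCurve x₀ γ) κ c r
    have h3 : deriv (fun r => κ • deriv (coordCurve x₀ γ) (κ * r + c)) s =
        κ • κ • deriv (deriv (coordCurve x₀ γ)) (κ * s + c) := by
      rw [deriv_fun_const_smul_field, deriv_comp_affine]
    rw [h2, h3]
    change accelForm _ (coordCurve x₀ γ (κ * s + c)) _ _ _ = 0
    rw [accelForm_smul, h1, mul_zero]

lemma coordState_const (x₀ : S) (p : ℝ × S) (s : ℝ) :
    coordState x₀ (fun _ => p) s = ((p.1, chart x₀ p.2), 0) :=
  Prod.ext rfl (deriv_const s ((p.1, chart x₀ p.2) : ℝ × E3))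

/-- Constant curves serve as comparison geodesics: they show that a moving geodesic never comes to
rest, and they provide the flow near zero velocity. -/
lemma geodAt_const {p : ℝ × S} (hp : p.1 ∈ M.J) (s : ℝ) : M.GeodAt (fun _ => p) s where
  mem_J := hp
  contMDiffAt := contMDiffAt_const
  accel x₀ hx W := by
    rw [covariantAcceleration_eq (coordCurve_mem (γ := fun _ => p) (s := s) hp hx)]
    have h : deriv (coordCurve x₀ fun _ => p) = fun _ => 0 :=
      funext fun r => deriv_const r ((p.1, chart x₀ p.2) : ℝ × E3)
    simp [h, accelForm]

/-- Two curves have the same position and velocity at `s`. -/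
def SameState (γ γ' : ℝ → ℝ × S) (s : ℝ) : Prop :=
  γ s = γ' s ∧ coordState (γ s).2 γ s = coordState (γ s).2 γ' s

lemma SameState.comp_affine {γ γ' : ℝ → ℝ × S} {κ c s : ℝ} (h : SameState γ γ' (κ * s + c)) :
    SameState (fun r => γ (κ * r + c)) (fun r => γ' (κ * r + c)) s := by
  refine ⟨h.1, ?_⟩
  rw [coordState_comp_affine, coordState_comp_affine]
  have := h.2
  simp only [this]

section Manifold

variable [IsManifold 𝓘(ℝ, E3) ∞ S]

/-- States in different charts determine each other through `stateChange`, so agreement may be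
tested in any chart that contains both points. -/
lemma sameState_iff {γ γ' : ℝ → ℝ × S} {s : ℝ} {x₀ : S}
    (hγ : ContMDiffAt 𝓘(ℝ, ℝ) (𝓘(ℝ, ℝ).prod 𝓘(ℝ, E3)) 2 γ s)
    (hγ' : ContMDiffAt 𝓘(ℝ, ℝ) (𝓘(ℝ, ℝ).prod 𝓘(ℝ, E3)) 2 γ' s)
    (hx : (γ s).2 ∈ (chart x₀).source) (hx' : (γ' s).2 ∈ (chart x₀).source) :
    SameState γ γ' s ↔ coordState x₀ γ s = coordState x₀ γ' s := by
  constructor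
  · rintro ⟨h1, h2⟩
    rw [coordState_stateChange (x₀ := (γ s).2) hγ (mem_extChartAt_source _) hx,
      coordState_stateChange (x₀ := (γ s).2) hγ' (by rw [h1]; exact mem_extChartAt_source _) hx',
      h2]
  · intro h
    have h1 : coordCurve x₀ γ s = coordCurve x₀ γ' s := congrArg Prod.fst h
    have h2 : γ s = γ' s :=
      Prod.ext (congrArg (fun z : ℝ × E3 => z.1) h1) ((chart x₀).injOn hx hx' (congrArg Prod.snd h1))
    refine ⟨h2, ?_⟩
    rw [coordState_stateChange hγ hx (mem_extChartAt_source _),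
      coordState_stateChange hγ' hx' (by rw [h2]; exact mem_extChartAt_source _), h]

/-- Geodesics with the same initial state agree. -/
theorem SameState.forward [T2Space S] {γ γ' : ℝ → ℝ × S} {T : ℝ} (hT : 0 ≤ T)
    (hγ : ∀ s ∈ Set.Icc 0 T, M.GeodAt γ s) (hγ' : ∀ s ∈ Set.Icc 0 T, M.GeodAt γ' s)
    (h0 : SameState γ γ' 0) : SameState γ γ' T := by
  refine Icc_induction (P := SameState γ γ') hT h0 fun s hs => ?_
  have hc := (hγ s hs).contMDiffAt.continuousAt
  have hc' := (hγ' s hs).contMDiffAt.continuousAt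
  -- Where the states agree, local Lipschitz uniqueness carries agreement across s. Where they
  -- differ, they differ nearby as well, and the induction step is vacuous.
  by_cases hsame : SameState γ γ' s
  · set x₀ := (γ s).2 with hx₀
    have hx : (γ s).2 ∈ (chart x₀).source := mem_extChartAt_source _
    have hx' : (γ' s).2 ∈ (chart x₀).source := by rw [← hsame.1]; exact mem_extChartAt_source _
    have heq : coordState x₀ γ s = coordState x₀ γ' s := hsame.2
    obtain ⟨K, N, hN, hK⟩ := ((M.contDiffAt_spray
      (coordCurve_mem (hγ s hs).mem_J hx) : ContDiffAt ℝ 2 _ (coordState x₀ γ s)).of_le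
        (m := 1) (by norm_num)).exists_lipschitzOnWith
    have e1 := ((hγ s hs).hasDerivAt_coordState hx).continuousAt.eventually hN
    have e2 := ((hγ' s hs).hasDerivAt_coordState hx').continuousAt.eventually (heq ▸ hN)
    obtain ⟨ε, hε, hball⟩ := Metric.eventually_nhds_iff.1 (((e1.and e2).and
      (eventually_mem_source hc hx)).and (eventually_mem_source hc' hx'))
    refine ⟨ε, hε, fun r hr r' hr' hrs hrs' hrr' hP => ?_⟩
    have hin : ∀ t ∈ Set.Icc r r', t ∈ Set.Icc 0 T ∧ dist t s < ε := by
      intro t ht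
      refine ⟨⟨hr.1.trans ht.1, ht.2.trans hr'.2⟩, ?_⟩
      rw [Real.dist_eq, abs_lt]
      rw [abs_lt] at hrs hrs'
      constructor <;> linarith [ht.1, ht.2]
    have hr0 := hin r ⟨le_rfl, hrr'⟩
    have hr1 := hin r' ⟨hrr', le_rfl⟩
    rw [sameState_iff (hγ r hr).contMDiffAt (hγ' r hr).contMDiffAt (hball hr0.2).1.2
      (hball hr0.2).2] at hP
    rw [sameState_iff (hγ r' hr').contMDiffAt (hγ' r' hr').contMDiffAt (hball hr1.2).1.2
      (hball hr1.2).2]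
    have hd : ∀ t ∈ Set.Icc r r', HasDerivAt (coordState x₀ γ)
        (geodesicSpray (M.chartMetric x₀) (coordState x₀ γ t)) t := fun t ht =>
      (hγ t (hin t ht).1).hasDerivAt_coordState (hball (hin t ht).2).1.2
    have hd' : ∀ t ∈ Set.Icc r r', HasDerivAt (coordState x₀ γ')
        (geodesicSpray (M.chartMetric x₀) (coordState x₀ γ' t)) t := fun t ht =>
      (hγ' t (hin t ht).1).hasDerivAt_coordState (hball (hin t ht).2).2
    exact ODE_solution_unique_of_mem_Icc_right
      (v := fun _ => geodesicSpray (M.chartMetric x₀)) (s := fun _ => N) (fun _ _ => hK)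
      (fun t ht => (hd t ht).continuousAt.continuousWithinAt)
      (fun t ht => (hd t (Set.Ico_subset_Icc_self ht)).hasDerivWithinAt)
      (fun t ht => (hball (hin t (Set.Ico_subset_Icc_self ht)).2).1.1.1)
      (fun t ht => (hd' t ht).continuousAt.continuousWithinAt)
      (fun t ht => (hd' t (Set.Ico_subset_Icc_self ht)).hasDerivWithinAt)
      (fun t ht => (hball (hin t (Set.Ico_subset_Icc_self ht)).2).1.1.2) hP ⟨hrr', le_rfl⟩
  · suffices h : ∀ᶠ r in 𝓝 s, r ∈ Set.Icc 0 T → ¬ SameState γ γ' r by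
      obtain ⟨ε, hε, hball⟩ := Metric.eventually_nhds_iff.1 h
      exact ⟨ε, hε, fun r hr r' _ hrs _ _ hP =>
        absurd hP (hball (by rwa [Real.dist_eq]) hr)⟩
    by_cases hpos : γ s = γ' s
    · set x₀ := (γ s).2 with hx₀
      have hx : (γ s).2 ∈ (chart x₀).source := mem_extChartAt_source _
      have hx' : (γ' s).2 ∈ (chart x₀).source := by rw [← hpos]; exact mem_extChartAt_source _
      have hne : coordState x₀ γ s ≠ coordState x₀ γ' s := fun h => hsame ⟨hpos, h⟩
      filter_upwards [(((hγ s hs).hasDerivAt_coordState hx).continuousAt.ne_iff_eventually_ne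
        ((hγ' s hs).hasDerivAt_coordState hx').continuousAt).1 hne, eventually_mem_source hc hx,
        eventually_mem_source hc' hx'] with r h1 h2 h3 hr hP
      rw [sameState_iff (hγ r hr).contMDiffAt (hγ' r hr).contMDiffAt h2 h3] at hP
      exact h1 hP
    · filter_upwards [(hc.ne_iff_eventually_ne hc').1 hpos] with r hr _ hP
      exact hr hP.1

/-- Geodesics with the same final state agree. -/
theorem SameState.backward [T2Space S] {γ γ' : ℝ → ℝ × S} {T : ℝ} (hT : 0 ≤ T)
    (hγ : ∀ s ∈ Set.Icc 0 T, M.GeodAt γ s) (hγ' : ∀ s ∈ Set.Icc 0 T, M.GeodAt γ' s)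
    (h0 : SameState γ γ' T) : SameState γ γ' 0 := by
  have hmem : ∀ s ∈ Set.Icc 0 T, -1 * s + T ∈ Set.Icc 0 T := fun s hs =>
    ⟨by linarith [hs.2], by linarith [hs.1]⟩
  -- The reversal r ↦ T - r exchanges the two ends of the segment.
  have h1 : SameState (fun r => γ (-1 * r + T)) (fun r => γ' (-1 * r + T)) T := by
    refine SameState.forward (M := M) hT (fun s hs => (hγ _ (hmem s hs)).comp_affine)
      (fun s hs => (hγ' _ (hmem s hs)).comp_affine) (SameState.comp_affine ?_)
    simpa using h0
  have h2 := SameState.comp_affine (κ := -1) (c := T) (s := 0)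
    (γ := fun r => γ (-1 * r + T)) (γ' := fun r => γ' (-1 * r + T)) (by simpa using h1)
  have h3 : ∀ r : ℝ, -1 * (-1 * r + T) + T = r := fun r => by ring
  simpa only [h3] using h2

end Manifold

end FoliatedSpacetime
end

/-! ### The geodesic flow near a geodesic segment and the first variation formula. -/

noncomputable section

namespace FoliatedSpacetime

set_option maxSynthPendingDepth 3

variable {S : Type*} [TopologicalSpace S] [ChartedSpace E3 S] (M : FoliatedSpacetime S)

/-- `γ` is a geodesic on a neighbourhood of `[0, T]`. -/
def OpenGeod (γ : ℝ → ℝ × S) (T : ℝ) : Prop :=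
  ∃ ε > 0, ∀ s ∈ Set.Ioo (-ε) (T + ε), M.GeodAt γ s

/-- Half the square of the velocity. -/
def kinetic (x₀ : S) (a : (ℝ × E3) × (ℝ × E3)) : ℝ := (1 / 2) * M.chartMetric x₀ a.1 a.2 a.2

/-- A geodesic of parameter length `T` leads from the state `a` in the chart around `x₀` to the
state `a'` in the chart around `x₁`. -/
def Link (x₀ : S) (a : (ℝ × E3) × (ℝ × E3)) (x₁ : S) (a' : (ℝ × E3) × (ℝ × E3)) (T : ℝ) : Prop :=
  ∃ γ, M.OpenGeod γ T ∧ (γ 0).2 ∈ (chart x₀).source ∧ coordState x₀ γ 0 = a ∧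
    (γ T).2 ∈ (chart x₁).source ∧ coordState x₁ γ T = a'

/-- `Φ` describes the geodesic flow for the parameter length `T` near the state `a`. -/
structure IsFlowMap (x₀ : S) (a : (ℝ × E3) × (ℝ × E3)) (x₁ : S) (T : ℝ)
    (Φ : (ℝ × E3) × (ℝ × E3) → (ℝ × E3) × (ℝ × E3))
    (Φ' : (ℝ × E3) × (ℝ × E3) →L[ℝ] (ℝ × E3) × (ℝ × E3)) : Prop where
  strict : HasStrictFDerivAt Φ Φ' a
  link : ∀ᶠ b in 𝓝 a, M.Link x₀ b x₁ (Φ b) T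
  firstVariation : ∀ δ, M.chartMetric x₁ (Φ a).1 (Φ a).2 (Φ' δ).1 =
    M.chartMetric x₀ a.1 a.2 δ.1 + T * fderiv ℝ (M.kinetic x₀) a δ

variable {M}

lemma OpenGeod.geodAt {γ : ℝ → ℝ × S} {T : ℝ} (h : M.OpenGeod γ T) :
    ∀ s ∈ Set.Icc 0 T, M.GeodAt γ s := by
  obtain ⟨ε, hε, h⟩ := h
  exact fun s hs => h s ⟨by linarith [hs.1], by linarith [hs.2]⟩

lemma OpenGeod.eventually {γ : ℝ → ℝ × S} {T : ℝ} (h : M.OpenGeod γ T) :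
    ∀ s ∈ Set.Icc 0 T, ∀ᶠ r in 𝓝 s, M.GeodAt γ r := by
  obtain ⟨ε, hε, h⟩ := h
  intro s hs
  filter_upwards [Ioo_mem_nhds (show -ε < s by linarith [hs.1])
    (show s < T + ε by linarith [hs.2])] with r hr using h r hr

lemma Link.mem_coordDomain_left {x₀ x₁ : S} {a a' : (ℝ × E3) × (ℝ × E3)} {T : ℝ} (hT : 0 ≤ T)
    (h : M.Link x₀ a x₁ a' T) : a.1 ∈ M.coordDomain x₀ := by
  obtain ⟨γ, hγ, hx, rfl, -⟩ := h
  exact coordCurve_mem (hγ.geodAt 0 ⟨le_rfl, hT⟩).mem_J hx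

lemma Link.mem_coordDomain_right {x₀ x₁ : S} {a a' : (ℝ × E3) × (ℝ × E3)} {T : ℝ} (hT : 0 ≤ T)
    (h : M.Link x₀ a x₁ a' T) : a'.1 ∈ M.coordDomain x₁ := by
  obtain ⟨γ, hγ, -, -, hx, rfl⟩ := h
  exact coordCurve_mem (hγ.geodAt T ⟨hT, le_rfl⟩).mem_J hx

lemma hasStrictFDerivAt_kinetic {x₀ : S} {a : (ℝ × E3) × (ℝ × E3)}
    (ha : a.1 ∈ M.coordDomain x₀) :
    HasStrictFDerivAt (M.kinetic x₀) (fderiv ℝ (M.kinetic x₀) a) a := by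
  have hG : ContDiffAt ℝ 1 (fun a : (ℝ × E3) × (ℝ × E3) => M.chartMetric x₀ a.1) a :=
    ((M.contDiffAt_chartMetric ha).of_le (by norm_cast)).comp a contDiffAt_fst
  have h : ContDiffAt ℝ 1 (M.kinetic x₀) a :=
    contDiffAt_const.mul ((hG.clm_apply contDiffAt_snd).clm_apply contDiffAt_snd)
  exact h.hasStrictFDerivAt (by norm_num)

lemma fderiv_kinetic {x₀ : S} {a : (ℝ × E3) × (ℝ × E3)} (ha : a.1 ∈ M.coordDomain x₀)
    (δ : (ℝ × E3) × (ℝ × E3)) : fderiv ℝ (M.kinetic x₀) a δ =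
      (1 / 2) * fderiv ℝ (M.chartMetric x₀) a.1 δ.1 a.2 a.2 + M.chartMetric x₀ a.1 a.2 δ.2 := by
  have hG : HasFDerivAt (fun a : (ℝ × E3) × (ℝ × E3) => M.chartMetric x₀ a.1)
      ((fderiv ℝ (M.chartMetric x₀) a.1).comp (ContinuousLinearMap.fst ℝ (ℝ × E3) (ℝ × E3))) a :=
    ((M.contDiffAt_chartMetric ha).differentiableAt (by simp)).hasFDerivAt.comp a hasFDerivAt_fst
  have h := ((hG.clm_apply hasFDerivAt_snd).clm_apply hasFDerivAt_snd).const_mul (1 / 2 : ℝ)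
  have h' : HasFDerivAt (M.kinetic x₀) _ a := h
  rw [h'.fderiv]
  simp
  rw [M.chartMetric_symm ha δ.2 a.2]
  ring

section Manifold

variable [IsManifold 𝓘(ℝ, E3) ∞ S]

/-- This is the geodesic equation tested against the velocity itself. -/
lemma fderiv_kinetic_spray {x₀ : S} {a : (ℝ × E3) × (ℝ × E3)} (ha : a.1 ∈ M.coordDomain x₀) :
    fderiv ℝ (M.kinetic x₀) a (geodesicSpray (M.chartMetric x₀) a) = 0 := by
  have h := accelForm_geodesicAccel (M.isInvertible_chartMetric ha) a.2 a.2
  rw [fderiv_kinetic ha]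
  unfold accelForm at h
  rw [M.chartMetric_symm ha] at h
  simp only [geodesicSpray]
  linarith

lemma kinetic_stateChange {x₀ x₁ : S} {a : (ℝ × E3) × (ℝ × E3)} (ha : a.1 ∈ overlap x₀ x₁) :
    M.kinetic x₁ (stateChange x₀ x₁ a) = M.kinetic x₀ a := by
  simp only [kinetic, stateChange, M.chartMetric_chartChange ha]

lemma kinetic_coordState {x₀ x₁ : S} {γ : ℝ → ℝ × S} {s : ℝ} (hγ : M.GeodAt γ s)
    (hx : (γ s).2 ∈ (chart x₀).source) (hx₁ : (γ s).2 ∈ (chart x₁).source) :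
    M.kinetic x₁ (coordState x₁ γ s) = M.kinetic x₀ (coordState x₀ γ s) := by
  rw [coordState_stateChange hγ.contMDiffAt hx hx₁]
  exact kinetic_stateChange (coordCurve_mem_overlap hx hx₁)

/-- The square of the velocity is constant along geodesics. -/
lemma kinetic_constant {x₀ x₁ : S} {γ : ℝ → ℝ × S} {T : ℝ} (hT : 0 ≤ T)
    (hγ : ∀ s ∈ Set.Icc 0 T, M.GeodAt γ s) (hx : (γ 0).2 ∈ (chart x₀).source)
    (hx₁ : (γ T).2 ∈ (chart x₁).source) :
    M.kinetic x₁ (coordState x₁ γ T) = M.kinetic x₀ (coordState x₀ γ 0) := by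
  -- The chart moves with the point so that `e` is defined on the whole segment; its derivative at s
  -- is computed in the chart frozen at γ s, as the kinetic energy does not depend on the chart.
  set e : ℝ → ℝ := fun s => M.kinetic (γ s).2 (coordState (γ s).2 γ s) with he
  have hd : ∀ s ∈ Set.Icc 0 T, HasDerivWithinAt e 0 (Set.Icc 0 T) s := by
    intro s hs
    have hxs : (γ s).2 ∈ (chart (γ s).2).source := mem_extChartAt_source _
    have h1 := (hasStrictFDerivAt_kinetic (M := M) (x₀ := (γ s).2) (a := coordState (γ s).2 γ s)
      (coordCurve_mem (hγ s hs).mem_J hxs)).hasFDerivAt.comp_hasDerivAt s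
      ((hγ s hs).hasDerivAt_coordState hxs)
    rw [fderiv_kinetic_spray (coordCurve_mem (hγ s hs).mem_J hxs)] at h1
    refine h1.hasDerivWithinAt.congr_of_eventuallyEq ?_ rfl
    filter_upwards [self_mem_nhdsWithin, nhdsWithin_le_nhds
      (eventually_mem_source (hγ s hs).contMDiffAt.continuousAt hxs)] with r hr hr'
    exact kinetic_coordState (hγ r hr) hr' (mem_extChartAt_source _)
  have hconst := constant_of_has_deriv_right_zero (f := e) (a := 0) (b := T)
    (fun s hs => (hd s hs).continuousWithinAt)
    (fun s hs => ((hd s (Set.Ico_subset_Icc_self hs)).mono_of_mem_nhdsWithin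
      (Icc_mem_nhdsGE_of_mem hs))) T ⟨hT, le_rfl⟩
  rw [kinetic_coordState (hγ T ⟨hT, le_rfl⟩) (mem_extChartAt_source _) hx₁,
    kinetic_coordState (hγ 0 ⟨le_rfl, hT⟩) (mem_extChartAt_source _) hx]
  exact hconst

lemma Link.kinetic_eq {x₀ x₁ : S} {a a' : (ℝ × E3) × (ℝ × E3)} {T : ℝ} (hT : 0 ≤ T)
    (h : M.Link x₀ a x₁ a' T) : M.kinetic x₁ a' = M.kinetic x₀ a := by
  obtain ⟨γ, hγ, hx, rfl, hx₁, rfl⟩ := h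
  exact kinetic_constant hT hγ.geodAt hx hx₁

/-- Conservation of the kinetic energy, differentiated in the initial state. -/
lemma IsFlowMap.fderiv_kinetic_eq {x₀ x₁ : S} {a : (ℝ × E3) × (ℝ × E3)} {T : ℝ} (hT : 0 ≤ T)
    {Φ : (ℝ × E3) × (ℝ × E3) → (ℝ × E3) × (ℝ × E3)}
    {Φ' : (ℝ × E3) × (ℝ × E3) →L[ℝ] (ℝ × E3) × (ℝ × E3)} (h : HasStrictFDerivAt Φ Φ' a)
    (hl : ∀ᶠ b in 𝓝 a, M.Link x₀ b x₁ (Φ b) T) (δ : (ℝ × E3) × (ℝ × E3)) :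
    fderiv ℝ (M.kinetic x₁) (Φ a) (Φ' δ) = fderiv ℝ (M.kinetic x₀) a δ := by
  have hla := hl.self_of_nhds
  have h1 := (hasStrictFDerivAt_kinetic (hla.mem_coordDomain_right hT)).hasFDerivAt.comp a
    h.hasFDerivAt
  have h2 : M.kinetic x₁ ∘ Φ =ᶠ[𝓝 a] M.kinetic x₀ := by
    filter_upwards [hl] with b hb using hb.kinetic_eq hT
  have h3 := (hasStrictFDerivAt_kinetic (hla.mem_coordDomain_left hT)).hasFDerivAt
  have h4 := (h1.congr_of_eventuallyEq h2.symm).unique h3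
  exact congrArg (fun L => L δ) h4

/-- Geodesics with the same state at an interior parameter agree near it. -/
lemma SameState.eventuallyEq {γ γ' : ℝ → ℝ × S} {s : ℝ} (hγ : ∀ᶠ r in 𝓝 s, M.GeodAt γ r)
    (hγ' : ∀ᶠ r in 𝓝 s, M.GeodAt γ' r) (h : SameState γ γ' s) : γ =ᶠ[𝓝 s] γ' := by
  have hg := hγ.self_of_nhds
  have hg' := hγ'.self_of_nhds
  set x₀ := (γ s).2 with hx₀
  have hx : (γ s).2 ∈ (chart x₀).source := mem_extChartAt_source _
  have hx' : (γ' s).2 ∈ (chart x₀).source := by rw [← h.1]; exact mem_extChartAt_source _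
  have heq : coordState x₀ γ s = coordState x₀ γ' s := h.2
  obtain ⟨K, N, hN, hK⟩ := ((M.contDiffAt_spray
    (coordCurve_mem hg.mem_J hx) : ContDiffAt ℝ 2 _ (coordState x₀ γ s)).of_le
      (m := 1) (by norm_num)).exists_lipschitzOnWith
  have e1 := (hg.hasDerivAt_coordState hx).continuousAt.eventually hN
  have e2 := (hg'.hasDerivAt_coordState hx').continuousAt.eventually (heq ▸ hN)
  have s1 := eventually_mem_source hg.contMDiffAt.continuousAt hx
  have s2 := eventually_mem_source hg'.contMDiffAt.continuousAt hx'
  have := ODE_solution_unique_of_eventually (v := fun _ => geodesicSpray (M.chartMetric x₀))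
    (s := fun _ => N) (K := K) (f := coordState x₀ γ) (g := coordState x₀ γ')
    (Filter.Eventually.of_forall fun _ => hK)
    (by filter_upwards [hγ, e1, s1] with r h1 h2 h3 using ⟨h1.hasDerivAt_coordState h3, h2⟩)
    (by filter_upwards [hγ', e2, s2] with r h1 h2 h3 using ⟨h1.hasDerivAt_coordState h3, h2⟩) heq
  filter_upwards [this, hγ, hγ', s1, s2] with r h1 h2 h3 h4 h5
  exact ((sameState_iff h2.contMDiffAt h3.contMDiffAt h4 h5).2 h1).1

/-- Concatenation of geodesics. -/
lemma Link.trans {x₀ x₁ x₂ : S} {a b c : (ℝ × E3) × (ℝ × E3)} {T₁ T₂ : ℝ} (hT₁ : 0 ≤ T₁)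
    (hT₂ : 0 ≤ T₂) (h₁ : M.Link x₀ a x₁ b T₁) (h₂ : M.Link x₁ b x₂ c T₂) :
    M.Link x₀ a x₂ c (T₁ + T₂) := by
  obtain ⟨γ₁, hγ₁, hx₀, rfl, hx₁, rfl⟩ := h₁
  obtain ⟨γ₂, hγ₂, hx₁', hb, hx₂, rfl⟩ := h₂
  set γ₃ : ℝ → ℝ × S := fun r => γ₂ (1 * r + -T₁) with hγ₃
  set γ : ℝ → ℝ × S := fun r => if r ≤ T₁ then γ₁ r else γ₃ r with hγdef
  have hst : ∀ r, coordState x₂ γ₃ r = coordState x₂ γ₂ (1 * r + -T₁) := fun r => by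
    rw [hγ₃, coordState_comp_affine, one_smul]
  have hg₁ := hγ₁.eventually T₁ ⟨hT₁, le_rfl⟩
  have hg₃ : ∀ᶠ r in 𝓝 T₁, M.GeodAt γ₃ r := by
    have hcont : Filter.Tendsto (fun r : ℝ => 1 * r + -T₁) (𝓝 T₁) (𝓝 0) := by
      have : Continuous (fun r : ℝ => 1 * r + -T₁) := by fun_prop
      simpa using this.tendsto T₁
    filter_upwards [hcont.eventually (hγ₂.eventually 0 ⟨le_rfl, hT₂⟩)] with r hr
    exact hr.comp_affine
  have hsame : SameState γ₁ γ₃ T₁ := by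
    have h0 : 1 * T₁ + -T₁ = 0 := by ring
    refine (sameState_iff (x₀ := x₁) hg₁.self_of_nhds.contMDiffAt hg₃.self_of_nhds.contMDiffAt
      hx₁ ?_).2 ?_
    · simp only [hγ₃, h0]; exact hx₁'
    · rw [hγ₃, coordState_comp_affine, one_smul, h0, hb]
  -- Both pieces are geodesics on either side of the junction and coincide near it, so the curve
  -- defined by cases is locally equal to one of them and no corner can arise.
  have hjoin : γ₁ =ᶠ[𝓝 T₁] γ₃ := hsame.eventuallyEq hg₁ hg₃
  have hleft : ∀ s ≤ T₁, γ =ᶠ[𝓝 s] γ₁ := by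
    intro s hs
    rcases hs.lt_or_eq with h | rfl
    · filter_upwards [gt_mem_nhds h] with r hr
      simp only [hγdef, if_pos (le_of_lt hr)]
    · filter_upwards [hjoin] with r hr
      by_cases h : r ≤ s
      · simp only [hγdef, if_pos h]
      · simp only [hγdef, if_neg h, hr]
  have hright : ∀ s, T₁ ≤ s → γ =ᶠ[𝓝 s] γ₃ := by
    intro s hs
    rcases hs.lt_or_eq with h | rfl
    · filter_upwards [lt_mem_nhds h] with r hr
      simp only [hγdef, if_neg (not_le.2 hr)]
    · filter_upwards [hjoin] with r hr
      by_cases h : r ≤ T₁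
      · simp only [hγdef, if_pos h, hr]
      · simp only [hγdef, if_neg h]
  have hend : 1 * (T₁ + T₂) + -T₁ = T₂ := by ring
  have hgend : γ (T₁ + T₂) = γ₂ T₂ := by
    rw [(hright (T₁ + T₂) (by linarith)).self_of_nhds]
    simp only [hγ₃, hend]
  refine ⟨γ, ?_, ?_, ?_, ?_, ?_⟩
  · obtain ⟨ε₁, hε₁, hg₁'⟩ := hγ₁
    obtain ⟨ε₂, hε₂, hg₂'⟩ := hγ₂
    refine ⟨min ε₁ ε₂, lt_min hε₁ hε₂, fun s hs => ?_⟩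
    have hm₁ := min_le_left ε₁ ε₂
    have hm₂ := min_le_right ε₁ ε₂
    rcases le_total s T₁ with h | h
    · exact (hg₁' s ⟨by linarith [hs.1], by linarith⟩).congr (hleft s h)
    · refine GeodAt.congr ?_ (hright s h)
      exact GeodAt.comp_affine (hg₂' _ ⟨by linarith, by linarith [hs.2]⟩)
  · rw [(hleft 0 hT₁).self_of_nhds]; exact hx₀
  · exact coordState_congr x₀ (hleft 0 hT₁)
  · rw [hgend]; exact hx₂
  · rw [coordState_congr x₂ (hright (T₁ + T₂) (by linarith)), hst, hend]

/-- The first variation formulas add up because the flow preserves the differential of the kinetic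
energy: the coefficients T₁ and T₂ multiply the same number. -/
lemma IsFlowMap.comp {x₀ x₁ x₂ : S} {a : (ℝ × E3) × (ℝ × E3)} {T₁ T₂ : ℝ} (hT₁ : 0 ≤ T₁)
    (hT₂ : 0 ≤ T₂) {Φ Ψ : (ℝ × E3) × (ℝ × E3) → (ℝ × E3) × (ℝ × E3)}
    {Φ' Ψ' : (ℝ × E3) × (ℝ × E3) →L[ℝ] (ℝ × E3) × (ℝ × E3)} (h₁ : M.IsFlowMap x₀ a x₁ T₁ Φ Φ')
    (h₂ : M.IsFlowMap x₁ (Φ a) x₂ T₂ Ψ Ψ') :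
    M.IsFlowMap x₀ a x₂ (T₁ + T₂) (Ψ ∘ Φ) (Ψ'.comp Φ') where
  strict := h₂.strict.comp a h₁.strict
  link := by
    filter_upwards [h₁.link, h₁.strict.continuousAt.eventually h₂.link] with b hb₁ hb₂
    exact hb₁.trans hT₁ hT₂ hb₂
  firstVariation δ := by
    have h := h₂.firstVariation (Φ' δ)
    rw [h₁.firstVariation, IsFlowMap.fderiv_kinetic_eq hT₁ h₁.strict h₁.link] at h
    simp only [Function.comp, ContinuousLinearMap.comp_apply]
    rw [h]
    ring

/-- Flow maps exist for short times, uniformly near a given state. -/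
lemma exists_local_flowMap {x₀ : S} {a₀ : (ℝ × E3) × (ℝ × E3)} (ha₀ : a₀.1 ∈ M.coordDomain x₀) :
    ∃ r > (0 : ℝ), ∃ ε > (0 : ℝ), ∀ a ∈ Metric.ball a₀ r, ∀ T ∈ Set.Ico 0 ε,
      ∃ Φ Φ', M.IsFlowMap x₀ a x₀ T Φ Φ' := by
  have hU : {a : (ℝ × E3) × (ℝ × E3) | a.1 ∈ M.coordDomain x₀} ∈ 𝓝 a₀ :=
    continuous_fst.continuousAt.eventually ((M.isOpen_coordDomain x₀).mem_nhds ha₀)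
  obtain ⟨r, hr, ε, hε, φ, A, h⟩ := (M.contDiffAt_spray ha₀).exists_local_flow hU
  have hgeod : ∀ a ∈ Metric.ball a₀ r, ∀ t ∈ Set.Ioo (-ε) ε,
      M.GeodAt (curveOfCoord x₀ fun t => (φ a t).1) t := by
    intro a ha t ht
    refine geodAt_curveOfCoord (σ := φ a) ?_ ((h a ha).2.2 t ht).1
    filter_upwards [Ioo_mem_nhds ht.1 ht.2] with s hs using ((h a ha).2.2 s hs).2.1
  have hlink : ∀ a ∈ Metric.ball a₀ r, ∀ T ∈ Set.Ico 0 ε, M.Link x₀ a x₀ (φ a T) T := by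
    intro a ha T hT
    have h0 : (0 : ℝ) ∈ Set.Ioo (-ε) ε := ⟨by linarith, hε⟩
    have hTm : T ∈ Set.Ioo (-ε) ε := ⟨by linarith [hT.1], hT.2⟩
    refine ⟨curveOfCoord x₀ fun t => (φ a t).1, ⟨ε - T, by linarith [hT.2], fun s hs =>
      hgeod a ha s ⟨by linarith [hs.1, hT.1], by linarith [hs.2]⟩⟩,
      (chart x₀).map_target ((h a ha).2.2 0 h0).1.2, ?_,
      (chart x₀).map_target ((h a ha).2.2 T hTm).1.2, ?_⟩
    · rw [coordState_curveOfCoord (σ := φ a) ((h a ha).2.2 0 h0).2.1 ((h a ha).2.2 0 h0).1]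
      exact (h a ha).1
    · exact coordState_curveOfCoord (σ := φ a) ((h a ha).2.2 T hTm).2.1 ((h a ha).2.2 T hTm).1
  refine ⟨r, hr, ε, hε, fun a ha T hT => ⟨fun b => φ b T, A a T, ?_, ?_, ?_⟩⟩
  · exact ((h a ha).2.2 T ⟨by linarith [hT.1], hT.2⟩).2.2.2 hT.1
  · filter_upwards [Metric.isOpen_ball.mem_nhds ha] with b hb using hlink b hb T hT
  · intro δ
    set c := fderiv ℝ (M.kinetic x₀) a δ with hc
    have hsub : ∀ s ∈ Set.Icc 0 T, s ∈ Set.Ioo (-ε) ε := fun s hs =>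
      ⟨by linarith [hs.1], by linarith [hs.2, hT.2]⟩
    have hE : ∀ s ∈ Set.Icc 0 T, fderiv ℝ (M.kinetic x₀) (φ a s) (A a s δ) = c := by
      intro s hs
      refine IsFlowMap.fderiv_kinetic_eq (x₁ := x₀) (T := s) hs.1
        (((h a ha).2.2 s (hsub s hs)).2.2.2 hs.1) ?_ δ
      filter_upwards [Metric.isOpen_ball.mem_nhds ha] with b hb
      exact hlink b hb s ⟨hs.1, (hsub s hs).2⟩
    -- First variation: along a geodesic the derivative of 𝐠(velocity, variation) is the variation
    -- of the kinetic energy, which is the constant c by `hE`.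
    have hd : ∀ s ∈ Set.Icc 0 T, HasDerivAt
        (fun s => M.chartMetric x₀ (φ a s).1 (φ a s).2 (A a s δ).1 - s * c) 0 s := by
      intro s hs
      obtain ⟨hdom, hφ, hA, -⟩ := (h a ha).2.2 s (hsub s hs)
      have hAδ : HasDerivAt (fun s => A a s δ)
          (fderiv ℝ (geodesicSpray (M.chartMetric x₀)) (φ a s) (A a s δ)) s := by
        simpa using hA.clm_apply (hasDerivAt_const s δ)
      -- The first component of the spray is the velocity, so the variation of the position has the
      -- variation of the velocity as its derivative.
      have hspray1 : ∀ η, (fderiv ℝ (geodesicSpray (M.chartMetric x₀)) (φ a s) η).1 = η.2 := by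
        intro η
        have hdf : DifferentiableAt ℝ (geodesicSpray (M.chartMetric x₀)) (φ a s) :=
          (M.contDiffAt_spray hdom).differentiableAt (by norm_num)
        have h1 : HasFDerivAt (fun b => (geodesicSpray (M.chartMetric x₀) b).1) _ (φ a s) :=
          hdf.hasFDerivAt.fst
        have h2 : HasFDerivAt (𝕜 := ℝ) (fun b : (ℝ × E3) × (ℝ × E3) => b.2) _ (φ a s) :=
          hasFDerivAt_snd
        exact congrArg (fun L => L η) (h1.unique h2)
      have hpos : HasDerivAt (fun s => (A a s δ).1) (A a s δ).2 s := by
        have := hAδ.fst_comp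
        rwa [hspray1] at this
      have hG := ((M.contDiffAt_chartMetric hdom).differentiableAt
        (by simp)).hasFDerivAt.comp_hasDerivAt s hφ.fst_comp
      have hmain := ((hG.clm_apply hφ.snd_comp).clm_apply hpos).sub
        ((hasDerivAt_id s).mul_const c)
      refine hmain.congr_deriv ?_
      have h3 := accelForm_geodesicAccel (M.isInvertible_chartMetric hdom) (φ a s).2 (A a s δ).1
      have h4 := hE s hs
      rw [fderiv_kinetic hdom] at h4
      unfold accelForm at h3
      simp only [geodesicSpray, add_apply, Function.comp]
      linarith
    have hconst := constant_of_has_deriv_right_zero (a := 0) (b := T)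
      (fun s hs => (hd s hs).continuousAt.continuousWithinAt)
      (fun s hs => (hd s (Set.Ico_subset_Icc_self hs)).hasDerivWithinAt) T ⟨hT.1, le_rfl⟩
    simp only [(h a ha).1, (h a ha).2.1, ContinuousLinearMap.id_apply, zero_mul, sub_zero]
      at hconst
    linarith

/-- Treating a change of charts as a flow of length zero lets flows in different charts be composed
by `IsFlowMap.comp`. -/
lemma isFlowMap_stateChange {x₀ x₁ : S} {a : (ℝ × E3) × (ℝ × E3)}
    (ha : a.1 ∈ M.coordDomain x₀) (hov : a.1 ∈ overlap x₀ x₁) :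
    M.IsFlowMap x₀ a x₁ 0 (stateChange x₀ x₁) (fderiv ℝ (stateChange x₀ x₁) a) := by
  have hev : stateChange x₀ x₁ =ᶠ[𝓝 a] fun b : (ℝ × E3) × (ℝ × E3) =>
      (chartChange x₀ x₁ b.1, fderiv ℝ (chartChange x₀ x₁) b.1 b.2) := by
    filter_upwards [continuous_fst.continuousAt.eventually
      ((isOpen_overlap x₀ x₁).mem_nhds hov)] with b hb
    rw [fderiv_chartChange hb]
    rfl
  have hτ := contDiffAt_chartChange hov
  have hsmooth : ContDiffAt ℝ 1 (stateChange x₀ x₁) a := by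
    refine ContDiffAt.congr_of_eventuallyEq ?_ hev
    refine ((hτ.of_le (by norm_cast)).comp a contDiffAt_fst).prodMk ?_
    have h1 : ContDiffAt ℝ 1 (fderiv ℝ (chartChange x₀ x₁)) a.1 :=
      (hτ.of_le (m := 2) (by norm_cast)).fderiv_right (by norm_num)
    exact ContDiffAt.clm_apply (h1.comp a contDiffAt_fst) contDiffAt_snd
  refine ⟨hsmooth.hasStrictFDerivAt (by norm_num), ?_, fun δ => ?_⟩
  -- Even a link of length zero needs a geodesic on an open interval through the given state; the
  -- local flow supplies it.
  · obtain ⟨r, hr, ε, hε, h⟩ := exists_local_flowMap ha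
    filter_upwards [Metric.ball_mem_nhds a hr, continuous_fst.continuousAt.eventually
      ((isOpen_overlap x₀ x₁).mem_nhds hov)] with b hb hbov
    obtain ⟨Φ, Φ', hΦ⟩ := h b hb 0 ⟨le_rfl, hε⟩
    obtain ⟨γ, hγ, hx, hb0, -⟩ := hΦ.link.self_of_nhds
    have hb1 : coordCurve x₀ γ 0 = b.1 := congrArg Prod.fst hb0
    have hx₁ : (γ 0).2 ∈ (chart x₁).source := by
      rw [← chart_symm_coordCurve hx, hb1]; exact hbov.2
    refine ⟨γ, hγ, hx, hb0, hx₁, ?_⟩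
    rw [coordState_stateChange (hγ.geodAt 0 ⟨le_rfl, le_rfl⟩).contMDiffAt hx hx₁, hb0]
  · have h1 : HasFDerivAt (fun b => (stateChange x₀ x₁ b).1) _ a :=
      (hsmooth.differentiableAt (by norm_num)).hasFDerivAt.fst
    have h2 : HasFDerivAt (fun b : (ℝ × E3) × (ℝ × E3) => chartChange x₀ x₁ b.1) _ a :=
      (hasFDerivAt_chartChange hov).comp a hasFDerivAt_fst
    have h3 : (fderiv ℝ (stateChange x₀ x₁) a δ).1 = chartChangeDeriv x₀ x₁ a.1 δ.1 :=
      congrArg (fun L => L δ) (h1.unique h2)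
    rw [h3, zero_mul, add_zero]
    exact M.chartMetric_chartChange hov _ _

/-- Uniqueness of geodesics fixes the end state of any link that starts like a known geodesic,
however the link was built. -/
lemma IsFlowMap.apply_eq [T2Space S] {x₀ x₁ : S} {γ : ℝ → ℝ × S} {T : ℝ} (hT : 0 ≤ T)
    (hγ : ∀ s ∈ Set.Icc 0 T, M.GeodAt γ s) (hx : (γ 0).2 ∈ (chart x₀).source)
    (hx₁ : (γ T).2 ∈ (chart x₁).source) {a' : (ℝ × E3) × (ℝ × E3)}
    (h : M.Link x₀ (coordState x₀ γ 0) x₁ a' T) : a' = coordState x₁ γ T := by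
  obtain ⟨γ', hγ', hx', h0, hx₁', rfl⟩ := h
  have hsame : SameState γ' γ 0 := (sameState_iff (hγ'.geodAt 0 ⟨le_rfl, hT⟩).contMDiffAt
    (hγ 0 ⟨le_rfl, hT⟩).contMDiffAt hx' hx).2 h0
  exact (sameState_iff (hγ'.geodAt T ⟨hT, le_rfl⟩).contMDiffAt
    (hγ T ⟨hT, le_rfl⟩).contMDiffAt hx₁' hx₁).1 (hsame.forward hT hγ'.geodAt hγ)

/-- The geodesic flow is defined and strictly differentiable near every geodesic segment. -/
theorem exists_flowMap [T2Space S] {x₀ x₁ : S} {γ : ℝ → ℝ × S} {T : ℝ} (hT : 0 ≤ T)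
    (hγ : ∀ s ∈ Set.Icc 0 T, M.GeodAt γ s) (hx : (γ 0).2 ∈ (chart x₀).source)
    (hx₁ : (γ T).2 ∈ (chart x₁).source) :
    ∃ Φ Φ', M.IsFlowMap x₀ (coordState x₀ γ 0) x₁ T Φ Φ' ∧
      Φ (coordState x₀ γ 0) = coordState x₁ γ T := by
  set a₀ := coordState x₀ γ 0 with ha₀
  have heq : ∀ s ∈ Set.Icc 0 T, ∀ x Φ Φ', (γ s).2 ∈ (chart x).source →
      M.IsFlowMap x₀ a₀ x s Φ Φ' → Φ a₀ = coordState x γ s := fun s hs x Φ Φ' hxs hΦ =>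
    IsFlowMap.apply_eq hs.1 (fun r hr => hγ r ⟨hr.1, hr.2.trans hs.2⟩) hx hxs
      hΦ.link.self_of_nhds
  have hchange : ∀ s ∈ Set.Icc 0 T, ∀ x y, (γ s).2 ∈ (chart x).source →
      (γ s).2 ∈ (chart y).source → (∃ Φ Φ', M.IsFlowMap x₀ a₀ x s Φ Φ') →
      ∃ Φ Φ', M.IsFlowMap x₀ a₀ y s Φ Φ' := by
    rintro s hs x y hxs hys ⟨Φ, Φ', hΦ⟩
    have h1 := heq s hs x Φ Φ' hxs hΦ
    have h2 := isFlowMap_stateChange (M := M) (x₁ := y)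
      (hΦ.link.self_of_nhds.mem_coordDomain_right hs.1)
      (by rw [h1]; exact coordCurve_mem_overlap hxs hys)
    have h3 := hΦ.comp hs.1 le_rfl h2
    rw [add_zero] at h3
    exact ⟨_, _, h3⟩
  -- Induction along the segment: a flow map up to a parameter r₁ near s is moved to the chart at γ
  -- s, followed by the local flow for the length r₂ - r₁, and moved to the chart at γ r₂.
  have hmain : ∃ Φ Φ', M.IsFlowMap x₀ a₀ (γ T).2 T Φ Φ' := by
    refine Icc_induction (P := fun s => ∃ Φ Φ', M.IsFlowMap x₀ a₀ (γ s).2 s Φ Φ') hT ?_ ?_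
    · have h0 : (0 : ℝ) ∈ Set.Icc 0 T := ⟨le_rfl, hT⟩
      refine hchange 0 h0 x₀ _ hx (mem_extChartAt_source _) ?_
      obtain ⟨r, hr, ε, hε, h⟩ := exists_local_flowMap (M := M) (x₀ := x₀) (a₀ := a₀)
        (coordCurve_mem (hγ 0 h0).mem_J hx)
      exact h a₀ (Metric.mem_ball_self hr) 0 ⟨le_rfl, hε⟩
    · intro s hs
      set y := (γ s).2 with hy
      have hys : (γ s).2 ∈ (chart y).source := mem_extChartAt_source _
      obtain ⟨r, hr, ε, hε, h⟩ := exists_local_flowMap (M := M) (x₀ := y)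
        (a₀ := coordState y γ s) (coordCurve_mem (hγ s hs).mem_J hys)
      have e1 := ((hγ s hs).hasDerivAt_coordState hys).continuousAt.eventually
        (Metric.ball_mem_nhds _ hr)
      have e2 := eventually_mem_source (hγ s hs).contMDiffAt.continuousAt hys
      obtain ⟨η, hη, hball⟩ := Metric.eventually_nhds_iff.1 (e1.and e2)
      refine ⟨min η (ε / 2), lt_min hη (by linarith), fun r₁ hr₁ r₂ hr₂ hd₁ hd₂ h12 hP => ?_⟩
      have hb₁ := hball (y := r₁) (by rw [Real.dist_eq]; exact hd₁.trans_le (min_le_left _ _))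
      have hb₂ := hball (y := r₂) (by rw [Real.dist_eq]; exact hd₂.trans_le (min_le_left _ _))
      obtain ⟨Φ, Φ', hΦ⟩ := hchange r₁ hr₁ _ y (mem_extChartAt_source _) hb₁.2 hP
      have hΦa := heq r₁ hr₁ y Φ Φ' hb₁.2 hΦ
      obtain ⟨Ψ, Ψ', hΨ⟩ := h (Φ a₀) (by rw [hΦa]; exact hb₁.1) (r₂ - r₁) (by
        have h1 := abs_lt.1 (hd₁.trans_le (min_le_right _ _))
        have h2 := abs_lt.1 (hd₂.trans_le (min_le_right _ _))
        constructor <;> linarith [h1.1, h1.2, h2.1, h2.2])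
      have h3 := hΦ.comp hr₁.1 (by linarith) hΨ
      rw [add_sub_cancel] at h3
      exact hchange r₂ hr₂ y _ hb₂.2 (mem_extChartAt_source _) ⟨_, _, h3⟩
  obtain ⟨Φ, Φ', hΦ⟩ := hchange T ⟨hT, le_rfl⟩ _ x₁ (mem_extChartAt_source _) hx₁ hmain
  exact ⟨Φ, Φ', hΦ, heq T ⟨hT, le_rfl⟩ x₁ Φ Φ' hx₁ hΦ⟩

end Manifold

end FoliatedSpacetime
end

/-! ### Past directed null geodesics. -/

noncomputable section

namespace FoliatedSpacetime

set_option maxSynthPendingDepth 3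

variable {S : Type*} [TopologicalSpace S] [ChartedSpace E3 S] {M : FoliatedSpacetime S}

lemma leafMetric_smul_smul (t : ℝ) (x : S) (κ : ℝ) (v : E3) :
    M.leafMetric t x (κ • v) (κ • v) = κ ^ 2 * M.leafMetric t x v v := by
  simp; ring

/-- The state `a` is past directed and null. -/
structure PastNull (M : FoliatedSpacetime S) (x₀ : S) (a : (ℝ × E3) × (ℝ × E3)) : Prop where
  mem : a.1 ∈ M.coordDomain x₀
  null : M.kinetic x₀ a = 0
  past : a.2.1 < 0

lemma kinetic_eq (x₀ : S) (a : (ℝ × E3) × (ℝ × E3)) :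
    M.kinetic x₀ a = (1 / 2) * (-(M.lapse a.1.1 ((chart x₀).symm a.1.2)) ^ 2 * a.2.1 ^ 2 +
      M.leafMetric a.1.1 ((chart x₀).symm a.1.2) (chartSymmDeriv x₀ a.1.2 a.2.2)
        (chartSymmDeriv x₀ a.1.2 a.2.2)) := by
  rw [kinetic, chartMetric_apply]
  ring

/-- The time component of the past null vector with leaf component `v`. -/
def nullTime (M : FoliatedSpacetime S) (t : ℝ) (x : S) (v : E3) : ℝ :=
  -(Real.sqrt (M.leafMetric t x v v) / M.lapse t x)

lemma nullTime_neg {t : ℝ} (ht : t ∈ M.J) (x : S) {v : E3} (hv : v ≠ 0) :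
    M.nullTime t x v < 0 := by
  have h1 := M.leafMetric_pos ht x hv
  have h2 := M.lapse_pos t ht x
  unfold nullTime
  have := div_pos (Real.sqrt_pos.2 h1) h2
  linarith

lemma nullTime_spec {t : ℝ} (ht : t ∈ M.J) (x : S) (v : E3) :
    -(M.lapse t x) ^ 2 * M.nullTime t x v ^ 2 + M.leafMetric t x v v = 0 := by
  have h1 := M.leafMetric_nonneg ht x v
  have h2 := M.lapse_pos t ht x
  unfold nullTime
  rw [neg_sq, div_pow, Real.sq_sqrt h1]
  field_simp
  ring

lemma eq_nullTime {t : ℝ} (ht : t ∈ M.J) {x : S} {v : E3} {α : ℝ} (hα : α ≤ 0)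
    (h : -(M.lapse t x) ^ 2 * α ^ 2 + M.leafMetric t x v v = 0) : α = M.nullTime t x v := by
  have h1 := M.leafMetric_nonneg ht x v
  have h2 := M.lapse_pos t ht x
  unfold nullTime
  have h3 : M.leafMetric t x v v = (M.lapse t x * (-α)) ^ 2 := by linarith
  rw [h3, Real.sqrt_sq (mul_nonneg h2.le (by linarith))]
  field_simp

lemma nullTime_smul {t : ℝ} (ht : t ∈ M.J) (x : S) {κ : ℝ} (hκ : 0 ≤ κ) (v : E3) :
    M.nullTime t x (κ • v) = κ * M.nullTime t x v := by
  have h := M.leafMetric_nonneg ht x v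
  unfold nullTime
  rw [leafMetric_smul_smul, Real.sqrt_mul (sq_nonneg κ), Real.sqrt_sq hκ]
  ring

/-- The past null vector with leaf component `w`, in a chart. -/
def nullLift (M : FoliatedSpacetime S) (x₀ : S) (z : ℝ × E3) (w : E3) : ℝ × E3 :=
  (M.nullTime z.1 ((chart x₀).symm z.2) (chartSymmDeriv x₀ z.2 w), w)

lemma nullLift_smul {x₀ : S} {z : ℝ × E3} (hz : z.1 ∈ M.J) {κ : ℝ} (hκ : 0 ≤ κ) (w : E3) :
    M.nullLift x₀ z (κ • w) = κ • M.nullLift x₀ z w := by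
  unfold nullLift
  rw [map_smul, nullTime_smul hz _ hκ]
  rfl

lemma PastNull.eq_nullLift {x₀ : S} {a : (ℝ × E3) × (ℝ × E3)} (h : M.PastNull x₀ a) :
    a.2 = M.nullLift x₀ a.1 a.2.2 := by
  refine Prod.ext (eq_nullTime h.mem.1 h.past.le ?_) rfl
  have := h.null
  rw [kinetic_eq] at this
  linarith

lemma continuousAt_nullLift {x₀ : S} {z : ℝ × E3} (hz : z ∈ M.coordDomain x₀) (w : E3) :
    ContinuousAt (fun q : (ℝ × E3) × E3 => M.nullLift x₀ q.1 q.2) (z, w) := by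
  refine ContinuousAt.prodMk ?_ continuousAt_snd
  have h1 : ContinuousAt (fun q : (ℝ × E3) × E3 =>
      M.lapse q.1.1 ((chart x₀).symm q.1.2)) (z, w) :=
    ContinuousAt.comp (f := fun q : (ℝ × E3) × E3 => q.1)
      (g := fun z : ℝ × E3 => M.lapse z.1 ((chart x₀).symm z.2))
      ((M.lapse_smooth x₀).continuousOn.continuousAt ((M.isOpen_coordDomain x₀).mem_nhds hz))
      continuousAt_fst
  have h2 : ContinuousAt (fun q : (ℝ × E3) × E3 =>
      M.chartMetric x₀ q.1 ((0, q.2) : ℝ × E3) ((0, q.2) : ℝ × E3)) (z, w) := by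
    have hG : ContinuousAt (fun q : (ℝ × E3) × E3 => M.chartMetric x₀ q.1) (z, w) :=
      ContinuousAt.comp (f := fun q : (ℝ × E3) × E3 => q.1) (g := M.chartMetric x₀)
        (M.contDiffAt_chartMetric hz).continuousAt continuousAt_fst
    have hv : ContinuousAt (fun q : (ℝ × E3) × E3 => ((0, q.2) : ℝ × E3)) (z, w) :=
      continuousAt_const.prodMk continuousAt_snd
    exact (hG.clm_apply hv).clm_apply hv
  have h3 : (fun q : (ℝ × E3) × E3 => M.nullTime q.1.1 ((chart x₀).symm q.1.2)
      (chartSymmDeriv x₀ q.1.2 q.2)) = fun q : (ℝ × E3) × E3 =>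
      -(Real.sqrt (M.chartMetric x₀ q.1 ((0, q.2) : ℝ × E3) ((0, q.2) : ℝ × E3)) /
        M.lapse q.1.1 ((chart x₀).symm q.1.2)) := by
    funext q
    rw [chartMetric_apply]
    simp [nullTime]
  rw [h3]
  exact (h2.sqrt.div h1 (M.lapse_pos _ hz.1 _).ne').neg

lemma PastNull.leaf_ne_zero {x₀ : S} {a : (ℝ × E3) × (ℝ × E3)} (h : M.PastNull x₀ a) :
    a.2.2 ≠ 0 := by
  intro h0
  have h1 := h.eq_nullLift
  have h2 : a.2.1 = 0 := by rw [h1, h0]; simp [nullLift, nullTime]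
  exact h.past.ne h2

lemma GeodAt.continuousAt_timeVelocity {γ : ℝ → ℝ × S} {s : ℝ} (h : M.GeodAt γ s) :
    ContinuousAt (timeVelocity γ) s := by
  have h1 : ContDiffAt ℝ 2 (fun s' => (γ s').1) s := h.contMDiffAt.fst.contDiffAt
  exact h1.differentiableAt_deriv.continuousAt

lemma GeodAt.hasDerivAt_time {γ : ℝ → ℝ × S} {s : ℝ} (h : M.GeodAt γ s) :
    HasDerivAt (fun s' => (γ s').1) (timeVelocity γ s) s := by
  have h1 : ContDiffAt ℝ 2 (fun s' => (γ s').1) s := h.contMDiffAt.fst.contDiffAt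
  exact (h1.differentiableAt (by norm_num)).hasDerivAt

lemma strictAntiOn_time {γ : ℝ → ℝ × S} {T : ℝ} (hγ : ∀ s ∈ Set.Icc 0 T, M.GeodAt γ s)
    (h : ∀ s ∈ Set.Icc 0 T, timeVelocity γ s < 0) :
    StrictAntiOn (fun s => (γ s).1) (Set.Icc 0 T) :=
  strictAntiOn_of_deriv_neg (convex_Icc 0 T)
    (fun s hs => (hγ s hs).hasDerivAt_time.continuousAt.continuousWithinAt)
    (fun s hs => h s (interior_subset hs))

lemma IsPastNullGeodesic.geodAt {γ : ℝ → ℝ × S} {b : ℝ} (h : M.IsPastNullGeodesic γ b) :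
    ∀ s ∈ Set.Icc 0 b, M.GeodAt γ s := fun s hs =>
  ⟨M.I_subset_J (h.mem_region s hs), h.contMDiffAt s hs, fun x₀ hx W => h.geodesic s hs x₀ hx W⟩

lemma IsPastNullGeodesic.strictAntiOn {γ : ℝ → ℝ × S} {b : ℝ} (h : M.IsPastNullGeodesic γ b) :
    StrictAntiOn (fun s => (γ s).1) (Set.Icc 0 b) := strictAntiOn_time h.geodAt h.past

lemma Joins.time_lt {γ : ℝ → ℝ × S} {b : ℝ} {p q : ℝ × S} (h : M.Joins γ b p q) : q.1 < p.1 := by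
  have := h.1.strictAntiOn ⟨le_rfl, h.1.pos.le⟩ ⟨h.1.pos.le, le_rfl⟩ h.1.pos
  simpa only [h.2.1, h.2.2] using this

section Manifold

variable [IsManifold 𝓘(ℝ, E3) ∞ S]

lemma pastNull_nullLift {x₀ : S} {z : ℝ × E3} (hz : z ∈ M.coordDomain x₀) {w : E3} (hw : w ≠ 0) :
    M.PastNull x₀ (z, M.nullLift x₀ z w) := by
  refine ⟨hz, ?_, nullTime_neg hz.1 _ fun h => hw (chartSymmDeriv_eq_zero hz.2 h)⟩
  rw [kinetic_eq]
  have := nullTime_spec hz.1 ((chart x₀).symm z.2) (chartSymmDeriv x₀ z.2 w)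
  simp only [nullLift]
  rw [this, mul_zero]

lemma GeodAt.timeVelocity_eq {γ : ℝ → ℝ × S} {s : ℝ} {x₀ : S} (h : M.GeodAt γ s)
    (hx : (γ s).2 ∈ (chart x₀).source) : timeVelocity γ s = (coordState x₀ γ s).2.1 := by
  have h1 := ((contDiffAt_coordCurve h.contMDiffAt hx).differentiableAt (by norm_num)).hasDerivAt
  exact h1.fst_comp.deriv

lemma GeodAt.chartDeriv_leafVelocity {γ : ℝ → ℝ × S} {s : ℝ} {x₀ : S} (h : M.GeodAt γ s)
    (hx : (γ s).2 ∈ (chart x₀).source) :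
    chartDeriv x₀ (γ s).2 (leafVelocity γ s) = (coordState x₀ γ s).2.2 := by
  have h1 := ((contDiffAt_coordCurve h.contMDiffAt hx).differentiableAt (by norm_num)).hasDerivAt
  have h2 : MDifferentiableAt 𝓘(ℝ, ℝ) 𝓘(ℝ, E3) (fun s' => (γ s').2) s :=
    h.contMDiffAt.snd.mdifferentiableAt (by norm_num)
  have h3 := (mdifferentiableAt_chart hx).hasMFDerivAt.comp s h2.hasMFDerivAt
  obtain ⟨L, hL⟩ : ∃ L : ℝ →L[ℝ] E3,
      L = mfderiv 𝓘(ℝ, ℝ) 𝓘(ℝ, E3) (fun s' => (γ s').2) s := ⟨_, rfl⟩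
  have h4 : HasFDerivAt (fun s' => chart x₀ (γ s').2) ((chartDeriv x₀ (γ s).2).comp L) s := by
    rw [hL]; exact h3.hasFDerivAt
  have h5 : leafVelocity γ s = L 1 := by rw [hL]; rfl
  rw [h5]
  exact h4.hasDerivAt.unique h1.snd_comp

lemma GeodAt.leafVelocity_eq {γ : ℝ → ℝ × S} {s : ℝ} {x₀ : S} (h : M.GeodAt γ s)
    (hx : (γ s).2 ∈ (chart x₀).source) :
    leafVelocity γ s = chartSymmDeriv x₀ (coordState x₀ γ s).1.2 (coordState x₀ γ s).2.2 := by
  rw [← h.chartDeriv_leafVelocity hx]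
  exact (chartSymmDeriv_chartDeriv hx _).symm

lemma GeodAt.kinetic_eq {γ : ℝ → ℝ × S} {s : ℝ} {x₀ : S} (h : M.GeodAt γ s)
    (hx : (γ s).2 ∈ (chart x₀).source) : M.kinetic x₀ (coordState x₀ γ s) =
      (1 / 2) * (-(M.lapse (γ s).1 (γ s).2) ^ 2 * timeVelocity γ s ^ 2 +
        M.leafMetric (γ s).1 (γ s).2 (leafVelocity γ s) (leafVelocity γ s)) := by
  rw [FoliatedSpacetime.kinetic_eq, ← h.leafVelocity_eq hx, ← h.timeVelocity_eq hx]
  have : (chart x₀).symm (coordState x₀ γ s).1.2 = (γ s).2 := chart_symm_coordCurve hx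
  rw [this]
  rfl

/-- A null geodesic that is past directed initially remains so. -/
lemma timeVelocity_neg [T2Space S] {γ : ℝ → ℝ × S} {T : ℝ} {x₀ : S}
    (hγ : ∀ s ∈ Set.Icc 0 T, M.GeodAt γ s) (hx : (γ 0).2 ∈ (chart x₀).source)
    (h0 : M.PastNull x₀ (coordState x₀ γ 0)) : ∀ s ∈ Set.Icc 0 T, timeVelocity γ s < 0 := by
  intro s hs
  have hT : 0 ≤ T := hs.1.trans hs.2
  -- If the time velocity vanished, nullness would make the whole velocity vanish, and backward
  -- uniqueness against a constant curve would contradict the initial data. A change of sign is then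
  -- excluded by the intermediate value theorem.
  have hne : ∀ r ∈ Set.Icc 0 T, timeVelocity γ r ≠ 0 := by
    intro r hr hzero
    have hgr := hγ r hr
    have hxr : (γ r).2 ∈ (chart (γ r).2).source := mem_extChartAt_source _
    have hk := kinetic_constant hr.1 (fun s hs => hγ s ⟨hs.1, hs.2.trans hr.2⟩) hx hxr
    rw [h0.null, hgr.kinetic_eq hxr, hzero] at hk
    have hv : leafVelocity γ r = 0 := by
      by_contra hne
      have := M.leafMetric_pos hgr.mem_J (γ r).2 hne
      simp at hk
      linarith
    have hst : coordState (γ r).2 γ r = coordState (γ r).2 (fun _ => γ r) r := by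
      rw [coordState_const]
      refine Prod.ext rfl (Prod.ext ?_ ?_)
      · exact (hgr.timeVelocity_eq hxr).symm.trans hzero
      · rw [← hgr.chartDeriv_leafVelocity hxr, hv]
        simp
    have hsame : SameState γ (fun _ => γ r) r := ⟨rfl, hst⟩
    have hb := hsame.backward hr.1 (fun s hs => hγ s ⟨hs.1, hs.2.trans hr.2⟩)
      (fun s _ => geodAt_const hgr.mem_J s)
    have h00 := hγ 0 ⟨le_rfl, hT⟩
    have h1 := (sameState_iff h00.contMDiffAt (geodAt_const hgr.mem_J 0).contMDiffAt hx
      (by have h := hb.1; dsimp only at h; rw [← h]; exact hx)).1 hb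
    rw [coordState_const] at h1
    have h2 := h0.past
    rw [h1] at h2
    simp at h2
  by_contra hcon
  have hcon' : 0 ≤ timeVelocity γ s := not_lt.1 hcon
  have h0' : timeVelocity γ 0 ≤ 0 := by
    rw [(hγ 0 ⟨le_rfl, hT⟩).timeVelocity_eq hx]; exact h0.past.le
  obtain ⟨r, hr, hr0⟩ := intermediate_value_Icc hs.1
    (f := timeVelocity γ) (fun r hr => (hγ r ⟨hr.1, hr.2.trans hs.2⟩).continuousAt_timeVelocity
      |>.continuousWithinAt) ⟨h0', hcon'⟩
  exact hne r ⟨hr.1, hr.2.trans hs.2⟩ hr0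

lemma IsPastNullGeodesic.pastNull {γ : ℝ → ℝ × S} {b s : ℝ} (h : M.IsPastNullGeodesic γ b)
    (hs : s ∈ Set.Icc 0 b) {x₀ : S} (hx : (γ s).2 ∈ (chart x₀).source) :
    M.PastNull x₀ (coordState x₀ γ s) := by
  have hg := h.geodAt s hs
  refine ⟨coordCurve_mem hg.mem_J hx, ?_, ?_⟩
  · rw [hg.kinetic_eq hx]
    have := h.null s hs
    change -(M.lapse (γ s).1 (γ s).2) ^ 2 * timeVelocity γ s ^ 2 +
      M.leafMetric (γ s).1 (γ s).2 (leafVelocity γ s) (leafVelocity γ s) = 0 at this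
    rw [this, mul_zero]
  · rw [← hg.timeVelocity_eq hx]; exact h.past s hs

lemma IsPastNullGeodesic.leafVelocity_ne_zero {γ : ℝ → ℝ × S} {b s : ℝ}
    (h : M.IsPastNullGeodesic γ b) (hs : s ∈ Set.Icc 0 b) : leafVelocity γ s ≠ 0 := by
  intro h0
  have hx : (γ s).2 ∈ (chart (γ s).2).source := mem_extChartAt_source _
  refine (h.pastNull hs hx).leaf_ne_zero ?_
  rw [← (h.geodAt s hs).chartDeriv_leafVelocity hx, h0, map_zero]

/-- Nullness propagates by conservation of the kinetic energy, and past direction by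
`timeVelocity_neg`. Time is then monotone, so only the ends need to be checked for membership in the
interval. -/
lemma isPastNullGeodesic_of_geodAt [T2Space S] {γ : ℝ → ℝ × S} {b : ℝ} {x₀ : S} (hb : 0 < b)
    (hγ : ∀ s ∈ Set.Icc 0 b, M.GeodAt γ s) (hx : (γ 0).2 ∈ (chart x₀).source)
    (h0 : M.PastNull x₀ (coordState x₀ γ 0)) (hI0 : (γ 0).1 ∈ M.I) (hIb : (γ b).1 ∈ M.I) :
    M.IsPastNullGeodesic γ b where
  pos := hb
  mem_region s hs := by
    have hanti := (strictAntiOn_time hγ (timeVelocity_neg hγ hx h0)).antitoneOn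
    exact M.ordConnected_I.out hIb hI0 ⟨hanti hs ⟨hb.le, le_rfl⟩ hs.2,
      hanti ⟨le_rfl, hb.le⟩ hs hs.1⟩
  contMDiffAt s hs := (hγ s hs).contMDiffAt
  geodesic s hs x₀ hx W := (hγ s hs).accel x₀ hx W
  past := timeVelocity_neg hγ hx h0
  null s hs := by
    have hxs : (γ s).2 ∈ (chart (γ s).2).source := mem_extChartAt_source _
    have hk := kinetic_constant hs.1 (fun r hr => hγ r ⟨hr.1, hr.2.trans hs.2⟩) hx hxs
    rw [h0.null, (hγ s hs).kinetic_eq hxs] at hk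
    change -(M.lapse (γ s).1 (γ s).2) ^ 2 * timeVelocity γ s ^ 2 +
      M.leafMetric (γ s).1 (γ s).2 (leafVelocity γ s) (leafVelocity γ s) = 0
    linarith

/-- The initial state of a past null geodesic is determined by its leaf velocity. -/
lemma IsPastNullGeodesic.coordState_eq {γ : ℝ → ℝ × S} {b s : ℝ} (h : M.IsPastNullGeodesic γ b)
    (hs : s ∈ Set.Icc 0 b) {x₀ : S} (hx : (γ s).2 ∈ (chart x₀).source) :
    coordState x₀ γ s = (coordCurve x₀ γ s, M.nullLift x₀ (coordCurve x₀ γ s)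
      (chartDeriv x₀ (γ s).2 (leafVelocity γ s))) := by
  refine Prod.ext rfl ?_
  rw [(h.geodAt s hs).chartDeriv_leafVelocity hx]
  exact (h.pastNull hs hx).eq_nullLift

/-- The null condition and past direction determine the time component, so the leaf velocity carries
the full initial velocity. -/
lemma sameState_of_leafVelocity {γ γ' : ℝ → ℝ × S} {b b' s : ℝ} (h : M.IsPastNullGeodesic γ b)
    (h' : M.IsPastNullGeodesic γ' b') (hs : s ∈ Set.Icc 0 b) (hs' : s ∈ Set.Icc 0 b')
    (hp : γ s = γ' s) (hv : leafVelocity γ s = leafVelocity γ' s) : SameState γ γ' s := by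
  refine ⟨hp, ?_⟩
  have hx : (γ s).2 ∈ (chart (γ s).2).source := mem_extChartAt_source _
  rw [h.coordState_eq hs hx, h'.coordState_eq hs' (by rw [← hp]; exact hx)]
  have h1 : coordCurve (γ s).2 γ s = coordCurve (γ s).2 γ' s := by simp only [coordCurve, hp]
  rw [← h1, ← hv, ← hp]

lemma Joins.sameState [T2Space S] {γ γ' : ℝ → ℝ × S} {b b' : ℝ} {p q q' : ℝ × S}
    (h : M.Joins γ b p q) (h' : M.Joins γ' b' p q')
    (hv : leafVelocity γ 0 = leafVelocity γ' 0) {s : ℝ} (hs : s ∈ Set.Icc 0 b)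
    (hs' : s ∈ Set.Icc 0 b') : SameState γ γ' s := by
  have h0 := sameState_of_leafVelocity h.1 h'.1 ⟨le_rfl, h.1.pos.le⟩ ⟨le_rfl, h'.1.pos.le⟩
    (h.2.1.trans h'.2.1.symm) hv
  exact h0.forward hs.1 (fun r hr => h.1.geodAt r ⟨hr.1, hr.2.trans hs.2⟩)
    (fun r hr => h'.1.geodAt r ⟨hr.1, hr.2.trans hs'.2⟩)

/-- Past null geodesics with the same initial data that reach the same leaf agree. -/
lemma Joins.unique [T2Space S] {γ γ' : ℝ → ℝ × S} {b b' : ℝ} {p q q' : ℝ × S}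
    (h : M.Joins γ b p q) (h' : M.Joins γ' b' p q')
    (hv : leafVelocity γ 0 = leafVelocity γ' 0) (ht : q.1 = q'.1) : b = b' ∧ q = q' := by
  wlog hbb : b ≤ b' generalizing γ γ' b b' q q'
  · have := this h' h hv.symm ht.symm (le_of_not_ge hbb)
    exact ⟨this.1.symm, this.2.symm⟩
  have h1 := (h.sameState h' hv (s := b) ⟨h.1.pos.le, le_rfl⟩ ⟨h.1.pos.le, hbb⟩).1
  have hb : b = b' := by
    refine h'.1.strictAntiOn.injOn ⟨h.1.pos.le, hbb⟩ ⟨h'.1.pos.le, le_rfl⟩ ?_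
    rw [← h1, h.2.2, h'.2.2, ht]
  refine ⟨hb, ?_⟩
  rw [← h.2.2, h1, hb, h'.2.2]

lemma leafVelocity_comp_mul {γ : ℝ → ℝ × S} {κ s : ℝ} (h : M.GeodAt γ (κ * s)) :
    leafVelocity (fun r => γ (κ * r)) s = κ • leafVelocity γ (κ * s) := by
  have hg : M.GeodAt (fun r => γ (κ * r + 0)) s := GeodAt.comp_affine (by rwa [add_zero])
  have hx : (γ (κ * s)).2 ∈ (chart (γ (κ * s)).2).source := mem_extChartAt_source _
  have h1 := hg.leafVelocity_eq (x₀ := (γ (κ * s)).2) (by simp)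
  rw [coordState_comp_affine] at h1
  simp only [add_zero] at h1
  rw [h1, h.leafVelocity_eq hx, Prod.smul_snd, map_smul]

lemma Joins.comp_mul {γ : ℝ → ℝ × S} {b κ : ℝ} {p q : ℝ × S} (h : M.Joins γ b p q)
    (hκ : 0 < κ) : M.Joins (fun r => γ (κ * r)) (b / κ) p q := by
  have hmem : ∀ s ∈ Set.Icc 0 (b / κ), κ * s ∈ Set.Icc 0 b := fun s hs =>
    ⟨mul_nonneg hκ.le hs.1, by have := (le_div_iff₀ hκ).1 hs.2; linarith⟩
  have hend : κ * (b / κ) = b := by field_simp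
  have hg : ∀ s ∈ Set.Icc 0 (b / κ), M.GeodAt (fun r => γ (κ * r)) s := fun s hs => by
    have := GeodAt.comp_affine (M := M) (γ := γ) (κ := κ) (c := 0) (s := s)
      (by rw [add_zero]; exact h.1.geodAt _ (hmem s hs))
    simpa only [add_zero] using this
  have ht : ∀ s ∈ Set.Icc 0 (b / κ), timeVelocity (fun r => γ (κ * r)) s =
      κ * timeVelocity γ (κ * s) := fun s _ => by
    simp only [timeVelocity]
    exact deriv_comp_mul_left κ (fun s' => (γ s').1) s
  refine ⟨⟨div_pos h.1.pos hκ, fun s hs => h.1.mem_region _ (hmem s hs),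
    fun s hs => (hg s hs).contMDiffAt, fun s hs => (hg s hs).accel, fun s hs => ?_,
    fun s hs => ?_⟩, by simp [h.2.1], by simp only [hend, h.2.2]⟩
  · rw [ht s hs]; exact mul_neg_of_pos_of_neg hκ (h.1.past _ (hmem s hs))
  · rw [ht s hs, leafVelocity_comp_mul (h.1.geodAt _ (hmem s hs))]
    have h1 := h.1.null _ (hmem s hs)
    change -(M.lapse (γ (κ * s)).1 (γ (κ * s)).2) ^ 2 * timeVelocity γ (κ * s) ^ 2 +
      M.leafMetric (γ (κ * s)).1 (γ (κ * s)).2 (leafVelocity γ (κ * s))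
        (leafVelocity γ (κ * s)) = 0 at h1
    change -(M.lapse (γ (κ * s)).1 (γ (κ * s)).2) ^ 2 * (κ * timeVelocity γ (κ * s)) ^ 2 +
      M.leafMetric (γ (κ * s)).1 (γ (κ * s)).2 (κ • leafVelocity γ (κ * s))
        (κ • leafVelocity γ (κ * s)) = 0
    rw [leafMetric_smul_smul]
    linear_combination κ ^ 2 * h1

lemma Joins.leafVelocity_comp_mul {γ : ℝ → ℝ × S} {b : ℝ} {p q : ℝ × S} (h : M.Joins γ b p q)
    (κ : ℝ) : leafVelocity (fun r => γ (κ * r)) 0 = κ • leafVelocity γ 0 := by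
  have := FoliatedSpacetime.leafVelocity_comp_mul (M := M) (γ := γ) (κ := κ) (s := 0)
    (by rw [mul_zero]; exact h.1.geodAt 0 ⟨le_rfl, h.1.pos.le⟩)
  rwa [mul_zero] at this

/-- Scaling the initial velocity only rescales the affine parameter; hence the null exponential map
is constant along rays. -/
lemma Reaches.smul {p : ℝ × S} {v : E3} {t : ℝ} {y : S} (h : M.Reaches p v t y) {κ : ℝ}
    (hκ : 0 < κ) : M.Reaches p (κ • v) t y := by
  obtain ⟨γ, b, hj, rfl⟩ := h
  exact ⟨_, _, hj.comp_mul hκ, hj.leafVelocity_comp_mul κ⟩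

/-- A link issuing from a past null state yields a past null geodesic. -/
lemma Link.joins [T2Space S] {x₀ x₁ : S} {a a' : (ℝ × E3) × (ℝ × E3)} {T : ℝ} (hT : 0 < T)
    (h : M.Link x₀ a x₁ a' T) (ha : M.PastNull x₀ a) (hI : a.1.1 ∈ M.I) (hI' : a'.1.1 ∈ M.I) :
    ∃ γ, M.Joins γ T (a.1.1, (chart x₀).symm a.1.2) (a'.1.1, (chart x₁).symm a'.1.2) ∧
      coordState x₀ γ 0 = a ∧ coordState x₁ γ T = a' ∧
      leafVelocity γ 0 = chartSymmDeriv x₀ a.1.2 a.2.2 ∧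
      leafVelocity γ T = chartSymmDeriv x₁ a'.1.2 a'.2.2 := by
  obtain ⟨γ, hγ, hx, rfl, hx₁, rfl⟩ := h
  have h0 := hγ.geodAt 0 ⟨le_rfl, hT.le⟩
  have h1 := hγ.geodAt T ⟨hT.le, le_rfl⟩
  refine ⟨γ, ⟨isPastNullGeodesic_of_geodAt hT hγ.geodAt hx ha hI hI', ?_, ?_⟩, rfl, rfl,
    h0.leafVelocity_eq hx, h1.leafVelocity_eq hx₁⟩
  · exact Prod.ext rfl (chart_symm_coordCurve hx).symm
  · exact Prod.ext rfl (chart_symm_coordCurve hx₁).symm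

end Manifold

end FoliatedSpacetime
end

/-! ### Comparison of the leaf metrics and control of leaf distances along null geodesics. -/

noncomputable section

namespace FoliatedSpacetime

set_option maxSynthPendingDepth 3

variable {S : Type*} [TopologicalSpace S] [ChartedSpace E3 S] {M : FoliatedSpacetime S}

lemma ofReal_sqrt_leafMetric_smul (t : ℝ) (x : S) (r : ℝ) (v : E3) :
    ENNReal.ofReal (Real.sqrt (M.leafMetric t x (r • v) (r • v))) =
      ‖r‖ₑ * ENNReal.ofReal (Real.sqrt (M.leafMetric t x v v)) := by
  rw [leafMetric_smul_smul, Real.sqrt_mul (sq_nonneg r), Real.sqrt_sq_eq_abs,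
    ENNReal.ofReal_mul (abs_nonneg r), Real.enorm_eq_ofReal_abs]

/-- The leaf distance is bounded by the length of curves. -/
lemma leafEDist_le_lintegral (t : ℝ) {c : ℝ → S} {a b : ℝ} (hab : a ≤ b)
    (hc : ContMDiffOn 𝓘(ℝ, ℝ) 𝓘(ℝ, E3) 1 c (Set.Icc a b)) :
    M.leafEDist t (c a) (c b) ≤ ∫⁻ s in Set.Icc a b, ENNReal.ofReal (Real.sqrt
      (M.metric t (c s) (mfderiv 𝓘(ℝ, ℝ) 𝓘(ℝ, E3) c s (1 : ℝ))
        (mfderiv 𝓘(ℝ, ℝ) 𝓘(ℝ, E3) c s (1 : ℝ)))) := by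
  unfold leafEDist
  let _ : ∀ x : S, ENorm (TangentSpace 𝓘(ℝ, E3) x) :=
    fun x => ⟨fun v => ENNReal.ofReal (Real.sqrt (M.metric t x v v))⟩
  have : ∀ x : S, ENormSMulClass ℝ (TangentSpace 𝓘(ℝ, E3) x) :=
    fun x => ⟨fun r v => ofReal_sqrt_leafMetric_smul t x r v⟩
  have h := Manifold.riemannianEDist_le_pathELength (I := 𝓘(ℝ, E3)) hc rfl rfl hab
  rw [Manifold.pathELength_eq_lintegral_mfderiv_Icc] at h
  exact h

lemma leafEDist_comm (t : ℝ) (x y : S) : M.leafEDist t x y = M.leafEDist t y x := by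
  unfold leafEDist
  let _ : ∀ x : S, ENorm (TangentSpace 𝓘(ℝ, E3) x) :=
    fun x => ⟨fun v => ENNReal.ofReal (Real.sqrt (M.metric t x v v))⟩
  have : ∀ x : S, ENormSMulClass ℝ (TangentSpace 𝓘(ℝ, E3) x) :=
    fun x => ⟨fun r v => ofReal_sqrt_leafMetric_smul t x r v⟩
  exact Manifold.riemannianEDist_comm

section Manifold

variable [IsManifold 𝓘(ℝ, E3) ∞ S]

lemma differentiableAt_leafMetric {t : ℝ} (ht : t ∈ M.J) (x : S) (v : E3) :
    DifferentiableAt ℝ (fun t' => M.leafMetric t' x v v) t := by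
  have hx : x ∈ (chart x).source := mem_extChartAt_source _
  have hz : ((t, chart x x) : ℝ × E3) ∈ M.coordDomain x := ⟨ht, (chart x).map_source hx⟩
  have h1 : (fun t' => M.leafMetric t' x v v) = fun t' : ℝ =>
      M.chartMetric x (t', chart x x) (0, chartDeriv x x v) (0, chartDeriv x x v) := by
    funext t'
    rw [chartMetric_apply]
    simp only [mul_zero, zero_add, chartSymmDeriv_chartDeriv hx, (chart x).left_inv hx]
  rw [h1]
  have h2 : DifferentiableAt ℝ (fun t' : ℝ => M.chartMetric x (t', chart x x)) t :=
    DifferentiableAt.comp (g := M.chartMetric x) (f := fun t' : ℝ => ((t', chart x x) : ℝ × E3)) t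
      ((M.contDiffAt_chartMetric hz).differentiableAt (by simp))
      (differentiableAt_id.prodMk (differentiableAt_const _))
  exact (h2.clm_apply (differentiableAt_const _)).clm_apply (differentiableAt_const _)

/-- The metrics of the leaves are comparable if the deformation tensor is bounded. -/
lemma leafMetric_le_exp {N₀ K₀ : ℝ}
    (hlapse : ∀ t ∈ M.I, ∀ x, N₀⁻¹ ≤ M.lapse t x ∧ M.lapse t x ≤ N₀)
    (hdeform : ∀ t ∈ M.I, ∀ x v, |M.deformation t x v v| ≤ K₀ * M.metric t x v v)
    {t τ : ℝ} (ht : t ∈ M.I) (hτ : τ ∈ M.I) (x : S) (v : E3) :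
    M.leafMetric τ x v v ≤ M.leafMetric t x v v * Real.exp (N₀ * |K₀| * |τ - t|) := by
  set f : ℝ → ℝ := fun t' => M.leafMetric t' x v v with hf
  have hd : ∀ s ∈ M.I, HasDerivAt f (deriv f s) s := fun s hs =>
    (differentiableAt_leafMetric (M.I_subset_J hs) x v).hasDerivAt
  have hnn : ∀ s ∈ M.I, 0 ≤ f s := fun s hs => M.leafMetric_nonneg (M.I_subset_J hs) x v
  have hb : ∀ s ∈ M.I, ‖deriv f s‖ ≤ N₀ * |K₀| * ‖f s‖ + 0 := by
    intro s hs
    have hn := M.lapse_pos s (M.I_subset_J hs) x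
    have h1 : |(M.lapse s x)⁻¹ * deriv f s| ≤ K₀ * f s := hdeform s hs x v
    rw [abs_mul, abs_of_pos (inv_pos.2 hn), inv_mul_le_iff₀ hn] at h1
    rw [Real.norm_eq_abs, Real.norm_eq_abs, abs_of_nonneg (hnn s hs), add_zero]
    calc |deriv f s| ≤ M.lapse s x * (K₀ * f s) := h1
      _ ≤ M.lapse s x * (|K₀| * f s) := by
          gcongr
          · exact hnn s hs
          · exact le_abs_self K₀
      _ ≤ N₀ * (|K₀| * f s) := by
          have := hnn s hs
          gcongr
          exact (hlapse s hs x).2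
      _ = N₀ * |K₀| * f s := by ring
  rcases le_total t τ with h | h
  · have hI : ∀ s ∈ Set.Icc t τ, s ∈ M.I := fun s hs => M.ordConnected_I.out ht hτ hs
    have := norm_le_gronwallBound_of_norm_deriv_right_le (f := f) (δ := f t) (K := N₀ * |K₀|)
      (ε := 0) (a := t) (b := τ) (fun s hs => (hd s (hI s hs)).continuousAt.continuousWithinAt)
      (fun s hs => (hd s (hI s (Set.Ico_subset_Icc_self hs))).hasDerivWithinAt)
      (by rw [Real.norm_eq_abs, abs_of_nonneg (hnn t ht)])
      (fun s hs => hb s (hI s (Set.Ico_subset_Icc_self hs))) τ ⟨h, le_rfl⟩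
    rw [gronwallBound_ε0, Real.norm_eq_abs, abs_of_nonneg (hnn τ hτ)] at this
    rwa [abs_of_nonneg (sub_nonneg.2 h)]
  -- Grönwall's inequality runs forward only, so for τ ≤ t it is applied to s ↦ f(-s).
  · have hI : ∀ s ∈ Set.Icc (-t) (-τ), -s ∈ M.I := fun s hs => M.ordConnected_I.out hτ ht
      ⟨by linarith [hs.2], by linarith [hs.1]⟩
    have hd' : ∀ s ∈ Set.Icc (-t) (-τ), HasDerivAt (fun s => f (-s)) (-deriv f (-s)) s := by
      intro s hs
      exact ((hd (-s) (hI s hs)).comp s (hasDerivAt_neg s)).congr_deriv (mul_neg_one _)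
    have := norm_le_gronwallBound_of_norm_deriv_right_le (f := fun s => f (-s)) (δ := f t)
      (K := N₀ * |K₀|) (ε := 0) (a := -t) (b := -τ)
      (fun s hs => (hd' s hs).continuousAt.continuousWithinAt)
      (fun s hs => (hd' s (Set.Ico_subset_Icc_self hs)).hasDerivWithinAt)
      (by rw [neg_neg, Real.norm_eq_abs, abs_of_nonneg (hnn t ht)])
      (fun s hs => by rw [norm_neg]; exact hb _ (hI s (Set.Ico_subset_Icc_self hs)))
      (-τ) ⟨by linarith, le_rfl⟩
    rw [gronwallBound_ε0, neg_neg, Real.norm_eq_abs, abs_of_nonneg (hnn τ hτ)] at this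
    rw [abs_of_nonpos (sub_nonpos.2 h)]
    convert this using 4
    ring

/-- The leaf distance of two points of a past null geodesic is controlled by their time
difference. -/
lemma IsPastNullGeodesic.leafEDist_le {N₀ K₀ : ℝ} (hN₀ : 0 < N₀)
    (hlapse : ∀ t ∈ M.I, ∀ x, N₀⁻¹ ≤ M.lapse t x ∧ M.lapse t x ≤ N₀)
    (hdeform : ∀ t ∈ M.I, ∀ x v, |M.deformation t x v v| ≤ K₀ * M.metric t x v v)
    {γ : ℝ → ℝ × S} {b : ℝ} (h : M.IsPastNullGeodesic γ b) {τ L : ℝ} (hτ : τ ∈ M.I)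
    {r₁ r₂ : ℝ} (hr₁ : r₁ ∈ Set.Icc 0 b) (hr₂ : r₂ ∈ Set.Icc 0 b) (h12 : r₁ ≤ r₂)
    (hL : ∀ s ∈ Set.Icc r₁ r₂, |τ - (γ s).1| ≤ L) :
    M.leafEDist τ (γ r₁).2 (γ r₂).2 ≤
      ENNReal.ofReal (Real.exp (N₀ * |K₀| * L) * N₀ * ((γ r₁).1 - (γ r₂).1)) := by
  have hsub : ∀ s ∈ Set.Icc r₁ r₂, s ∈ Set.Icc 0 b := fun s hs =>
    ⟨hr₁.1.trans hs.1, hs.2.trans hr₂.2⟩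
  set C := Real.exp (N₀ * |K₀| * L) with hC
  have hL0 : 0 ≤ L := (abs_nonneg _).trans (hL r₁ ⟨le_rfl, h12⟩)
  have hC1 : 1 ≤ C := Real.one_le_exp (by positivity)
  have h1 : ContMDiffOn 𝓘(ℝ, ℝ) 𝓘(ℝ, E3) 1 (fun s => (γ s).2) (Set.Icc r₁ r₂) := fun s hs =>
    ((h.contMDiffAt s (hsub s hs)).snd.of_le (by norm_num)).contMDiffWithinAt
  refine (leafEDist_le_lintegral τ h12 h1).trans ?_
  have hcont : ContinuousOn (timeVelocity γ) (Set.uIcc r₁ r₂) := by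
    rw [Set.uIcc_of_le h12]
    exact fun s hs => (h.geodAt s (hsub s hs)).continuousAt_timeVelocity.continuousWithinAt
  have hint : ∫ s in r₁..r₂, timeVelocity γ s = (γ r₂).1 - (γ r₁).1 :=
    intervalIntegral.integral_eq_sub_of_hasDerivAt
      (fun s hs => by
        rw [Set.uIcc_of_le h12] at hs
        exact (h.geodAt s (hsub s hs)).hasDerivAt_time) hcont.intervalIntegrable
  -- Nullness says that the speed in the leaf's own metric is lapse times |dt/ds|. Passing to the
  -- fixed metric at time τ costs the exponential factor, and what remains integrates to the time
  -- difference.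
  have hle : ∀ s ∈ Set.Icc r₁ r₂, ENNReal.ofReal (Real.sqrt (M.metric τ (γ s).2
      (mfderiv 𝓘(ℝ, ℝ) 𝓘(ℝ, E3) (fun s => (γ s).2) s (1 : ℝ))
      (mfderiv 𝓘(ℝ, ℝ) 𝓘(ℝ, E3) (fun s => (γ s).2) s (1 : ℝ)))) ≤
      ENNReal.ofReal (C * N₀ * (-timeVelocity γ s)) := by
    intro s hs
    refine ENNReal.ofReal_le_ofReal ?_
    change Real.sqrt (M.leafMetric τ (γ s).2 (leafVelocity γ s) (leafVelocity γ s)) ≤ _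
    have hI : (γ s).1 ∈ M.I := h.mem_region s (hsub s hs)
    have h2 := leafMetric_le_exp hlapse hdeform hI hτ (γ s).2 (leafVelocity γ s)
    have h3 : -(M.lapse (γ s).1 (γ s).2) ^ 2 * timeVelocity γ s ^ 2 +
      M.leafMetric (γ s).1 (γ s).2 (leafVelocity γ s) (leafVelocity γ s) = 0 :=
      h.null s (hsub s hs)
    have h4 := h.past s (hsub s hs)
    have h5 := M.lapse_pos _ (M.I_subset_J hI) (γ s).2
    have h6 := (hlapse _ hI (γ s).2).2
    have h7 : Real.exp (N₀ * |K₀| * |τ - (γ s).1|) ≤ C := by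
      rw [hC]; gcongr; exact hL s hs
    refine Real.sqrt_le_iff.2 ⟨by have : 0 ≤ -timeVelocity γ s := by linarith
                                  positivity, ?_⟩
    have h8 : M.leafMetric (γ s).1 (γ s).2 (leafVelocity γ s) (leafVelocity γ s) =
      (M.lapse (γ s).1 (γ s).2) ^ 2 * timeVelocity γ s ^ 2 := by linarith
    rw [h8] at h2
    calc _ ≤ _ := h2
      _ ≤ (N₀ ^ 2 * timeVelocity γ s ^ 2) * C := by gcongr
      -- The square root of C would suffice; C ≥ 1 allows C itself and spares a root.
      _ ≤ (N₀ ^ 2 * timeVelocity γ s ^ 2) * C ^ 2 := by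
          gcongr
          nlinarith
      _ = (C * N₀ * (-timeVelocity γ s)) ^ 2 := by ring
  refine (MeasureTheory.setLIntegral_mono' measurableSet_Icc hle).trans ?_
  rw [← MeasureTheory.ofReal_integral_eq_lintegral_ofReal]
  · rw [MeasureTheory.integral_Icc_eq_integral_Ioc, ← intervalIntegral.integral_of_le h12,
      intervalIntegral.integral_const_mul, intervalIntegral.integral_neg, hint, neg_sub]
  · rw [Set.uIcc_of_le h12] at hcont
    exact (continuousOn_const.mul hcont.neg).integrableOn_Icc
  · refine (MeasureTheory.ae_restrict_iff' measurableSet_Icc).2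
      (Filter.Eventually.of_forall fun s hs => ?_)
    have h4 := h.past s (hsub s hs)
    have : 0 ≤ -timeVelocity γ s := by linarith
    change 0 ≤ C * N₀ * (-timeVelocity γ s)
    positivity

end Manifold

end FoliatedSpacetime
end

/-! ### Past null geodesics reach every earlier leaf. -/

noncomputable section

namespace FoliatedSpacetime

set_option maxSynthPendingDepth 3

variable {S : Type*} [TopologicalSpace S] [ChartedSpace E3 S] {M : FoliatedSpacetime S}

lemma Joins.restrict {γ : ℝ → ℝ × S} {b c : ℝ} {p q : ℝ × S} (h : M.Joins γ b p q)
    (hc : c ∈ Set.Ioc 0 b) : M.Joins γ c p (γ c) := by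
  have hmem : ∀ s ∈ Set.Icc 0 c, s ∈ Set.Icc 0 b := fun s hs => ⟨hs.1, hs.2.trans hc.2⟩
  exact ⟨⟨hc.1, fun s hs => h.1.mem_region s (hmem s hs),
    fun s hs => h.1.contMDiffAt s (hmem s hs), fun s hs => h.1.geodesic s (hmem s hs),
    fun s hs => h.1.past s (hmem s hs), fun s hs => h.1.null s (hmem s hs)⟩, h.2.1, rfl⟩

lemma Joins.exists_time {γ : ℝ → ℝ × S} {b τ : ℝ} {p q : ℝ × S} (h : M.Joins γ b p q)
    (hτ : τ ∈ Set.Ico q.1 p.1) : ∃ c ∈ Set.Ioc 0 b, (γ c).1 = τ := by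
  obtain ⟨c, hc, hcτ⟩ := intermediate_value_Icc' h.1.pos.le (f := fun s => (γ s).1)
    (fun s hs => (h.1.geodAt s hs).hasDerivAt_time.continuousAt.continuousWithinAt)
    (show τ ∈ Set.Icc (γ b).1 (γ 0).1 by rw [h.2.1, h.2.2]; exact ⟨hτ.1, hτ.2.le⟩)
  refine ⟨c, ⟨hc.1.lt_of_ne' ?_, hc.2⟩, hcτ⟩
  rintro rfl
  simp only [h.2.1] at hcτ
  exact hτ.2.ne hcτ.symm

lemma Reaches.exists_later {p : ℝ × S} {v : E3} {t τ : ℝ} {y : S} (h : M.Reaches p v t y)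
    (ht : t ≤ τ) (hτ : τ < p.1) : ∃ y', M.Reaches p v τ y' := by
  obtain ⟨γ, b, hj, hv⟩ := h
  obtain ⟨c, hc, hcτ⟩ := hj.exists_time (τ := τ) ⟨ht, hτ⟩
  refine ⟨(γ c).2, γ, c, ?_, hv⟩
  rw [← hcτ]
  exact hj.restrict hc

section Manifold

variable [IsManifold 𝓘(ℝ, E3) ∞ S] [T2Space S]

/-- `Joins` gives the geodesic equation only at the points of a closed segment; the flow replaces
the curve by a geodesic with the same end states on an open neighbourhood of the segment. -/
lemma Joins.link {γ : ℝ → ℝ × S} {b : ℝ} {p q : ℝ × S} (h : M.Joins γ b p q) {x₀ x₁ : S}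
    (hx : p.2 ∈ (chart x₀).source) (hx₁ : q.2 ∈ (chart x₁).source) :
    M.Link x₀ (coordState x₀ γ 0) x₁ (coordState x₁ γ b) b := by
  obtain ⟨Φ, Φ', hΦ, h0⟩ := exists_flowMap h.1.pos.le h.1.geodAt
    (by rw [h.2.1]; exact hx) (by rw [h.2.2]; exact hx₁)
  rw [← h0]
  exact hΦ.link.self_of_nhds

lemma Joins.trans {γ₁ γ₂ : ℝ → ℝ × S} {b₁ b₂ : ℝ} {p q r : ℝ × S} (h₁ : M.Joins γ₁ b₁ p q)
    (h₂ : M.Joins γ₂ b₂ q r) (hv : leafVelocity γ₁ b₁ = leafVelocity γ₂ 0) :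
    ∃ γ, M.Joins γ (b₁ + b₂) p r ∧ leafVelocity γ 0 = leafVelocity γ₁ 0 := by
  have hp : p.2 ∈ (chart p.2).source := mem_extChartAt_source _
  have hq : q.2 ∈ (chart q.2).source := mem_extChartAt_source _
  have hr : r.2 ∈ (chart r.2).source := mem_extChartAt_source _
  have l₁ := h₁.link hp hq
  have l₂ := h₂.link hq hr
  have hp' : (γ₁ 0).2 ∈ (chart p.2).source := by rw [h₁.2.1]; exact hp
  have hst : coordState q.2 γ₁ b₁ = coordState q.2 γ₂ 0 := by
    rw [h₁.1.coordState_eq ⟨h₁.1.pos.le, le_rfl⟩ (by rw [h₁.2.2]; exact hq),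
      h₂.1.coordState_eq ⟨le_rfl, h₂.1.pos.le⟩ (by rw [h₂.2.1]; exact hq), hv]
    simp only [coordCurve, h₁.2.2, h₂.2.1]
  rw [hst] at l₁
  have l := l₁.trans h₁.1.pos.le h₂.1.pos.le l₂
  obtain ⟨γ, hγ, -, -, hv0, -⟩ := l.joins (add_pos h₁.1.pos h₂.1.pos)
    (h₁.1.pastNull ⟨le_rfl, h₁.1.pos.le⟩ hp')
    (h₁.1.mem_region 0 ⟨le_rfl, h₁.1.pos.le⟩) (h₂.1.mem_region b₂ ⟨h₂.1.pos.le, le_rfl⟩)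
  refine ⟨γ, ?_, ?_⟩
  · convert hγ using 1
    · refine Prod.ext (by simp [coordState, coordCurve, h₁.2.1]) ?_
      simp [coordState, coordCurve, h₁.2.1]
    · refine Prod.ext (by simp [coordState, coordCurve, h₂.2.2]) ?_
      simp [coordState, coordCurve, h₂.2.2]
  · rw [hv0, (h₁.1.geodAt 0 ⟨le_rfl, h₁.1.pos.le⟩).leafVelocity_eq hp']

lemma Link.exists_reaches {x₀ x₁ : S} {a a' : (ℝ × E3) × (ℝ × E3)} {T t : ℝ} (hT : 0 < T)
    (h : M.Link x₀ a x₁ a' T) (ha : M.PastNull x₀ a) (hI : a.1.1 ∈ M.I) (ht : t ∈ M.I)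
    (hlt : t < a.1.1) (hle : a'.1.1 ≤ t) :
    ∃ y, M.Reaches (a.1.1, (chart x₀).symm a.1.2) (chartSymmDeriv x₀ a.1.2 a.2.2) t y := by
  obtain ⟨γ, hγ, hx, rfl, hx₁, rfl⟩ := h
  have h0 := hγ.geodAt 0 ⟨le_rfl, hT.le⟩
  obtain ⟨c, hc, hct⟩ := intermediate_value_Icc' hT.le (f := fun s => (γ s).1)
    (fun s hs => (hγ.geodAt s hs).hasDerivAt_time.continuousAt.continuousWithinAt)
    (show t ∈ Set.Icc (γ T).1 (γ 0).1 from ⟨hle, hlt.le⟩)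
  have hc0 : 0 < c := by
    refine hc.1.lt_of_ne' ?_
    rintro rfl
    exact hlt.ne hct.symm
  refine ⟨(γ c).2, γ, c, ⟨isPastNullGeodesic_of_geodAt hc0
    (fun s hs => hγ.geodAt s ⟨hs.1, hs.2.trans hc.2⟩) hx ha hI (by rw [← hct] at ht; exact ht),
    ?_, ?_⟩, h0.leafVelocity_eq hx⟩
  · exact Prod.ext rfl (chart_symm_coordCurve hx).symm
  · exact Prod.ext hct rfl

/-- Past null geodesics exist for a uniform amount of time near a given point. -/
lemma eventually_exists_reaches {t₀ : ℝ} (ht₀ : t₀ ∈ M.J) (x₀ : S) :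
    ∃ η > 0, ∀ᶠ q : ℝ × S in 𝓝 (t₀, x₀), q.1 ∈ M.I → ∀ w : E3, w ≠ 0 → ∀ t ∈ M.I, t₀ - η ≤ t →
      t < q.1 → ∃ y, M.Reaches q w t y := by
  have hx₀ : x₀ ∈ (chart x₀).source := mem_extChartAt_source _
  set z₀ : ℝ × E3 := (t₀, chart x₀ x₀) with hz₀
  have hz₀m : z₀ ∈ M.coordDomain x₀ := ⟨ht₀, (chart x₀).map_source hx₀⟩
  -- Each direction has a link that arrives strictly before t₀, which is an open condition;
  -- compactness of the coordinate sphere makes it uniform. The second component of u is the margin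
  -- in time, from which η is chosen.
  have hsph : ∀ᶠ u : (ℝ × E3) × ℝ in 𝓝 (z₀, 0), ∀ θ ∈ Metric.sphere (0 : E3) 1,
      u.1 ∈ M.coordDomain x₀ ∧ ∃ a' T, 0 < T ∧ M.Link x₀ (u.1, M.nullLift x₀ u.1 θ) x₀ a' T ∧
        a'.1.1 < t₀ - u.2 := by
    refine (isCompact_sphere (0 : E3) 1).eventually_forall_of_forall_eventually fun θ hθ => ?_
    have hθ0 : θ ≠ 0 := by rintro rfl; simp at hθ
    set a : (ℝ × E3) × (ℝ × E3) := (z₀, M.nullLift x₀ z₀ θ) with ha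
    have hpn : M.PastNull x₀ a := pastNull_nullLift hz₀m hθ0
    obtain ⟨r, hr, ε, hε, hflow⟩ := exists_local_flowMap (M := M) (x₀ := x₀) (a₀ := a) hz₀m
    have hT : 0 < ε / 2 := by linarith
    obtain ⟨Φ, Φ', hΦ⟩ := hflow a (Metric.mem_ball_self hr) (ε / 2) ⟨hT.le, by linarith⟩
    have hdec : (Φ a).1.1 < t₀ := by
      obtain ⟨γ, hγ, hx, h0, hx₁, h1⟩ := hΦ.link.self_of_nhds
      have := strictAntiOn_time hγ.geodAt (timeVelocity_neg hγ.geodAt hx (by rw [h0]; exact hpn))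
        ⟨le_rfl, hT.le⟩ ⟨hT.le, le_rfl⟩ hT
      rw [← h1]
      have h2 : (γ 0).1 = t₀ := congrArg (fun a => a.1.1) h0
      rw [← h2]
      exact this
    have hcont : ContinuousAt (fun u : ((ℝ × E3) × ℝ) × E3 =>
        ((u.1.1, M.nullLift x₀ u.1.1 u.2) : (ℝ × E3) × (ℝ × E3))) ((z₀, 0), θ) := by
      refine ContinuousAt.prodMk (by fun_prop) ?_
      exact ContinuousAt.comp (f := fun u : ((ℝ × E3) × ℝ) × E3 => ((u.1.1, u.2) : (ℝ × E3) × E3))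
        (g := fun q : (ℝ × E3) × E3 => M.nullLift x₀ q.1 q.2) (continuousAt_nullLift hz₀m θ)
        (by fun_prop)
    have e1 := hcont.eventually hΦ.link
    have e2 : ∀ᶠ u : ((ℝ × E3) × ℝ) × E3 in 𝓝 ((z₀, 0), θ),
        (Φ (u.1.1, M.nullLift x₀ u.1.1 u.2)).1.1 < t₀ - u.1.2 := by
      have h1 : ContinuousAt (fun u : ((ℝ × E3) × ℝ) × E3 =>
          (Φ (u.1.1, M.nullLift x₀ u.1.1 u.2)).1.1) ((z₀, 0), θ) :=
        (ContinuousAt.comp (g := Φ) (x := ((z₀, (0 : ℝ)), θ)) (f := fun u : ((ℝ × E3) × ℝ) × E3 =>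
          ((u.1.1, M.nullLift x₀ u.1.1 u.2) : (ℝ × E3) × (ℝ × E3))) hΦ.strict.continuousAt hcont).fst.fst
      have h2 : ContinuousAt (fun u : ((ℝ × E3) × ℝ) × E3 => t₀ - u.1.2) ((z₀, 0), θ) := by
        fun_prop
      exact h1.eventually_lt h2 (by simpa using hdec)
    have e3 : ∀ᶠ u : ((ℝ × E3) × ℝ) × E3 in 𝓝 ((z₀, 0), θ), u.1.1 ∈ M.coordDomain x₀ :=
      (continuousAt_fst.comp continuousAt_fst).eventually
        ((M.isOpen_coordDomain x₀).mem_nhds hz₀m)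
    filter_upwards [e1, e2, e3] with u h1 h2 h3 using ⟨h3, _, _, hT, h1, h2⟩
  rw [nhds_prod_eq, Filter.eventually_prod_iff] at hsph
  obtain ⟨pa, hpa, pb, hpb, hab⟩ := hsph
  obtain ⟨ε, hε, hb⟩ := Metric.eventually_nhds_iff.1 hpb
  refine ⟨ε / 2, by linarith, ?_⟩
  have hpbε : pb (ε / 2) := hb (by rw [Real.dist_eq, sub_zero, abs_of_pos] <;> linarith)
  have hch : ContinuousAt (fun q : ℝ × S => ((q.1, chart x₀ q.2) : ℝ × E3)) (t₀, x₀) :=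
    continuousAt_fst.prodMk (ContinuousAt.comp (f := fun q : ℝ × S => q.2) (g := chart x₀)
      (continuousAt_extChartAt x₀) continuousAt_snd)
  have hsrc : ∀ᶠ q : ℝ × S in 𝓝 (t₀, x₀), q.2 ∈ (chart x₀).source :=
    continuousAt_snd.eventually (extChartAt_source_mem_nhds x₀)
  filter_upwards [hch.eventually hpa, hsrc] with q hq hqs hqI w hw t ht hle hlt
  have hinv : (chart x₀).symm (chart x₀ q.2) = q.2 := (chart x₀).left_inv hqs
  set w' := chartDeriv x₀ q.2 w with hw'
  have hww' : chartSymmDeriv x₀ (chart x₀ q.2) w' = w := chartSymmDeriv_chartDeriv hqs w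
  have hw0 : w' ≠ 0 := by
    intro h0
    rw [h0, map_zero] at hww'
    exact hw hww'.symm
  have hn : 0 < ‖w'‖ := norm_pos_iff.2 hw0
  -- Only unit vectors of the coordinate norm were treated; `Reaches.smul` removes the
  -- normalization.
  have hθ : ‖w'‖⁻¹ • w' ∈ Metric.sphere (0 : E3) 1 := by
    rw [mem_sphere_zero_iff_norm, norm_smul, norm_inv, norm_norm, inv_mul_cancel₀ hn.ne']
  obtain ⟨hdom, a', T, hT, hl, hlt'⟩ := hab hq hpbε _ hθ
  obtain ⟨y, hy⟩ := hl.exists_reaches hT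
    (pastNull_nullLift hdom (smul_ne_zero (inv_ne_zero hn.ne') hw0)) hqI ht hlt
    (by dsimp only at hlt'; linarith)
  refine ⟨y, ?_⟩
  have h1 := hy.smul hn
  simp only [nullLift] at h1
  rw [map_smul, smul_smul, mul_inv_cancel₀ hn.ne', one_smul, hww', hinv] at h1
  exact h1

/-- Past null geodesics reach every earlier leaf. -/
theorem exists_reaches (hcomplete : ∀ t ∈ M.I, M.IsCompleteLeaf t) {N₀ K₀ : ℝ} (hN₀ : 0 < N₀)
    (hlapse : ∀ t ∈ M.I, ∀ x, N₀⁻¹ ≤ M.lapse t x ∧ M.lapse t x ≤ N₀)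
    (hdeform : ∀ t ∈ M.I, ∀ x v, |M.deformation t x v v| ≤ K₀ * M.metric t x v v)
    {p : ℝ × S} (hp : p.1 ∈ M.I) {v : E3} (hv : v ≠ 0) {t : ℝ} (ht : t ∈ M.I) (htp : t < p.1) :
    ∃ y, M.Reaches p v t y := by
  have hI : ∀ τ ∈ Set.Icc t p.1, τ ∈ M.I := fun τ hτ => M.ordConnected_I.out ht hp hτ
  -- Continuity method: the geodesic is followed down to the infimum of the times it reaches and is
  -- then continued past it.
  set A : Set ℝ := {τ | t ≤ τ ∧ τ < p.1 ∧ ∃ y, M.Reaches p v τ y} with hA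
  have hAne : A.Nonempty := by
    obtain ⟨η, hη, h⟩ := eventually_exists_reaches (M.I_subset_J hp) p.2
    have h1 : max t (p.1 - η) < p.1 := max_lt htp (by linarith)
    exact ⟨max t (p.1 - η), le_max_left _ _, h1, h.self_of_nhds hp v hv _
      (hI _ ⟨le_max_left _ _, h1.le⟩) (le_max_right _ _) h1⟩
  have hbdd : BddBelow A := ⟨t, fun τ hτ => hτ.1⟩
  set τ₀ := sInf A with hτ₀
  have hτ₀p : τ₀ < p.1 := by
    obtain ⟨τ, hτ⟩ := hAne
    exact (csInf_le hbdd hτ).trans_lt hτ.2.1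
  have htτ₀ : t ≤ τ₀ := le_csInf hAne fun τ hτ => hτ.1
  have hτ₀I := hI τ₀ ⟨htτ₀, hτ₀p.le⟩
  have hlater : ∀ τ, τ₀ < τ → τ < p.1 → ∃ y, M.Reaches p v τ y := by
    intro τ h1 h2
    obtain ⟨τ', hτ', hlt⟩ := exists_lt_of_csInf_lt hAne h1
    obtain ⟨y, hy⟩ := hτ'.2.2
    exact hy.exists_later hlt.le h2
  set L := p.1 - τ₀ with hL
  have hLpos : 0 < L := sub_pos.2 hτ₀p
  -- With k + 2 in the denominator every `u k`, including the first, lies strictly below p.1.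
  set u : ℕ → ℝ := fun k => τ₀ + L / (k + 2) with hu
  have hu1 : ∀ k, τ₀ < u k := fun k => by
    have : 0 < L / ((k : ℝ) + 2) := by positivity
    simp only [hu]; linarith
  have hu2 : ∀ k, u k < p.1 := fun k => by
    have : L / ((k : ℝ) + 2) < L := div_lt_self hLpos (by
      have : (0 : ℝ) ≤ k := Nat.cast_nonneg k
      linarith)
    simp only [hu]; linarith
  have hulim : Filter.Tendsto u Filter.atTop (𝓝 τ₀) := by
    have h1 : Filter.Tendsto (fun k : ℕ => L / ((k : ℝ) + 2)) Filter.atTop (𝓝 0) :=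
      Filter.Tendsto.const_div_atTop
        (Filter.tendsto_atTop_add_const_right _ _ tendsto_natCast_atTop_atTop) L
    simpa using h1.const_add τ₀
  choose y hy using fun k => hlater (u k) (hu1 k) (hu2 k)
  set C := Real.exp (N₀ * |K₀| * L) * N₀ with hC
  have hCpos : 0 < C := by positivity
  -- The points lie on different leaves but are compared in S with the single metric of time τ₀. By
  -- uniqueness they lie on one geodesic, so the time difference bounds their distance.
  have hdist : ∀ i j, u j ≤ u i →
      M.leafEDist τ₀ (y i) (y j) ≤ ENNReal.ofReal (C * (u i - u j)) := by
    intro i j hij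
    obtain ⟨γ, b, hj, hvj⟩ := hy j
    obtain ⟨γ', b', hi, hvi⟩ := hy i
    obtain ⟨c, hc, hcτ⟩ := hj.exists_time (τ := u i) ⟨hij, hu2 i⟩
    have hci := (hi.unique (hj.restrict hc) (hvi.trans hvj.symm) hcτ.symm).2
    have hyi : y i = (γ c).2 := congrArg Prod.snd hci
    have hyj : y j = (γ b).2 := by rw [hj.2.2]
    have h1 := hj.1.leafEDist_le hN₀ hlapse hdeform hτ₀I (L := L) ⟨hc.1.le, hc.2⟩
      ⟨hj.1.pos.le, le_rfl⟩ hc.2 (fun s hs => by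
        have hs' : s ∈ Set.Icc 0 b := ⟨hc.1.le.trans hs.1, hs.2⟩
        have h2 := hj.1.strictAntiOn.antitoneOn hs' ⟨hj.1.pos.le, le_rfl⟩ hs.2
        have h3 := hj.1.strictAntiOn.antitoneOn ⟨le_rfl, hj.1.pos.le⟩ hs' hs'.1
        simp only [hj.2.1, hj.2.2] at h2 h3
        have h4 := hu1 j
        rw [abs_le]
        constructor <;> linarith)
    rw [hyi, hyj]
    rw [hcτ, hj.2.2] at h1
    simpa only [hj.2.2] using h1
  have hcauchy : ∀ ε : ENNReal, 0 < ε → ∃ N, ∀ i ≥ N, ∀ j ≥ N,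
      M.leafEDist τ₀ (y i) (y j) < ε := by
    intro ε hε
    have h1 : Filter.Tendsto (fun k => ENNReal.ofReal (C * (u k - τ₀))) Filter.atTop (𝓝 0) := by
      have h2 : Filter.Tendsto (fun k => C * (u k - τ₀)) Filter.atTop (𝓝 0) := by
        simpa using (hulim.sub_const τ₀).const_mul C
      simpa using ENNReal.tendsto_ofReal h2
    obtain ⟨N, hN⟩ := Filter.eventually_atTop.1 (h1.eventually (gt_mem_nhds hε))
    have key : ∀ i ≥ N, ∀ j, u j ≤ u i → M.leafEDist τ₀ (y i) (y j) < ε := fun i hi j hij =>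
      ((hdist i j hij).trans (ENNReal.ofReal_le_ofReal (by
        have := hu1 j
        gcongr))).trans_lt (hN i hi)
    refine ⟨N, fun i hi j hj => ?_⟩
    rcases le_total (u j) (u i) with h | h
    · exact key i hi j h
    · rw [leafEDist_comm]; exact key j hj i h
  obtain ⟨x, hx⟩ := hcomplete τ₀ hτ₀I y hcauchy
  -- Completeness of the leaf at τ₀ gave the limit x. Existence for a uniform time near (τ₀, x)
  -- continues the geodesic from a point close to x down to the later of t and τ₀ - η; the infimum
  -- property rules out τ₀ - η, so t is reached.
  obtain ⟨η, hη, hnear⟩ := eventually_exists_reaches (M.I_subset_J hτ₀I) x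
  obtain ⟨k, hk⟩ := ((hulim.prodMk_nhds hx).eventually hnear).exists
  set t' := max t (τ₀ - η) with ht'
  have ht'u : t' < u k := max_lt (htτ₀.trans_lt (hu1 k)) (by linarith [hu1 k])
  have ht'I : t' ∈ M.I := hI t' ⟨le_max_left _ _, (ht'u.trans (hu2 k)).le⟩
  obtain ⟨γ, b, hj, hvj⟩ := hy k
  have hb : b ∈ Set.Icc 0 b := ⟨hj.1.pos.le, le_rfl⟩
  obtain ⟨y', γ', b', hj', hvj'⟩ := hk (hI _ ⟨htτ₀.trans (hu1 k).le, (hu2 k).le⟩)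
    (leafVelocity γ b) (hj.1.leafVelocity_ne_zero hb) t' ht'I (le_max_right _ _) ht'u
  obtain ⟨γ'', hj'', hv''⟩ := hj.trans hj' hvj'.symm
  have hR : M.Reaches p v t' y' := ⟨γ'', _, hj'', hv''.trans hvj⟩
  have hmem : t' ∈ A := ⟨le_max_left _ _, ht'u.trans (hu2 k), y', hR⟩
  have hle : τ₀ ≤ t' := csInf_le hbdd hmem
  rcases le_total t (τ₀ - η) with h | h
  · rw [ht', max_eq_right h] at hle
    linarith
  · rw [ht', max_eq_left h] at hR
    exact ⟨y', hR⟩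

end Manifold

end FoliatedSpacetime
end

/-! ### From the null exponential map to the end point map of the geodesic flow. -/

noncomputable section

/-- A vector annihilated by a surjective derivative is tangent to a curve in the level set. -/
lemma HasStrictFDerivAt.exists_curve {E F : Type*} [NormedAddCommGroup E] [NormedSpace ℝ E]
    [CompleteSpace E] [NormedAddCommGroup F] [NormedSpace ℝ F] [FiniteDimensional ℝ F]
    {f : E → F} {f' : E →L[ℝ] F} {a : E} (hf : HasStrictFDerivAt f f' a)
    (hsurj : Function.Surjective f') {W : E} (hW : f' W = 0) :
    ∃ c : ℝ → E, c 0 = a ∧ HasDerivAt c W 0 ∧ ∀ᶠ s in 𝓝 0, f (c s) = f a := by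
  have hr : f'.range = ⊤ := LinearMap.range_eq_top.2 hsurj
  set k : f'.ker := ⟨W, hW⟩ with hk
  have hline : HasDerivAt (fun s : ℝ => s • k) k 0 := by
    simpa using (hasDerivAt_id (0 : ℝ)).smul_const k
  have h0 : (0 : ℝ) • k = 0 := zero_smul _ _
  refine ⟨fun s => hf.implicitFunction f f' hr (f a) (s • k), ?_, ?_, ?_⟩
  · change hf.implicitFunction f f' hr (f a) ((0 : ℝ) • k) = a
    rw [h0, hf.implicitFunction_apply_image hr]
  · have h1 := hf.to_implicitFunction hr
    rw [← h0] at h1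
    exact h1.hasFDerivAt.comp_hasDerivAt (0 : ℝ) hline
  · have h1 : Filter.Tendsto (fun s : ℝ => (f a, s • k)) (𝓝 0) (𝓝 (f a, 0)) := by
      rw [← h0]
      exact tendsto_const_nhds.prodMk_nhds hline.continuousAt
    exact h1.eventually (hf.map_implicitFunction_eq hr)

/-- If a partial derivative is injective then the function is locally injective in that variable,
uniformly in the other one. -/
lemma HasStrictFDerivAt.eventually_eq_of_eq {E F G : Type*} [NormedAddCommGroup E]
    [NormedSpace ℝ E] [NormedAddCommGroup F] [NormedSpace ℝ F] [FiniteDimensional ℝ F]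
    [NormedAddCommGroup G] [NormedSpace ℝ G] {f : E × F → G} {f' : E × F →L[ℝ] G} {a : E × F}
    (hf : HasStrictFDerivAt f f' a) (hinj : ∀ W, f' (0, W) = 0 → W = 0) :
    ∀ᶠ c : (E × F) × (E × F) in 𝓝 (a, a), c.1.1 = c.2.1 → f c.1 = f c.2 → c.1 = c.2 := by
  set B : F →L[ℝ] G := f'.comp (ContinuousLinearMap.inr ℝ E F) with hB
  obtain ⟨K, hK, hKB⟩ := B.toLinearMap.exists_antilipschitzWith
    (LinearMap.ker_eq_bot'.2 fun W hW => hinj W hW)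
  have hbound : ∀ W, ‖W‖ ≤ K * ‖B W‖ := fun W => by
    have := hKB.le_mul_dist W 0
    simpa using this
  have hK' : (0 : ℝ) < K := hK
  -- An error of at most half the lower bound ‖B W‖ ≥ ‖W‖ / K cannot cancel the linear term unless
  -- the difference is zero.
  have hlo := hf.isLittleO.def (c := (2 * K : ℝ)⁻¹) (by positivity)
  filter_upwards [hlo] with c hc h1 h2
  have hsub : c.1 - c.2 = (0, c.1.2 - c.2.2) := Prod.ext (by simp [h1]) rfl
  rw [h2, sub_self, zero_sub, norm_neg, hsub] at hc
  have h3 : ‖B (c.1.2 - c.2.2)‖ ≤ (2 * K : ℝ)⁻¹ * ‖c.1.2 - c.2.2‖ := by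
    have h5 : ‖((0 : E), c.1.2 - c.2.2)‖ = ‖c.1.2 - c.2.2‖ := by simp [Prod.norm_def]
    rw [h5] at hc
    exact hc
  have h4 := hbound (c.1.2 - c.2.2)
  have h6 : ‖c.1.2 - c.2.2‖ ≤ 2⁻¹ * ‖c.1.2 - c.2.2‖ := by
    calc _ ≤ _ := h4
      _ ≤ K * ((2 * K : ℝ)⁻¹ * ‖c.1.2 - c.2.2‖) := by gcongr
      _ = 2⁻¹ * ‖c.1.2 - c.2.2‖ := by field_simp
  have h7 : ‖c.1.2 - c.2.2‖ = 0 := by linarith [norm_nonneg (c.1.2 - c.2.2)]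
  exact Prod.ext h1 (sub_eq_zero.1 (norm_eq_zero.1 h7))

namespace FoliatedSpacetime

set_option maxSynthPendingDepth 3

variable {S : Type*} [TopologicalSpace S] [ChartedSpace E3 S] {M : FoliatedSpacetime S}
variable [IsManifold 𝓘(ℝ, E3) ∞ S] [T2Space S]

/-- The derivative of the flow in the direction of a multiple of the velocity. -/
lemma IsFlowMap.deriv_smul {x₀ x₁ : S} {a : (ℝ × E3) × (ℝ × E3)} {T : ℝ} (hT : 0 ≤ T)
    {Φ : (ℝ × E3) × (ℝ × E3) → (ℝ × E3) × (ℝ × E3)}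
    {Φ' : (ℝ × E3) × (ℝ × E3) →L[ℝ] (ℝ × E3) × (ℝ × E3)} (h : M.IsFlowMap x₀ a x₁ T Φ Φ')
    {γ : ℝ → ℝ × S} {T' κ₀ : ℝ} {X : ℝ × E3} (hγ : M.OpenGeod γ T')
    (hx : (γ 0).2 ∈ (chart x₀).source) (h0 : coordState x₀ γ 0 = (a.1, X)) (hκ₀ : 0 ≤ κ₀)
    (hκT : κ₀ * T ≤ T') (ha : a.2 = κ₀ • X) (hx₁ : (γ (κ₀ * T)).2 ∈ (chart x₁).source) :
    (Φ' (0, X)).1 = T • (coordState x₁ γ (κ₀ * T)).2 := by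
  have hgκ := hγ.geodAt (κ₀ * T) ⟨mul_nonneg hκ₀ hT, hκT⟩
  have ha' : ((a.1, κ₀ • X) : (ℝ × E3) × (ℝ × E3)) = a := by rw [← ha]
  have hline : HasDerivAt (fun κ : ℝ => ((a.1, κ • X) : (ℝ × E3) × (ℝ × E3))) (0, X) κ₀ :=
    (hasDerivAt_const κ₀ a.1).prodMk (by simpa using (hasDerivAt_id κ₀).smul_const X)
  have hd1 : HasDerivAt (fun κ : ℝ => (Φ (a.1, κ • X)).1) (Φ' (0, X)).1 κ₀ := by
    have := h.strict.hasFDerivAt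
    rw [← ha'] at this
    exact (this.comp_hasDerivAt κ₀ hline).fst_comp
  have hd2 : HasDerivAt (fun κ : ℝ => coordCurve x₁ γ (κ * T))
      (T • (coordState x₁ γ (κ₀ * T)).2) κ₀ := by
    have h1 := ((contDiffAt_coordCurve hgκ.contMDiffAt hx₁).differentiableAt
      (by norm_num)).hasDerivAt
    have h2 : HasDerivAt (fun κ : ℝ => κ * T) T κ₀ := by
      simpa using (hasDerivAt_id κ₀).mul_const T
    exact h1.scomp κ₀ h2
  refine hd1.unique (hd2.congr_of_eventuallyEq ?_)
  have hct : Continuous fun κ : ℝ => κ * T := by fun_prop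
  have e1 := hct.continuousAt.eventually (eventually_mem_source hgκ.contMDiffAt.continuousAt hx₁)
  have e2 : ∀ᶠ κ in 𝓝 κ₀, M.Link x₀ (a.1, κ • X) x₁ (Φ (a.1, κ • X)) T :=
    hline.continuousAt.eventually (by dsimp only; rw [ha']; exact h.link)
  have e3 : ∀ᶠ κ in 𝓝 κ₀, ∀ s ∈ Set.Icc 0 T, M.GeodAt (fun r => γ (κ * r + 0)) s := by
    obtain ⟨ε, hε, hg⟩ := hγ
    obtain ⟨η, hη, hηT⟩ : ∃ η > 0, η * T < ε := by
      refine ⟨ε / (T + 1), by positivity, ?_⟩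
      rw [div_mul_eq_mul_div, div_lt_iff₀ (by positivity)]
      linarith
    filter_upwards [Ioo_mem_nhds (show κ₀ - η < κ₀ by linarith)
      (show κ₀ < κ₀ + η by linarith)] with κ hκ s hs
    refine GeodAt.comp_affine (hg _ ?_)
    have h1 : η * s ≤ η * T := mul_le_mul_of_nonneg_left hs.2 hη.le
    have h2 : κ₀ * s ≤ κ₀ * T := mul_le_mul_of_nonneg_left hs.2 hκ₀
    have h3 : 0 ≤ κ₀ * s := mul_nonneg hκ₀ hs.1
    have h4 : (κ₀ - η) * s ≤ κ * s := mul_le_mul_of_nonneg_right hκ.1.le hs.1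
    have h5 : κ * s ≤ (κ₀ + η) * s := mul_le_mul_of_nonneg_right hκ.2.le hs.1
    constructor <;> linarith
  filter_upwards [e1, e2, e3] with κ h1 h2 h3
  -- Homogeneity: the geodesic with initial velocity κX is r ↦ γ(κr), so the end point for length T
  -- is γ(κT), to be differentiated in κ.
  have hst : coordState x₀ (fun r => γ (κ * r + 0)) 0 = (a.1, κ • X) := by
    rw [coordState_comp_affine, mul_zero, add_zero, h0]
  have := IsFlowMap.apply_eq (x₁ := x₁) hT h3 (by simpa using hx) (by simpa using h1)
    (by rw [hst]; exact h2)
  rw [this, coordState_comp_affine, add_zero]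
  rfl

/-- Euler's relation for the flow, which is homogeneous in the velocity. -/
lemma IsFlowMap.euler {x₀ x₁ : S} {a : (ℝ × E3) × (ℝ × E3)} {T : ℝ} (hT : 0 ≤ T)
    {Φ : (ℝ × E3) × (ℝ × E3) → (ℝ × E3) × (ℝ × E3)}
    {Φ' : (ℝ × E3) × (ℝ × E3) →L[ℝ] (ℝ × E3) × (ℝ × E3)} (h : M.IsFlowMap x₀ a x₁ T Φ Φ') :
    (Φ' (0, a.2)).1 = T • (Φ a).2 := by
  obtain ⟨γ, hγ, hx, h0, hx₁, h1⟩ := h.link.self_of_nhds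
  have := h.deriv_smul hT hγ hx (X := a.2) h0 zero_le_one (one_mul T).le (one_smul ℝ a.2).symm
    (by rw [one_mul]; exact hx₁)
  rwa [one_mul, h1] at this

/-- At zero velocity, the derivative of the end point with respect to the velocity is the
identity. -/
lemma IsFlowMap.deriv_zero {x₀ : S} {z : ℝ × E3}
    {Φ : (ℝ × E3) × (ℝ × E3) → (ℝ × E3) × (ℝ × E3)}
    {Φ' : (ℝ × E3) × (ℝ × E3) →L[ℝ] (ℝ × E3) × (ℝ × E3)}
    (h : M.IsFlowMap x₀ (z, 0) x₀ 1 Φ Φ') (W : ℝ × E3) : (Φ' (0, W)).1 = W := by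
  have hline : Continuous (fun κ : ℝ => ((z, κ • W) : (ℝ × E3) × (ℝ × E3))) := by fun_prop
  have h1 : ∀ᶠ κ : ℝ in 𝓝 0, M.Link x₀ (z, κ • W) x₀ (Φ (z, κ • W)) 1 :=
    hline.continuousAt.eventually (by dsimp only; rw [zero_smul]; exact h.link)
  -- The geodesic with velocity W need not exist up to parameter 1, but the one with velocity κW
  -- does for small κ > 0; linearity of the derivative then cancels κ.
  obtain ⟨κ, hκ, hκ0⟩ := ((h1.filter_mono nhdsWithin_le_nhds).and
    (self_mem_nhdsWithin (a := (0 : ℝ)) (s := Set.Ioi 0))).exists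
  obtain ⟨γ, hγ, hx, h0, -⟩ := hκ
  have h2 := h.deriv_smul zero_le_one hγ hx (X := κ • W) h0 le_rfl (by norm_num)
    (by simp) (by simpa using hx)
  rw [zero_mul, h0, one_smul] at h2
  have h3 : ((0, κ • W) : (ℝ × E3) × (ℝ × E3)) = κ • (0, W) := by simp
  rw [h3, map_smul] at h2
  exact smul_right_injective _ (ne_of_gt hκ0) h2

lemma nullExp_eq {p : ℝ × S} {v : E3} {t : ℝ} {y : S} (h : M.Reaches p v t y) :
    M.nullExp p t v = y := by
  have hex : ∃ y, M.Reaches p v t y := ⟨y, h⟩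
  rw [nullExp, dif_pos hex]
  obtain ⟨γ, b, hj, hv⟩ := h
  obtain ⟨γ', b', hj', hv'⟩ := hex.choose_spec
  exact congrArg Prod.snd (hj'.unique hj (hv'.trans hv.symm) rfl).2

/-- Where the null exponential map is nonsingular, the end point of the geodesic flow depends
nonsingularly on the velocity. -/
theorem IsFlowMap.injective_of_nonsingularAt {p q : ℝ × S} {γ : ℝ → ℝ × S} {T : ℝ}
    (hj : M.Joins γ T p q) {x₀ x₁ : S} (hx : p.2 ∈ (chart x₀).source)
    (hx₁ : q.2 ∈ (chart x₁).source) {Φ : (ℝ × E3) × (ℝ × E3) → (ℝ × E3) × (ℝ × E3)}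
    {Φ' : (ℝ × E3) × (ℝ × E3) →L[ℝ] (ℝ × E3) × (ℝ × E3)}
    (h : M.IsFlowMap x₀ (coordState x₀ γ 0) x₁ T Φ Φ') {ξ : E3} {κ : ℝ} (hκ : 0 < κ)
    (hξ : leafVelocity γ 0 = κ • ξ) (hns : M.NonsingularAt p q.1 ξ) {W : ℝ × E3}
    (hW : (Φ' (0, W)).1 = 0) : W = 0 := by
  have hT := hj.1.pos
  have h0mem : (0 : ℝ) ∈ Set.Icc 0 T := ⟨le_rfl, hT.le⟩
  have hTmem : T ∈ Set.Icc 0 T := ⟨hT.le, le_rfl⟩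
  have hx' : (γ 0).2 ∈ (chart x₀).source := by rw [hj.2.1]; exact hx
  have hx₁' : (γ T).2 ∈ (chart x₁).source := by rw [hj.2.2]; exact hx₁
  set a := coordState x₀ γ 0 with ha
  have hΦa : Φ a = coordState x₁ γ T :=
    IsFlowMap.apply_eq hT.le hj.1.geodAt hx' hx₁' h.link.self_of_nhds
  have hpn : M.PastNull x₀ a := hj.1.pastNull h0mem hx'
  have hpn₁ : M.PastNull x₁ (Φ a) := by rw [hΦa]; exact hj.1.pastNull hTmem hx₁'
  have ha1 : a.1 = (p.1, chart x₀ p.2) := by simp only [ha, coordState, coordCurve, hj.2.1]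
  have hsymm : (chart x₀).symm a.1.2 = p.2 := by rw [ha1]; exact (chart x₀).left_inv hx
  have hpI : p.1 ∈ M.I := by have := hj.1.mem_region 0 h0mem; rwa [hj.2.1] at this
  have hqI : q.1 ∈ M.I := by have := hj.1.mem_region T hTmem; rwa [hj.2.2] at this
  have hv : leafVelocity γ 0 = chartSymmDeriv x₀ a.1.2 a.2.2 :=
    (hj.1.geodAt 0 h0mem).leafVelocity_eq hx'
  have hξ0 : ξ ≠ 0 := by
    rintro rfl
    rw [smul_zero] at hξ
    exact hj.1.leafVelocity_ne_zero h0mem hξ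
  have hξpos : 0 < M.leafMetric p.1 p.2 ξ ξ := M.leafMetric_pos (M.I_subset_J hpI) p.2 hξ0
  -- `W` is tangent to the null cone
  have hcone : M.chartMetric x₀ a.1 a.2 W = 0 := by
    have h1 := h.firstVariation (0, W)
    rw [hW, fderiv_kinetic hpn.mem] at h1
    simp only [map_zero, zero_apply, mul_zero, zero_add] at h1
    rcases mul_eq_zero.1 h1.symm with h2 | h2
    · exact absurd h2 hT.ne'
    · exact h2
  have heuler := h.euler hT.le
  -- a curve of null vectors for which the arrival time is constant
  obtain ⟨c, hc0, hcd, hclev⟩ : ∃ c : ℝ → ℝ × E3, c 0 = a.2 ∧ HasDerivAt c W 0 ∧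
      ∀ᶠ s in 𝓝 0, (M.kinetic x₀ (a.1, c s), (Φ (a.1, c s)).1.1) = ((0 : ℝ), q.1) := by
    have hin : HasStrictFDerivAt (fun X : ℝ × E3 => ((a.1, X) : (ℝ × E3) × (ℝ × E3)))
        (ContinuousLinearMap.inr ℝ (ℝ × E3) (ℝ × E3)) a.2 :=
      (hasStrictFDerivAt_const a.1 a.2).prodMk (hasStrictFDerivAt_id a.2)
    have hk := HasStrictFDerivAt.comp (f := fun X : ℝ × E3 => ((a.1, X) : (ℝ × E3) × (ℝ × E3)))
      a.2 (hasStrictFDerivAt_kinetic hpn.mem) hin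
    have ht := HasStrictFDerivAt.comp (f := fun X : ℝ × E3 => ((a.1, X) : (ℝ × E3) × (ℝ × E3)))
      a.2 h.strict.fst.fst hin
    have hf := hk.prodMk ht
    have hval : (M.kinetic x₀ (a.1, a.2), (Φ (a.1, a.2)).1.1) = ((0 : ℝ), q.1) := by
      refine Prod.ext hpn.null ?_
      change (Φ a).1.1 = q.1
      rw [hΦa]
      simp [coordState, coordCurve, hj.2.2]
    have happ : ∀ V, ((fderiv ℝ (M.kinetic x₀) a).comp
        (ContinuousLinearMap.inr ℝ (ℝ × E3) (ℝ × E3))) V = M.chartMetric x₀ a.1 a.2 V := by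
      intro V
      rw [ContinuousLinearMap.comp_apply, fderiv_kinetic hpn.mem]
      simp
    -- Surjectivity of the derivative of (energy, arrival time): ∂_t changes the energy to first
    -- order, while scaling the null velocity leaves the energy fixed and, by Euler's relation,
    -- changes the arrival time.
    obtain ⟨c, h1, h2, h3⟩ := hf.exists_curve (W := W) (by
      obtain ⟨V, hV⟩ : ∃ V, M.chartMetric x₀ a.1 a.2 V ≠ 0 := by
        refine ⟨(1, 0), ?_⟩
        rw [chartMetric_apply]
        have h4 := M.lapse_pos a.1.1 hpn.mem.1 ((chart x₀).symm a.1.2)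
        simpa using ⟨h4.ne', hpn.past.ne⟩
      rintro ⟨α, β⟩
      have hX1 : T * (Φ a).2.1 ≠ 0 := mul_ne_zero hT.ne' hpn₁.past.ne
      have hnull : M.chartMetric x₀ a.1 a.2 a.2 = 0 := by
        have := hpn.null
        simp only [kinetic] at this
        linarith
      have he1 : (Φ' (0, a.2)).1.1 = T * (Φ a).2.1 := by rw [heuler]; rfl
      set α' := α / M.chartMetric x₀ a.1 a.2 V with hα'
      refine ⟨α' • V + ((β - (Φ' (0, α' • V)).1.1) / (T * (Φ a).2.1)) • a.2, ?_⟩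
      rw [ContinuousLinearMap.prod_apply, happ]
      refine Prod.ext ?_ ?_
      · simp only [map_add, map_smul, hnull, smul_eq_mul, mul_zero, add_zero, hα']
        field_simp
      · change (Φ' (0, α' • V +
          ((β - (Φ' (0, α' • V)).1.1) / (T * (Φ a).2.1)) • a.2)).1.1 = β
        have hlin : ∀ (U : ℝ × E3) (r : ℝ), (Φ' (0, U + r • a.2)).1.1 =
            (Φ' (0, U)).1.1 + r * (Φ' (0, a.2)).1.1 := fun U r => by
          have : ((0, U + r • a.2) : (ℝ × E3) × (ℝ × E3)) = (0, U) + r • (0, a.2) := by simp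
          rw [this, map_add, map_smul]
          rfl
        rw [hlin, he1, div_mul_cancel₀ _ hX1, add_sub_cancel]) (by
      rw [ContinuousLinearMap.prod_apply, happ, hcone]
      refine Prod.ext rfl ?_
      change (Φ' (0, W)).1.1 = 0
      rw [hW]
      rfl)
    refine ⟨c, h1, h2, ?_⟩
    filter_upwards [h3] with s hs
    exact hs.trans hval
  -- differentiability of the null exponential map
  have hMD : MDifferentiableAt 𝓘(ℝ, E3) 𝓘(ℝ, E3) (M.nullExp p q.1) ξ := by
    -- Where the map is not differentiable, `mfderiv` is zero by default. Nonsingularity would then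
    -- fail on any nonzero w orthogonal to ξ, and such w exist in dimension 3.
    by_contra hnd
    have hker := LinearMap.ker_ne_bot_of_finrank_lt (f := (M.leafMetric p.1 p.2 ξ).toLinearMap)
      (by simp)
    obtain ⟨w, hw, hw0⟩ := (Submodule.ne_bot_iff _).1 hker
    refine hw0 (hns w hw ?_)
    rw [mfderiv_zero_of_not_mdifferentiableAt hnd]
    rfl
  have hNξ : M.nullExp p q.1 ξ = q.2 := by
    refine nullExp_eq ?_
    have h1 : M.Reaches p (κ • ξ) q.1 q.2 := ⟨γ, T, hj, hξ⟩
    have h2 := h1.smul (inv_pos.2 hκ)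
    rwa [smul_smul, inv_mul_cancel₀ hκ.ne', one_smul] at h2
  obtain ⟨L, hL⟩ : ∃ L : E3 →L[ℝ] E3,
      L = mfderiv 𝓘(ℝ, E3) 𝓘(ℝ, E3) (M.nullExp p q.1) ξ := ⟨_, rfl⟩
  have hns' : ∀ w, M.leafMetric p.1 p.2 ξ w = 0 → L w = 0 → w = 0 := fun w h1 h2 => by
    rw [hL] at h2
    exact hns w h1 h2
  have hfd : HasFDerivAt (fun v => chart x₁ (M.nullExp p q.1 v)) ((chartDeriv x₁ q.2).comp L) ξ := by
    have h1 := (mdifferentiableAt_chart (x₀ := x₁) (x := M.nullExp p q.1 ξ)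
      (by rw [hNξ]; exact hx₁)).hasMFDerivAt.comp ξ hMD.hasMFDerivAt
    rw [hL, ← hNξ]
    exact h1.hasFDerivAt
  have hLzero : ∀ w, chartDeriv x₁ q.2 (L w) = 0 → L w = 0 := fun w hw => by
    rw [← chartSymmDeriv_chartDeriv hx₁ (L w), hw, map_zero]
  -- the derivative vanishes in the radial direction
  have hrad : L ξ = 0 := by
    refine hLzero ξ ?_
    have hline : HasDerivAt (fun s : ℝ => (1 + s) • ξ) ξ 0 := by
      simpa using ((hasDerivAt_id (0 : ℝ)).const_add 1).smul_const ξ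
    have h1 := HasFDerivAt.comp_hasDerivAt (f := fun s : ℝ => (1 + s) • ξ) (0 : ℝ)
      (by rw [add_zero, one_smul]; exact hfd) hline
    have h2 : (fun _ : ℝ => chart x₁ q.2) =ᶠ[𝓝 0]
        ((fun v => chart x₁ (M.nullExp p q.1 v)) ∘ fun s : ℝ => (1 + s) • ξ) := by
      filter_upwards [lt_mem_nhds (show (-1 : ℝ) < 0 by norm_num)] with s hs
      have h3 : M.Reaches p (κ • ξ) q.1 q.2 := ⟨γ, T, hj, hξ⟩
      have h4 := h3.smul (κ := (1 + s) / κ) (div_pos (by linarith) hκ)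
      rw [smul_smul, div_mul_cancel₀ _ hκ.ne'] at h4
      simp only [Function.comp, nullExp_eq h4]
    exact (h1.congr_of_eventuallyEq h2).unique (hasDerivAt_const (0 : ℝ) _)
  -- V is the velocity, at ξ, of the rescaled leaf components of the curve c. The geodesics with
  -- these data all arrive at time q.1, so the null exponential map along them has the same
  -- derivative as the flow, which is zero.
  obtain ⟨V, hV⟩ : ∃ V, V = κ⁻¹ • chartSymmDeriv x₀ a.1.2 W.2 := ⟨_, rfl⟩
  have hVzero : L V = 0 := by
    refine hLzero V ?_
    have hσ : HasDerivAt (fun s => κ⁻¹ • chartSymmDeriv x₀ a.1.2 (c s).2) V 0 := by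
      rw [hV]
      exact ((chartSymmDeriv x₀ a.1.2).hasFDerivAt.comp_hasDerivAt (0 : ℝ) hcd.snd_comp).const_smul κ⁻¹
    have hσ0 : κ⁻¹ • chartSymmDeriv x₀ a.1.2 (c 0).2 = ξ := by
      rw [hc0, ← hv, hξ, smul_smul, inv_mul_cancel₀ hκ.ne', one_smul]
    have h1 := HasFDerivAt.comp_hasDerivAt
      (f := fun s => κ⁻¹ • chartSymmDeriv x₀ a.1.2 (c s).2) (0 : ℝ)
      (by rw [hσ0]; exact hfd) hσ
    have hac : HasDerivAt (fun s => ((a.1, c s) : (ℝ × E3) × (ℝ × E3))) (0, W) 0 :=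
      (hasDerivAt_const (0 : ℝ) a.1).prodMk hcd
    have ha0 : ((a.1, c 0) : (ℝ × E3) × (ℝ × E3)) = a := by rw [hc0]
    have h2 : HasDerivAt (fun s => (Φ (a.1, c s)).1.2) (Φ' (0, W)).1.2 0 := by
      have := h.strict.hasFDerivAt
      rw [← ha0] at this
      exact (this.comp_hasDerivAt (0 : ℝ) hac).fst_comp.snd_comp
    rw [hW] at h2
    have e1 : ∀ᶠ s in 𝓝 (0 : ℝ), M.Link x₀ (a.1, c s) x₁ (Φ (a.1, c s)) T :=
      hac.continuousAt.eventually (by dsimp only; rw [ha0]; exact h.link)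
    have e2 : ∀ᶠ s in 𝓝 (0 : ℝ), (c s).1 < 0 := by
      refine hcd.continuousAt.fst.eventually_lt continuousAt_const ?_
      rw [hc0]; exact hpn.past
    have h3 : (fun s => (Φ (a.1, c s)).1.2) =ᶠ[𝓝 0]
        ((fun v => chart x₁ (M.nullExp p q.1 v)) ∘
          fun s => κ⁻¹ • chartSymmDeriv x₀ a.1.2 (c s).2) := by
      filter_upwards [e1, e2, hclev] with s h4 h5 h6
      have h7 : (Φ (a.1, c s)).1.1 = q.1 := congrArg Prod.snd h6
      have h8 : M.kinetic x₀ (a.1, c s) = 0 := congrArg Prod.fst h6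
      obtain ⟨γ', hj', -, -, hv', -⟩ := h4.joins hT ⟨hpn.mem, h8, h5⟩
        (by rw [ha1]; exact hpI) (by rw [h7]; exact hqI)
      rw [h7, hsymm] at hj'
      have hpp : ((a.1.1, p.2) : ℝ × S) = p := by rw [ha1]
      rw [hpp] at hj'
      have hR : M.Reaches p (chartSymmDeriv x₀ a.1.2 (c s).2) q.1
        ((chart x₁).symm (Φ (a.1, c s)).1.2) := ⟨γ', T, hj', hv'⟩
      simp only [Function.comp, nullExp_eq (hR.smul (inv_pos.2 hκ))]
      exact ((chart x₁).right_inv (h4.mem_coordDomain_right hT.le).2).symm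
    exact (h1.congr_of_eventuallyEq h3).unique h2
  -- hence `W` is a multiple of the velocity
  obtain ⟨α, hα⟩ : ∃ α, α = M.leafMetric p.1 p.2 ξ V / M.leafMetric p.1 p.2 ξ ξ := ⟨_, rfl⟩
  have hVα : V - α • ξ = 0 := by
    refine hns' _ ?_ ?_
    · rw [map_sub, map_smul, smul_eq_mul, hα]
      field_simp
      ring
    · rw [map_sub, map_smul, hVzero, hrad, smul_zero, sub_zero]
  have hW2 : W.2 = α • a.2.2 := by
    have h1 : chartSymmDeriv x₀ a.1.2 (W.2 - α • a.2.2) = 0 := by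
      have h2 : chartSymmDeriv x₀ a.1.2 W.2 = κ • V := by
        rw [hV, smul_smul, mul_inv_cancel₀ hκ.ne', one_smul]
      rw [map_sub, map_smul, ← hv, hξ, h2, sub_eq_zero.1 hVα, smul_comm, sub_self]
    exact sub_eq_zero.1 (chartSymmDeriv_eq_zero hpn.mem.2 h1)
  have hWa : W = α • a.2 := by
    refine Prod.ext ?_ hW2
    have hnull : M.chartMetric x₀ a.1 a.2 a.2 = 0 := by
      have := hpn.null
      simp only [kinetic] at this
      linarith
    have h1 : M.chartMetric x₀ a.1 a.2 (W - α • a.2) = 0 := by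
      rw [map_sub, map_smul, hcone, hnull, smul_zero, sub_zero]
    rw [chartMetric_apply, Prod.snd_sub, Prod.smul_snd, hW2, sub_self, map_zero, map_zero,
      add_zero] at h1
    have h4 := M.lapse_pos a.1.1 hpn.mem.1 ((chart x₀).symm a.1.2)
    have h5 : -(M.lapse a.1.1 ((chart x₀).symm a.1.2)) ^ 2 * a.2.1 ≠ 0 :=
      mul_ne_zero (neg_ne_zero.2 (pow_ne_zero 2 h4.ne')) hpn.past.ne
    exact sub_eq_zero.1 ((mul_eq_zero.1 h1).resolve_left h5)
  -- The direction of the velocity itself is not in the kernel: by Euler's relation it moves the end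
  -- point along the geodesic.
  have hα0 : α = 0 := by
    have h1 : ((0, W) : (ℝ × E3) × (ℝ × E3)) = α • (0, a.2) := by rw [hWa]; simp
    rw [h1, map_smul, Prod.smul_fst, heuler] at hW
    have h2 : α * (T * (Φ a).2.1) = 0 := congrArg Prod.fst hW
    exact (mul_eq_zero.1 h2).resolve_right (mul_ne_zero hT.ne' hpn₁.past.ne)
  rw [hWa, hα0, zero_smul]

end FoliatedSpacetime
end

/-! ### Crossings, limits of null geodesics, and a crossing of least extent. -/

noncomputable section

namespace FoliatedSpacetime

set_option maxSynthPendingDepth 3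

variable {S : Type*} [TopologicalSpace S] [ChartedSpace E3 S] {M : FoliatedSpacetime S}

lemma coordState_comp_mul (x₀ : S) (γ : ℝ → ℝ × S) (κ s : ℝ) :
    coordState x₀ (fun r => γ (κ * r)) s =
      ((coordState x₀ γ (κ * s)).1, κ • (coordState x₀ γ (κ * s)).2) := by
  have := coordState_comp_affine x₀ γ κ 0 s
  simpa only [add_zero] using this

lemma Joins.left_mem {γ : ℝ → ℝ × S} {b : ℝ} {p q : ℝ × S} (h : M.Joins γ b p q) :
    p.1 ∈ M.I := by
  have := h.1.mem_region 0 ⟨le_rfl, h.1.pos.le⟩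
  rwa [h.2.1] at this

lemma Joins.right_mem {γ : ℝ → ℝ × S} {b : ℝ} {p q : ℝ × S} (h : M.Joins γ b p q) :
    q.1 ∈ M.I := by
  have := h.1.mem_region b ⟨h.1.pos.le, le_rfl⟩
  rwa [h.2.2] at this

/-- Two different past null geodesics from `p` to `q`, normalized to the parameter interval
`[0, 1]`. -/
structure Crossing (M : FoliatedSpacetime S) (p q : ℝ × S) (γ₁ γ₂ : ℝ → ℝ × S) : Prop where
  left : M.Joins γ₁ 1 p q
  right : M.Joins γ₂ 1 p q
  ne : leafVelocity γ₁ 0 ≠ leafVelocity γ₂ 0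

lemma exists_unit_smul {p : ℝ × S} (hp : p.1 ∈ M.J) {v : E3} (hv : v ≠ 0) :
    ∃ κ > (0 : ℝ), κ⁻¹ • v ∈ M.unitSphere p := by
  have h := M.leafMetric_pos hp p.2 hv
  refine ⟨Real.sqrt (M.leafMetric p.1 p.2 v v), Real.sqrt_pos.2 h, ?_⟩
  change M.leafMetric p.1 p.2 _ _ = 1
  rw [leafMetric_smul_smul, inv_pow, Real.sq_sqrt h.le, inv_mul_cancel₀ h.ne']

section Manifold

variable [IsManifold 𝓘(ℝ, E3) ∞ S]

lemma Joins.normalize {γ : ℝ → ℝ × S} {b : ℝ} {p q : ℝ × S} (h : M.Joins γ b p q) :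
    M.Joins (fun r => γ (b * r)) 1 p q := by
  have := h.comp_mul h.1.pos
  rwa [div_self h.1.pos.ne'] at this

lemma Joins.coordState_zero {γ : ℝ → ℝ × S} {b : ℝ} {p q : ℝ × S} (h : M.Joins γ b p q) {x₀ : S}
    (hx : p.2 ∈ (chart x₀).source) : coordState x₀ γ 0 = ((p.1, chart x₀ p.2),
      M.nullLift x₀ (p.1, chart x₀ p.2) (chartDeriv x₀ p.2 (leafVelocity γ 0))) := by
  rw [h.1.coordState_eq ⟨le_rfl, h.1.pos.le⟩ (by rw [h.2.1]; exact hx)]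
  simp only [coordCurve, h.2.1]

/-- Two unit vectors whose null geodesics meet yield a crossing. -/
lemma crossing_of_unit {p q : ℝ × S} {γ₁ γ₂ : ℝ → ℝ × S} {b₁ b₂ : ℝ} (h₁ : M.Joins γ₁ b₁ p q)
    (h₂ : M.Joins γ₂ b₂ p q) (hu₁ : leafVelocity γ₁ 0 ∈ M.unitSphere p)
    (hu₂ : leafVelocity γ₂ 0 ∈ M.unitSphere p) (hne : leafVelocity γ₁ 0 ≠ leafVelocity γ₂ 0) :
    M.Crossing p q (fun r => γ₁ (b₁ * r)) (fun r => γ₂ (b₂ * r)) := by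
  refine ⟨h₁.normalize, h₂.normalize, fun heq => hne ?_⟩
  rw [h₁.leafVelocity_comp_mul, h₂.leafVelocity_comp_mul] at heq
  have hu₁' : M.leafMetric p.1 p.2 (leafVelocity γ₁ 0) (leafVelocity γ₁ 0) = 1 := hu₁
  have hu₂' : M.leafMetric p.1 p.2 (leafVelocity γ₂ 0) (leafVelocity γ₂ 0) = 1 := hu₂
  have h3 := leafMetric_smul_smul (M := M) p.1 p.2 b₁ (leafVelocity γ₁ 0)
  rw [heq, leafMetric_smul_smul, hu₁', hu₂', mul_one, mul_one] at h3
  have hb : b₂ = b₁ := (sq_eq_sq₀ h₂.1.pos.le h₁.1.pos.le).1 h3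
  rw [hb] at heq
  exact smul_right_injective _ h₁.1.pos.ne' heq

variable [T2Space S]

/-- Comparison of parameters on a past null geodesic by means of the time function. -/
lemma Link.time_compare {x₀ x₁ : S} {a a' : (ℝ × E3) × (ℝ × E3)} {T : ℝ} (hT : 0 ≤ T)
    (h : M.Link x₀ a x₁ a' T) {γ : ℝ → ℝ × S} {ρ : ℝ} {p q : ℝ × S} (hj : M.Joins γ ρ p q)
    (hx : p.2 ∈ (chart x₀).source) (ha : coordState x₀ γ 0 = a) :
    (q.1 < a'.1.1 → T < ρ) ∧ (a'.1.1 < q.1 → ρ < T) := by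
  have hx' : (γ 0).2 ∈ (chart x₀).source := by rw [hj.2.1]; exact hx
  have h0mem : (0 : ℝ) ∈ Set.Icc 0 ρ := ⟨le_rfl, hj.1.pos.le⟩
  have hpn : M.PastNull x₀ a := ha ▸ hj.1.pastNull h0mem hx'
  obtain ⟨γ', hγ', hx₀, h0, hx₁, h1⟩ := h
  have hT1 : (γ' T).1 = a'.1.1 := by rw [← h1]; rfl
  have hanti := strictAntiOn_time hγ'.geodAt
    (timeVelocity_neg hγ'.geodAt hx₀ (by rw [h0]; exact hpn))
  have hsame : SameState γ γ' 0 := (sameState_iff (hj.1.geodAt 0 h0mem).contMDiffAt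
    (hγ'.geodAt 0 ⟨le_rfl, hT⟩).contMDiffAt hx' hx₀).2 (ha.trans h0.symm)
  have hsame' : ∀ s, 0 ≤ s → s ≤ ρ → s ≤ T → γ s = γ' s := fun s hs hsρ hsT =>
    (hsame.forward hs (fun r hr => hj.1.geodAt r ⟨hr.1, hr.2.trans hsρ⟩)
      (fun r hr => hγ'.geodAt r ⟨hr.1, hr.2.trans hsT⟩)).1
  rw [← hT1]
  constructor
  · intro hlt
    by_contra hle
    have hle : ρ ≤ T := not_lt.1 hle
    have h2 := hanti.antitoneOn ⟨hj.1.pos.le, hle⟩ ⟨hT, le_rfl⟩ hle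
    simp only [← hsame' ρ hj.1.pos.le le_rfl hle, hj.2.2] at h2
    linarith
  · intro hlt
    by_contra hle
    have hle : T ≤ ρ := not_lt.1 hle
    have h2 := hj.1.strictAntiOn.antitoneOn ⟨hT, hle⟩ ⟨hj.1.pos.le, le_rfl⟩ hle
    simp only [hsame' T hT hle le_rfl, hj.2.2] at h2
    linarith

lemma Link.end_eq {x₀ x₁ : S} {a a' : (ℝ × E3) × (ℝ × E3)} {T : ℝ}
    (h : M.Link x₀ a x₁ a' T) {γ : ℝ → ℝ × S} {p q : ℝ × S} (hj : M.Joins γ T p q)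
    (hx : p.2 ∈ (chart x₀).source) (ha : coordState x₀ γ 0 = a) :
    q.2 ∈ (chart x₁).source ∧ a'.1 = (q.1, chart x₁ q.2) := by
  have hx' : (γ 0).2 ∈ (chart x₀).source := by rw [hj.2.1]; exact hx
  have hT := hj.1.pos.le
  have h0mem : (0 : ℝ) ∈ Set.Icc 0 T := ⟨le_rfl, hT⟩
  obtain ⟨γ', hγ', hx₀, h0, hx₁, h1⟩ := h
  have hsame : SameState γ γ' 0 := (sameState_iff (hj.1.geodAt 0 h0mem).contMDiffAt
    (hγ'.geodAt 0 h0mem).contMDiffAt hx' hx₀).2 (ha.trans h0.symm)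
  have hend := (hsame.forward hT hj.1.geodAt hγ'.geodAt).1
  have hq : q = γ' T := by rw [← hend, hj.2.2]
  refine ⟨by rw [hq]; exact hx₁, ?_⟩
  rw [← h1, hq]
  rfl

/-- The parameters at which past null geodesics reach given times depend continuously on the
data. -/
lemma tendsto_parameter {ι : Type*} {l : Filter ι} {x₀ : S} {b : ℝ} (hb : 0 ≤ b)
    {γ : ℝ → ℝ × S} (hγ : M.OpenGeod γ b) (hx : (γ 0).2 ∈ (chart x₀).source)
    (hpn : M.PastNull x₀ (coordState x₀ γ 0)) {γ' : ι → ℝ → ℝ × S} {ρ : ι → ℝ} {P Q : ι → ℝ × S}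
    (hj : ∀ᶠ k in l, M.Joins (γ' k) (ρ k) (P k) (Q k))
    (hP : ∀ᶠ k in l, (P k).2 ∈ (chart x₀).source)
    (hst : Filter.Tendsto (fun k => coordState x₀ (γ' k) 0) l (𝓝 (coordState x₀ γ 0)))
    (hQ : Filter.Tendsto (fun k => (Q k).1) l (𝓝 (γ b).1)) : Filter.Tendsto ρ l (𝓝 b) := by
  obtain ⟨ε, hε, hg⟩ := hγ
  have hg' : ∀ T < b + ε, ∀ s ∈ Set.Icc 0 T, M.GeodAt γ s := fun T hT s hs =>
    hg s ⟨by linarith [hs.1], by linarith [hs.2]⟩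
  have hflow : ∀ T, 0 ≤ T → T < b + ε → ∃ Φ : (ℝ × E3) × (ℝ × E3) → (ℝ × E3) × (ℝ × E3),
      (Filter.Tendsto (fun k => (Φ (coordState x₀ (γ' k) 0)).1.1) l (𝓝 (γ T).1)) ∧
      ∀ᶠ k in l, M.Link x₀ (coordState x₀ (γ' k) 0) (γ T).2 (Φ (coordState x₀ (γ' k) 0)) T := by
    intro T hT hTε
    obtain ⟨Φ, Φ', hΦ, h0⟩ := exists_flowMap (x₀ := x₀) (x₁ := (γ T).2) hT (hg' T hTε) hx
      (mem_extChartAt_source _)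
    refine ⟨Φ, ?_, hst.eventually hΦ.link⟩
    have h1 : ContinuousAt (fun a => (Φ a).1.1) (coordState x₀ γ 0) :=
      hΦ.strict.continuousAt.fst.fst
    have h2 := h1.tendsto.comp hst
    rw [h0] at h2
    exact h2
  have hanti : ∀ r s, 0 ≤ r → r < s → s < b + ε → (γ s).1 < (γ r).1 := fun r s hr hrs hs =>
    strictAntiOn_time (hg' s hs) (timeVelocity_neg (hg' s hs) hx hpn) ⟨hr, hrs.le⟩
      ⟨hr.trans hrs.le, le_rfl⟩ hrs
  -- For a fixed parameter below or above b, the flow of the nearby data ends at a time strictly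
  -- after or before the target time; monotonicity of time converts this into bounds on the
  -- parameters.
  refine tendsto_order.2 ⟨fun c hc => ?_, fun c hc => ?_⟩
  · rcases lt_or_ge c 0 with hc0 | hc0
    · filter_upwards [hj] with k hk using hc0.trans hk.1.pos
    · obtain ⟨Φ, h1, h2⟩ := hflow c hc0 (by linarith)
      filter_upwards [hj, hP, h2, hQ.eventually_lt h1 (hanti c b hc0 hc (by linarith))]
        with k hjk hPk hlk hlt
      exact (hlk.time_compare hc0 hjk hPk rfl).1 hlt
  · set T := min c (b + ε / 2) with hT
    have hbT : b < T := lt_min hc (by linarith)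
    have hTε : T < b + ε := (min_le_right _ _).trans_lt (by linarith)
    obtain ⟨Φ, h1, h2⟩ := hflow T (hb.trans hbT.le) hTε
    filter_upwards [hj, hP, h2, h1.eventually_lt hQ (hanti b T hb hbT hTε)] with k hjk hPk hlk hlt
    exact ((hlk.time_compare (hb.trans hbT.le) hjk hPk rfl).2 hlt).trans_le (min_le_left _ _)

/-- Limits of past null geodesics. -/
lemma Joins.exists_limit (hex : ∀ p : ℝ × S, p.1 ∈ M.I → ∀ v : E3, v ≠ 0 → ∀ t ∈ M.I, t < p.1 →
      ∃ y, M.Reaches p v t y) {ι : Type*} {l : Ultrafilter ι} {P Q : ι → ℝ × S}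
    {γ : ι → ℝ → ℝ × S} (hj : ∀ k, M.Joins (γ k) 1 (P k) (Q k)) {p : ℝ × S} (hpI : p.1 ∈ M.I)
    (hP : Filter.Tendsto P l (𝓝 p)) {τ : ℝ} (hτI : τ ∈ M.I) (hτ : τ ≤ p.1)
    (hQ : Filter.Tendsto (fun k => (Q k).1) l (𝓝 τ)) :
    ∃ X : ℝ × E3, Filter.Tendsto (fun k => coordState p.2 (γ k) 0) l
        (𝓝 ((p.1, chart p.2 p.2), X)) ∧ (τ = p.1 → X = 0) ∧
      (τ < p.1 → ∃ γ' y, M.Joins γ' 1 p (τ, y) ∧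
        coordState p.2 γ' 0 = ((p.1, chart p.2 p.2), X) ∧
        Filter.Tendsto (fun k => (Q k).2) l (𝓝 y)) := by
  set x₀ := p.2 with hx₀
  have hx₀s : x₀ ∈ (chart x₀).source := mem_extChartAt_source _
  set z : ℝ × E3 := (p.1, chart x₀ x₀) with hz
  have hzm : z ∈ M.coordDomain x₀ := ⟨M.I_subset_J hpI, (chart x₀).map_source hx₀s⟩
  have hPs : ∀ᶠ k in (l : Filter ι), (P k).2 ∈ (chart x₀).source :=
    (continuous_snd.tendsto p |>.comp hP).eventually (extChartAt_source_mem_nhds x₀)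
  set Z : ι → ℝ × E3 := fun k => ((P k).1, chart x₀ (P k).2) with hZ
  have hZlim : Filter.Tendsto Z l (𝓝 z) :=
    ((continuous_fst.tendsto p).comp hP).prodMk_nhds
      ((continuousAt_extChartAt x₀).tendsto.comp ((continuous_snd.tendsto p).comp hP))
  set w : ι → E3 := fun k => chartDeriv x₀ (P k).2 (leafVelocity (γ k) 0) with hw
  have hw0 : ∀ k, (P k).2 ∈ (chart x₀).source → w k ≠ 0 := fun k hk h0 => by
    refine (hj k).1.leafVelocity_ne_zero ⟨le_rfl, zero_le_one⟩ ?_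
    rw [← chartSymmDeriv_chartDeriv hk (leafVelocity (γ k) 0)]
    change chartSymmDeriv x₀ _ (w k) = 0
    rw [h0, map_zero]
  set θ : ι → E3 := fun k => ‖w k‖⁻¹ • w k with hθ
  have hθs : ∀ᶠ k in (l : Filter ι), θ k ∈ Metric.sphere (0 : E3) 1 := by
    filter_upwards [hPs] with k hk
    have := norm_pos_iff.2 (hw0 k hk)
    rw [mem_sphere_zero_iff_norm, norm_smul, norm_inv, norm_norm, inv_mul_cancel₀ this.ne']
  -- Only directions range over a compact set. The lengths of the velocities are recovered as
  -- parameters of the normalized geodesics, whose convergence is `tendsto_parameter`.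
  obtain ⟨θ', hθ's, hθlim⟩ := (isCompact_sphere (0 : E3) 1).ultrafilter_le_nhds' (l.map θ) hθs
  have hθlim : Filter.Tendsto θ l (𝓝 θ') := hθlim
  have hθ'0 : θ' ≠ 0 := by rintro rfl; simp at hθ's
  set Y := M.nullLift x₀ z θ' with hY
  have hpn : M.PastNull x₀ (z, Y) := pastNull_nullLift hzm hθ'0
  have hYlim : Filter.Tendsto (fun k => M.nullLift x₀ (Z k) (θ k)) l (𝓝 Y) :=
    Filter.Tendsto.comp (g := fun q : (ℝ × E3) × E3 => M.nullLift x₀ q.1 q.2)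
      (f := fun k => (Z k, θ k)) (continuousAt_nullLift hzm θ').tendsto (hZlim.prodMk_nhds hθlim)
  -- the normalized geodesics
  have hjn : ∀ᶠ k in (l : Filter ι),
      M.Joins (fun r => γ k (‖w k‖⁻¹ * r)) ‖w k‖ (P k) (Q k) := by
    filter_upwards [hPs] with k hk
    have := (hj k).comp_mul (inv_pos.2 (norm_pos_iff.2 (hw0 k hk)))
    simpa using this
  have hstk : ∀ᶠ k in (l : Filter ι), coordState x₀ (γ k) 0 =
      (Z k, ‖w k‖ • M.nullLift x₀ (Z k) (θ k)) := by
    filter_upwards [hPs] with k hk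
    have hn := norm_pos_iff.2 (hw0 k hk)
    rw [(hj k).coordState_zero hk, ← nullLift_smul (M.I_subset_J (hj k).left_mem) hn.le]
    simp only [hθ, smul_smul, mul_inv_cancel₀ hn.ne', one_smul]
    rfl
  have hstn : ∀ᶠ k in (l : Filter ι), coordState x₀ (fun r => γ k (‖w k‖⁻¹ * r)) 0 =
      (Z k, M.nullLift x₀ (Z k) (θ k)) := by
    filter_upwards [hPs, hstk] with k hk hk'
    have hn := norm_pos_iff.2 (hw0 k hk)
    rw [coordState_comp_mul, mul_zero, hk']
    simp only [smul_smul, inv_mul_cancel₀ hn.ne', one_smul]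
  -- The reference geodesic in the limit direction, up to the parameter b where it meets time τ. For
  -- τ = p.1 a short geodesic with b = 0 suffices, and the limiting velocity bY is then zero.
  obtain ⟨b, γ', hb, hγ', hxγ', hst', hbτ, hbeq⟩ : ∃ b γ', 0 ≤ b ∧ M.OpenGeod γ' b ∧
      (γ' 0).2 ∈ (chart x₀).source ∧ coordState x₀ γ' 0 = (z, Y) ∧ (γ' b).1 = τ ∧
      (τ = p.1 → b = 0) := by
    rcases hτ.eq_or_lt with heq | hlt
    · obtain ⟨r, hr, ε, hε, hflow⟩ := exists_local_flowMap (M := M) (x₀ := x₀) (a₀ := (z, Y)) hzm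
      obtain ⟨Φ, Φ', hΦ⟩ := hflow (z, Y) (Metric.mem_ball_self hr) 0 ⟨le_rfl, hε⟩
      obtain ⟨γ', hγ', h1, h2, -⟩ := hΦ.link.self_of_nhds
      refine ⟨0, γ', le_rfl, hγ', h1, h2, ?_, fun _ => rfl⟩
      have h3 : (γ' 0).1 = z.1 := congrArg (fun a => a.1.1) h2
      rw [h3, heq]
    · have hv0 : chartSymmDeriv x₀ (chart x₀ x₀) θ' ≠ 0 := fun h0 =>
        hθ'0 (chartSymmDeriv_eq_zero hzm.2 h0)
      obtain ⟨y, γ₁, b, hj₁, hv₁⟩ := hex p hpI _ hv0 τ hτI hlt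
      obtain ⟨γ', hγ', h1, h2, h3, h4⟩ := hj₁.link (x₁ := y) hx₀s (mem_extChartAt_source _)
      refine ⟨b, γ', hj₁.1.pos.le, hγ', h1, ?_, ?_, fun h => absurd h hlt.ne⟩
      · rw [h2, hj₁.coordState_zero hx₀s, hv₁, ← hx₀, chartDeriv_chartSymmDeriv hx₀s]
      · have h5 := congrArg (fun a => a.1.1) h4
        simp only [coordState, coordCurve, hj₁.2.2] at h5
        exact h5
  have hρ : Filter.Tendsto (fun k => ‖w k‖) l (𝓝 b) := by
    refine tendsto_parameter hb hγ' hxγ' (by rw [hst']; exact hpn) hjn hPs ?_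
      (by rw [hbτ]; exact hQ)
    rw [hst']
    exact (hZlim.prodMk_nhds hYlim).congr' (by
      filter_upwards [hstn] with k hk using hk.symm)
  have hlim : Filter.Tendsto (fun k => coordState x₀ (γ k) 0) l (𝓝 (z, b • Y)) :=
    (hZlim.prodMk_nhds (hρ.smul hYlim)).congr' (by
      filter_upwards [hstk] with k hk using hk.symm)
  refine ⟨b • Y, hlim, fun h => by rw [hbeq h, zero_smul], fun hlt => ?_⟩
  have hb0 : 0 < b := by
    refine hb.lt_of_ne' ?_
    rintro rfl
    have h3 : (γ' 0).1 = z.1 := congrArg (fun a => a.1.1) hst'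
    rw [hbτ] at h3
    exact hlt.ne h3
  have hγ'0 : γ' 0 = p := by
    have h1 := chart_symm_coordCurve hxγ'
    have h2 : coordCurve x₀ γ' 0 = z := congrArg Prod.fst hst'
    rw [h2] at h1
    refine Prod.ext (congrArg (fun a => a.1.1) hst') ?_
    rw [← h1]
    exact (chart x₀).left_inv hx₀s
  have hjb : M.Joins γ' b p (τ, (γ' b).2) :=
    ⟨isPastNullGeodesic_of_geodAt hb0 hγ'.geodAt hxγ' (by rw [hst']; exact hpn)
      (by rw [hγ'0]; exact hpI) (by rw [hbτ]; exact hτI), hγ'0, Prod.ext hbτ rfl⟩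
  obtain ⟨γ₁, hj1, hst1⟩ : ∃ γ₁, M.Joins γ₁ 1 p (τ, (γ' b).2) ∧
      coordState x₀ γ₁ 0 = (z, b • Y) := by
    refine ⟨_, hjb.normalize, ?_⟩
    rw [coordState_comp_mul, mul_zero, hst']
  refine ⟨_, _, hj1, hst1, ?_⟩
  set y := (γ' b).2 with hy
  obtain ⟨Φ, Φ', hΦ, hΦ0⟩ := exists_flowMap (x₀ := x₀) (x₁ := y) zero_le_one hj1.1.geodAt
    (by rw [hj1.2.1]; exact hx₀s) (by rw [hj1.2.2]; exact mem_extChartAt_source _)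
  rw [hst1] at hΦ hΦ0
  have h1 : Filter.Tendsto (fun k => (Φ (coordState x₀ (γ k) 0)).1.2) l (𝓝 (chart y y)) := by
    have h2 : ContinuousAt (fun a => (Φ a).1.2) (z, b • Y) := hΦ.strict.continuousAt.fst.snd
    have h3 := h2.tendsto.comp hlim
    rw [hΦ0] at h3
    simp only [coordState, coordCurve, hj1.2.2] at h3
    exact h3
  have h4 : Filter.Tendsto (chart y).symm (𝓝 (chart y y)) (𝓝 y) := by
    have := (continuousAt_extChartAt_symm (I := 𝓘(ℝ, E3)) y).tendsto
    rwa [extChartAt_to_inv] at this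
  refine (h4.comp h1).congr' ?_
  filter_upwards [hlim.eventually hΦ.link, hPs] with k hk hk'
  obtain ⟨h5, h6⟩ := hk.end_eq (hj k) hk' rfl
  simp only [Function.comp, h6]
  exact (chart y).left_inv h5

lemma Crossing.intersectionRadius_le {p q : ℝ × S} {γ₁ γ₂ : ℝ → ℝ × S}
    (h : M.Crossing p q γ₁ γ₂) : M.intersectionRadius p ≤ ((p.1 - q.1 : ℝ) : EReal) := by
  have hpJ := M.I_subset_J h.left.left_mem
  have h0 : (0 : ℝ) ∈ Set.Icc 0 1 := ⟨le_rfl, zero_le_one⟩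
  obtain ⟨κ₁, hκ₁, hu₁⟩ := exists_unit_smul hpJ (h.left.1.leafVelocity_ne_zero h0)
  obtain ⟨κ₂, hκ₂, hu₂⟩ := exists_unit_smul hpJ (h.right.1.leafVelocity_ne_zero h0)
  have h₁ := h.left.comp_mul (inv_pos.2 hκ₁)
  have h₂ := h.right.comp_mul (inv_pos.2 hκ₂)
  have hv₁ := h.left.leafVelocity_comp_mul κ₁⁻¹
  have hv₂ := h.right.leafVelocity_comp_mul κ₂⁻¹
  refine sInf_le ⟨q.1, h.left.right_mem, h.left.time_lt, rfl, _, hu₁, _, hu₂, fun heq => h.ne ?_,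
    q.2, ⟨_, _, h₁, hv₁⟩, ⟨_, _, h₂, hv₂⟩⟩
  -- If the unit vectors agreed, the two geodesics would reach q at the same parameter, so both
  -- normalizing factors, and hence both original velocities, would agree.
  have hb := (h₁.unique h₂ (by rw [hv₁, hv₂, heq]) rfl).1
  rw [one_div, one_div, inv_inv, inv_inv] at hb
  rw [hb] at heq
  exact smul_right_injective _ (inv_ne_zero hκ₂.ne') heq

/-- Within the radius of conjugacy, the end point of a past null geodesic from a point without
earlier crossings depends nonsingularly on the velocity. -/
lemma Joins.flow_injective {p : ℝ × S} {τ : ℝ} {y : S} {γ : ℝ → ℝ × S}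
    (hj : M.Joins γ 1 p (τ, y)) {δs : ℝ}
    (hconj : min (M.intersectionRadius p) (δs : EReal) < M.conjugacyRadius p)
    (hδ : p.1 - τ < δs) (hmin : ∀ q' γ' lam', M.Crossing p q' γ' lam' → q'.1 ≤ τ) {x₀ x₁ : S}
    (hx : p.2 ∈ (chart x₀).source) (hx₁ : y ∈ (chart x₁).source)
    {Φ : (ℝ × E3) × (ℝ × E3) → (ℝ × E3) × (ℝ × E3)}
    {Φ' : (ℝ × E3) × (ℝ × E3) →L[ℝ] (ℝ × E3) × (ℝ × E3)}
    (hΦ : M.IsFlowMap x₀ (coordState x₀ γ 0) x₁ 1 Φ Φ') {W : ℝ × E3}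
    (hW : (Φ' (0, W)).1 = 0) : W = 0 := by
  obtain ⟨κ, hκ, hu⟩ := exists_unit_smul (M.I_subset_J hj.left_mem)
    (hj.1.leafVelocity_ne_zero ⟨le_rfl, zero_le_one⟩)
  have hrad : ((p.1 - τ : ℝ) : EReal) < M.conjugacyRadius p := by
    refine lt_of_le_of_lt (le_min ?_ ?_) hconj
    -- Two unit vectors whose geodesics meet on a leaf give a crossing from p; by `hmin` it arrives
    -- no later than τ, so p.1 - τ is a lower bound for the values defining ℓ_*.
    · refine le_sInf ?_
      rintro σ ⟨t, htI, htp, rfl, ξ₁, hξ₁, ξ₂, hξ₂, hne, y, ⟨γ', b', hj', rfl⟩,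
        ⟨γ'', b'', hj'', rfl⟩⟩
      rw [EReal.coe_le_coe_iff]
      have := hmin (t, y) _ _ (crossing_of_unit hj' hj'' hξ₁ hξ₂ hne)
      dsimp only at this
      linarith
    · exact EReal.coe_le_coe_iff.2 hδ.le
  obtain ⟨σ, hσ, hσlt⟩ := lt_sSup_iff.1 hrad
  have hR : M.Reaches p (κ⁻¹ • leafVelocity γ 0) τ y :=
    Reaches.smul ⟨γ, 1, hj, rfl⟩ (inv_pos.2 hκ)
  have hns := hσ τ hj.right_mem hj.time_lt hσlt _ hu ⟨y, hR⟩
  exact hΦ.injective_of_nonsingularAt hj hx hx₁ hκ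
    (by rw [smul_smul, mul_inv_cancel₀ hκ.ne', one_smul]) hns hW

/-- There is a crossing of minimal time extent. -/
theorem exists_minimal_crossing (hex : ∀ p : ℝ × S, p.1 ∈ M.I → ∀ v : E3, v ≠ 0 → ∀ t ∈ M.I,
      t < p.1 → ∃ y, M.Reaches p v t y)
    {D : Set (ℝ × S)} {δ₀ : ℝ} (hD : IsCompact D) (hDM : D ⊆ M.region)
    (hA4 : ∀ p ∈ M.region, p ∉ D → (δ₀ : EReal) < M.intersectionRadius p)
    {δs : ℝ} (hδsδ₀ : δs ≤ δ₀)
    (hconj : ∀ p ∈ M.region, min (M.intersectionRadius p) (δs : EReal) < M.conjugacyRadius p)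
    {p₀ q₀ : ℝ × S} {γ₀ lam₀ : ℝ → ℝ × S} (h₀ : M.Crossing p₀ q₀ γ₀ lam₀)
    (htime : p₀.1 - q₀.1 < δs) :
    ∃ p q γ lam, M.Crossing p q γ lam ∧ q₀.1 ≤ q.1 ∧ p.1 ≤ p₀.1 ∧
      ∀ p' q' γ' lam', M.Crossing p' q' γ' lam' → q₀.1 ≤ q'.1 → p'.1 ≤ p₀.1 →
        p.1 - q.1 ≤ p'.1 - q'.1 := by
  set V : Set ℝ := {m | ∃ p q γ lam, M.Crossing p q γ lam ∧ q₀.1 ≤ q.1 ∧ p.1 ≤ p₀.1 ∧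
    m = p.1 - q.1} with hV
  have hV0 : p₀.1 - q₀.1 ∈ V := ⟨p₀, q₀, γ₀, lam₀, h₀, le_rfl, le_rfl, rfl⟩
  have hbdd : BddBelow V := by
    refine ⟨0, ?_⟩
    rintro m ⟨p, q, γ, lam, h, -, -, rfl⟩
    exact (sub_pos.2 h.left.time_lt).le
  set m₀ := sInf V with hm₀
  have hm₀δ : m₀ < δs := (csInf_le hbdd hV0).trans_lt htime
  have hm₀0 : 0 ≤ m₀ := le_csInf ⟨_, hV0⟩ (by
    rintro m ⟨p, q, γ, lam, h, -, -, rfl⟩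
    exact (sub_pos.2 h.left.time_lt).le)
  obtain ⟨u, -, hulim, huV⟩ := exists_seq_tendsto_sInf ⟨_, hV0⟩ hbdd
  choose P Q γ lam hcr hq hp hval using huV
  set l : Ultrafilter ℕ := Filter.hyperfilter ℕ with hl
  have hle : (l : Filter ℕ) ≤ Filter.atTop := Nat.hyperfilter_le_atTop
  have hulim' : Filter.Tendsto u l (𝓝 m₀) := hulim.mono_left hle
  -- An upper vertex outside D has ℓ_* > δ₀ ≥ δ_*, whereas a crossing of smaller extent bounds ℓ_*
  -- from above.
  have hPD : ∀ᶠ k in (l : Filter ℕ), P k ∈ D := by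
    filter_upwards [hulim'.eventually (gt_mem_nhds hm₀δ)] with k hk
    by_contra hnot
    have h1 := (hA4 (P k) (hcr k).left.left_mem hnot).trans_le (hcr k).intersectionRadius_le
    rw [EReal.coe_lt_coe_iff, ← hval k] at h1
    linarith
  obtain ⟨p, hpD, hPlim⟩ := hD.ultrafilter_le_nhds' (l.map P) hPD
  have hPlim : Filter.Tendsto P l (𝓝 p) := hPlim
  have hpI : p.1 ∈ M.I := hDM hpD
  have hP1 : Filter.Tendsto (fun k => (P k).1) l (𝓝 p.1) := (continuous_fst.tendsto p).comp hPlim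
  set τ := p.1 - m₀ with hτ
  have hQ1 : Filter.Tendsto (fun k => (Q k).1) l (𝓝 τ) := by
    refine (hP1.sub hulim').congr fun k => ?_
    rw [hval k]; ring
  have hpp₀ : p.1 ≤ p₀.1 := le_of_tendsto hP1 (Filter.Eventually.of_forall hp)
  have hq₀τ : q₀.1 ≤ τ := ge_of_tendsto hQ1 (Filter.Eventually.of_forall hq)
  have hτp : τ ≤ p.1 := by rw [hτ]; linarith
  have hτI : τ ∈ M.I := M.ordConnected_I.out h₀.left.right_mem hpI ⟨hq₀τ, hτp⟩
  have hPs : ∀ᶠ k in (l : Filter ℕ), (P k).2 ∈ (chart p.2).source :=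
    (continuous_snd.tendsto p |>.comp hPlim).eventually (extChartAt_source_mem_nhds p.2)
  obtain ⟨X₁, hX₁, hX₁z, hX₁j⟩ :=
    Joins.exists_limit hex (fun k => (hcr k).left) hpI hPlim hτI hτp hQ1
  obtain ⟨X₂, hX₂, hX₂z, hX₂j⟩ :=
    Joins.exists_limit hex (fun k => (hcr k).right) hpI hPlim hτI hτp hQ1
  set z : ℝ × E3 := (p.1, chart p.2 p.2) with hz
  -- the limits differ if the flow is nonsingular at the limit
  have hexcl : ∀ x₁ Φ Φ', X₁ = X₂ → M.IsFlowMap p.2 (z, X₁) x₁ 1 Φ Φ' →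
      (∀ W, (Φ' (0, W)).1 = 0 → W = 0) → False := by
    intro x₁ Φ Φ' heq hΦ hinj
    -- Near the common limit the vertex and the end point at parameter 1 determine the velocity; the
    -- two geodesics of a crossing share both but have different velocities.
    have hloc := hΦ.strict.fst.eventually_eq_of_eq (fun W hW => hinj W hW)
    have hpair := hX₁.prodMk_nhds (heq ▸ hX₂)
    have hfalse : ∀ᶠ k in (l : Filter ℕ), False := by
      filter_upwards [hpair.eventually hloc, hX₁.eventually hΦ.link,
        (heq ▸ hX₂ : Filter.Tendsto _ _ (𝓝 (z, X₁))).eventually hΦ.link, hPs] with k h1 h2 h3 h4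
      have e1 := (h2.end_eq (hcr k).left h4 rfl).2
      have e2 := (h3.end_eq (hcr k).right h4 rfl).2
      have s1 := (hcr k).left.coordState_zero h4
      have s2 := (hcr k).right.coordState_zero h4
      have h5 := h1 (by rw [s1, s2]) (e1.trans e2.symm)
      rw [s1, s2] at h5
      have h6 : chartDeriv p.2 (P k).2 (leafVelocity (γ k) 0) =
          chartDeriv p.2 (P k).2 (leafVelocity (lam k) 0) := congrArg (fun a => a.2.2) h5
      apply (hcr k).ne
      rw [← chartSymmDeriv_chartDeriv h4 (leafVelocity (γ k) 0), h6, chartSymmDeriv_chartDeriv h4]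
    exact hfalse.exists.elim fun _ h => h
  have hps : p.2 ∈ (chart p.2).source := mem_extChartAt_source _
  rcases hτp.eq_or_lt with hτeq | hτlt
  -- Extent zero: both limiting velocities vanish, and at zero velocity the end point map has the
  -- identity as its derivative in the velocity.
  · exfalso
    have h1 := hX₁z hτeq
    obtain ⟨Φ, Φ', hΦ, -⟩ := exists_flowMap (M := M) (x₀ := p.2) (x₁ := p.2)
      (γ := fun _ => p) zero_le_one (fun s _ => geodAt_const (M.I_subset_J hpI) s) hps hps
    rw [coordState_const] at hΦ
    refine hexcl p.2 Φ Φ' (h1.trans (hX₂z hτeq).symm) (by rw [h1]; exact hΦ) fun W hW => ?_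
    rwa [hΦ.deriv_zero] at hW
  · obtain ⟨γ₁, y₁, hj₁, hs₁, hy₁⟩ := hX₁j hτlt
    obtain ⟨γ₂, y₂, hj₂, hs₂, hy₂⟩ := hX₂j hτlt
    have hyy : y₁ = y₂ := tendsto_nhds_unique hy₁ hy₂
    subst hyy
    have hmin : ∀ p' q' γ' lam', M.Crossing p' q' γ' lam' → q₀.1 ≤ q'.1 → p'.1 ≤ p₀.1 →
        m₀ ≤ p'.1 - q'.1 := fun p' q' γ' lam' h1 h2 h3 =>
      csInf_le hbdd ⟨p', q', γ', lam', h1, h2, h3, rfl⟩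
    have hm₀eq : p.1 - τ = m₀ := by rw [hτ]; ring
    refine ⟨p, (τ, y₁), γ₁, γ₂, ⟨hj₁, hj₂, fun hveq => ?_⟩, hq₀τ, hpp₀, by
      simpa only [hm₀eq] using hmin⟩
    have hXX : X₁ = X₂ := by
      rw [hj₁.coordState_zero hps, hveq, ← hj₂.coordState_zero hps, hs₂] at hs₁
      exact (congrArg Prod.snd hs₁).symm
    obtain ⟨Φ, Φ', hΦ, -⟩ := exists_flowMap (x₀ := p.2) (x₁ := y₁) zero_le_one hj₁.1.geodAt
      (by rw [hj₁.2.1]; exact hps) (by rw [hj₁.2.2]; exact mem_extChartAt_source _)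
    refine hexcl y₁ Φ Φ' hXX (by rw [← hs₁]; exact hΦ) fun W hW => ?_
    -- The least extent is already used for its infimum property: a crossing from p that arrived
    -- after τ would have extent smaller than m₀.
    refine hj₁.flow_injective (hconj p hpI) (by rw [hm₀eq]; exact hm₀δ)
      (fun q' γ' lam' hc => ?_) hps (mem_extChartAt_source _) hΦ hW
    by_contra hlt
    have hlt : τ < q'.1 := not_le.1 hlt
    have := hmin p q' γ' lam' hc (hq₀τ.trans hlt.le) hpp₀
    linarith

end Manifold

end FoliatedSpacetime
end

/-! ### Lagrange multipliers for the latest arrival of a crossing. -/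

noncomputable section

namespace FoliatedSpacetime

set_option maxSynthPendingDepth 3

variable {S : Type*} [TopologicalSpace S] [ChartedSpace E3 S] {M : FoliatedSpacetime S}
variable [IsManifold 𝓘(ℝ, E3) ∞ S] [T2Space S]

/-- Nearby data of the minimization problem: the position on the leaf and the two velocities. -/
lemma hasStrictFDerivAt_leafState (t : ℝ) (L : (ℝ × E3) × (ℝ × E3) →L[ℝ] ℝ × E3)
    (ζ : E3 × (ℝ × E3) × (ℝ × E3)) :
    HasStrictFDerivAt
      (fun ζ : E3 × (ℝ × E3) × (ℝ × E3) => (((t, ζ.1), L ζ.2) : (ℝ × E3) × (ℝ × E3)))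
      (((0 : E3 × (ℝ × E3) × (ℝ × E3) →L[ℝ] ℝ).prod (ContinuousLinearMap.fst ℝ E3 _)).prod
        (L.comp (ContinuousLinearMap.snd ℝ E3 _))) ζ :=
  ((hasStrictFDerivAt_const t ζ).prodMk hasStrictFDerivAt_fst).prodMk
    (L.hasStrictFDerivAt.comp ζ hasStrictFDerivAt_snd)

/-- The two geodesics of a crossing arriving at the latest possible time satisfy a linear relation
at both ends. -/
lemma Crossing.exists_multipliers {p q : ℝ × S} {γ₁ γ₂ : ℝ → ℝ × S} (h : M.Crossing p q γ₁ γ₂)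
    (hmax : ∀ x q' γ₁' γ₂', M.Crossing (p.1, x) q' γ₁' γ₂' → q'.1 ≤ q.1)
    (hinj : ∀ γ, M.Joins γ 1 p q → ∀ Φ Φ', M.IsFlowMap p.2 (coordState p.2 γ 0) q.2 1 Φ Φ' →
      ∀ W, (Φ' (0, W)).1 = 0 → W = 0) :
    ∃ c₁ c₂ : ℝ, (c₁ ≠ 0 ∨ c₂ ≠ 0) ∧ c₁ • leafVelocity γ₁ 0 + c₂ • leafVelocity γ₂ 0 = 0 ∧
      c₁ • leafVelocity γ₁ 1 + c₂ • leafVelocity γ₂ 1 = 0 := by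
  have hps : p.2 ∈ (chart p.2).source := mem_extChartAt_source _
  have hqs : q.2 ∈ (chart q.2).source := mem_extChartAt_source _
  have h0 : (0 : ℝ) ∈ Set.Icc 0 1 := ⟨le_rfl, zero_le_one⟩
  have h1 : (1 : ℝ) ∈ Set.Icc 0 1 := ⟨zero_le_one, le_rfl⟩
  obtain ⟨x₀, hx₀⟩ : ∃ x₀, x₀ = p.2 := ⟨_, rfl⟩
  obtain ⟨x₁, hx₁⟩ : ∃ x₁, x₁ = q.2 := ⟨_, rfl⟩
  rw [← hx₀, ← hx₁] at hinj
  have hps' : p.2 ∈ (chart x₀).source := by rw [hx₀]; exact hps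
  have hqs' : q.2 ∈ (chart x₁).source := by rw [hx₁]; exact hqs
  -- data of one geodesic
  have hdata : ∀ γ, M.Joins γ 1 p q → ∃ (X X' : ℝ × E3) (Φ : (ℝ × E3) × (ℝ × E3) →
      (ℝ × E3) × (ℝ × E3)) (Φ' : (ℝ × E3) × (ℝ × E3) →L[ℝ] (ℝ × E3) × (ℝ × E3)),
      M.PastNull x₀ ((p.1, chart x₀ p.2), X) ∧
      M.IsFlowMap x₀ ((p.1, chart x₀ p.2), X) x₁ 1 Φ Φ' ∧
      Φ ((p.1, chart x₀ p.2), X) = ((q.1, chart x₁ q.2), X') ∧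
      (∀ W, ∃ V, (Φ' (0, V)).1 = W) ∧ leafVelocity γ 0 = chartSymmDeriv x₀ (chart x₀ p.2) X.2 ∧
      leafVelocity γ 1 = chartSymmDeriv x₁ (chart x₁ q.2) X'.2 := by
    intro γ hj
    have hx : (γ 0).2 ∈ (chart x₀).source := by rw [hj.2.1]; exact hps'
    have hx' : (γ 1).2 ∈ (chart x₁).source := by rw [hj.2.2]; exact hqs'
    have e0 : coordState x₀ γ 0 = ((p.1, chart x₀ p.2), (coordState x₀ γ 0).2) := by
      simp only [coordState, coordCurve, hj.2.1]
    have e1 : coordState x₁ γ 1 = ((q.1, chart x₁ q.2), (coordState x₁ γ 1).2) := by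
      simp only [coordState, coordCurve, hj.2.2]
    obtain ⟨Φ, Φ', hΦ, hΦ0⟩ := exists_flowMap (x₁ := x₁) zero_le_one hj.1.geodAt hx hx'
    refine ⟨(coordState x₀ γ 0).2, (coordState x₁ γ 1).2, Φ, Φ', ?_, ?_, ?_, ?_, ?_, ?_⟩
    · rw [← e0]; exact hj.1.pastNull h0 hx
    · rw [← e0]; exact hΦ
    · rw [← e0, hΦ0, e1]
    · have hB : Function.Injective (((ContinuousLinearMap.fst ℝ (ℝ × E3) (ℝ × E3)).comp
          (Φ'.comp (ContinuousLinearMap.inr ℝ (ℝ × E3) (ℝ × E3)))).toLinearMap) :=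
        (injective_iff_map_eq_zero _).2 fun W hW => hinj γ hj Φ Φ' hΦ W hW
      exact LinearMap.surjective_of_injective hB
    · have := (hj.1.geodAt 0 h0).leafVelocity_eq hx
      rw [e0] at this
      exact this
    · have := (hj.1.geodAt 1 h1).leafVelocity_eq hx'
      rw [e1] at this
      exact this
  obtain ⟨X₁, X₁', Φ₁, Φ₁', hpn₁, hΦ₁, hend₁, hsurj₁, hv₁, hk₁⟩ := hdata γ₁ h.left
  obtain ⟨X₂, X₂', Φ₂, Φ₂', hpn₂, hΦ₂, hend₂, hsurj₂, hv₂, hk₂⟩ := hdata γ₂ h.right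
  clear hdata
  set z : ℝ × E3 := (p.1, chart x₀ p.2) with hz
  -- The unknowns are the position of the vertex in the leaf of time p.1 and two unrestricted
  -- velocities; nullness becomes a constraint.
  set e₁ : E3 × (ℝ × E3) × (ℝ × E3) → (ℝ × E3) × (ℝ × E3) := fun ζ => ((p.1, ζ.1), ζ.2.1) with he₁
  set e₂ : E3 × (ℝ × E3) × (ℝ × E3) → (ℝ × E3) × (ℝ × E3) := fun ζ => ((p.1, ζ.1), ζ.2.2) with he₂
  set ζ₀ : E3 × (ℝ × E3) × (ℝ × E3) := (chart x₀ p.2, X₁, X₂) with hζ₀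
  have he₁0 : e₁ ζ₀ = (z, X₁) := rfl
  have he₂0 : e₂ ζ₀ = (z, X₂) := rfl
  have de₁ := hasStrictFDerivAt_leafState p.1 (ContinuousLinearMap.fst ℝ (ℝ × E3) (ℝ × E3)) ζ₀
  have de₂ := hasStrictFDerivAt_leafState p.1 (ContinuousLinearMap.snd ℝ (ℝ × E3) (ℝ × E3)) ζ₀
  have ce₁ : ContinuousAt e₁ ζ₀ := de₁.continuousAt
  have ce₂ : ContinuousAt e₂ ζ₀ := de₂.continuousAt
  have dΦ₁ := HasStrictFDerivAt.comp (f := e₁) (g := Φ₁) ζ₀ hΦ₁.strict de₁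
  have dΦ₂ := HasStrictFDerivAt.comp (f := e₂) (g := Φ₂) ζ₀ hΦ₂.strict de₂
  have dk₁ := HasStrictFDerivAt.comp (f := e₁) (g := M.kinetic x₀) ζ₀
    (hasStrictFDerivAt_kinetic hpn₁.mem) de₁
  have dk₂ := HasStrictFDerivAt.comp (f := e₂) (g := M.kinetic x₀) ζ₀
    (hasStrictFDerivAt_kinetic hpn₂.mem) de₂
  have df := dk₁.prodMk (dk₂.prodMk (dΦ₁.fst.sub dΦ₂.fst))
  have dφ := dΦ₁.fst.fst
  -- Constraints: both velocities null and the same end point. Nearby solutions are crossings, since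
  -- past direction and inequality of the velocities are open conditions, so `hmax` bounds their
  -- arrival time.
  have hmaxOn : IsLocalMaxOn (fun ζ => (Φ₁ (e₁ ζ)).1.1)
      {ζ | (M.kinetic x₀ (e₁ ζ), M.kinetic x₀ (e₂ ζ), (Φ₁ (e₁ ζ)).1 - (Φ₂ (e₂ ζ)).1) =
        (M.kinetic x₀ (e₁ ζ₀), M.kinetic x₀ (e₂ ζ₀), (Φ₁ (e₁ ζ₀)).1 - (Φ₂ (e₂ ζ₀)).1)} ζ₀ := by
    have hne : X₁.2 ≠ X₂.2 := fun heq => h.ne (by rw [hv₁, hv₂, heq])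
    have ev : ∀ᶠ ζ in 𝓝 ζ₀, M.Link x₀ (e₁ ζ) x₁ (Φ₁ (e₁ ζ)) 1 ∧
        M.Link x₀ (e₂ ζ) x₁ (Φ₂ (e₂ ζ)) 1 ∧ (Φ₁ (e₁ ζ)).1.1 < p.1 ∧ (e₁ ζ).2.1 < 0 ∧
        (e₂ ζ).2.1 < 0 ∧ (e₁ ζ).2.2 ≠ (e₂ ζ).2.2 := by
      have t1 : ContinuousAt (fun ζ => (Φ₁ (e₁ ζ)).1.1) ζ₀ := dφ.continuousAt
      filter_upwards [ce₁.eventually hΦ₁.link, ce₂.eventually hΦ₂.link,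
        t1.eventually_lt continuousAt_const (show (Φ₁ (e₁ ζ₀)).1.1 < p.1 by
          rw [he₁0, hend₁]; exact h.left.time_lt),
        ce₁.snd.fst.eventually_lt continuousAt_const hpn₁.past,
        ce₂.snd.fst.eventually_lt continuousAt_const hpn₂.past,
        (ce₁.snd.snd.sub ce₂.snd.snd).tendsto.eventually_ne (sub_ne_zero.2 hne)] with ζ a1 a2 a3 a4 a5 a6
      exact ⟨a1, a2, a3, a4, a5, sub_ne_zero.1 a6⟩
    filter_upwards [nhdsWithin_le_nhds ev, self_mem_nhdsWithin]
      with ζ ⟨a1, a2, a3, a4, a5, a6⟩ hζ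
    rw [he₁0, he₂0, hpn₁.null, hpn₂.null, hend₁, hend₂, sub_self] at hζ
    have hζ₁ : M.kinetic x₀ (e₁ ζ) = 0 := congrArg Prod.fst hζ
    have hζ₂ : M.kinetic x₀ (e₂ ζ) = 0 := congrArg (fun w => w.2.1) hζ
    have hζ₃ : (Φ₁ (e₁ ζ)).1 = (Φ₂ (e₂ ζ)).1 := sub_eq_zero.1 (congrArg (fun w => w.2.2) hζ)
    change (Φ₁ (e₁ ζ)).1.1 ≤ (Φ₁ (e₁ ζ₀)).1.1
    rw [he₁0, hend₁]
    by_contra hlt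
    have hlt : q.1 < (Φ₁ (e₁ ζ)).1.1 := not_le.1 hlt
    have htI : (Φ₁ (e₁ ζ)).1.1 ∈ M.I :=
      M.ordConnected_I.out h.left.right_mem h.left.left_mem ⟨hlt.le, a3.le⟩
    have hm₁ := a1.mem_coordDomain_left zero_le_one
    obtain ⟨γ₁', hj₁', -, -, hw₁, -⟩ := a1.joins one_pos ⟨hm₁, hζ₁, a4⟩ h.left.left_mem htI
    obtain ⟨γ₂', hj₂', -, -, hw₂, -⟩ := a2.joins one_pos
      ⟨a2.mem_coordDomain_left zero_le_one, hζ₂, a5⟩ h.left.left_mem (by rw [← hζ₃]; exact htI)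
    rw [← hζ₃] at hj₂'
    refine hlt.not_ge (hmax _ _ γ₁' γ₂' ⟨hj₁', hj₂', fun heq => a6 ?_⟩)
    rw [hw₁, hw₂] at heq
    refine sub_eq_zero.1 (chartSymmDeriv_eq_zero hm₁.2 ?_)
    rw [map_sub, heq]
    exact sub_self _
  -- This form of the multiplier rule does not require the constraints to be independent; only the
  -- pair (Λ, μ) is known to be nonzero.
  obtain ⟨Λ, μ, hne, hΛ⟩ :=
    IsLocalExtrOn.exists_linear_map_of_hasStrictFDerivAt (Or.inr hmaxOn) df dφ
  -- the multipliers
  set c₁ := Λ (1, 0, 0) with hc₁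
  set c₂ := Λ (0, 1, 0) with hc₂
  obtain ⟨lm, hlm⟩ : ∃ lm : (ℝ × E3) →ₗ[ℝ] ℝ, ∀ w, lm w = Λ (0, 0, w) :=
    ⟨Λ ∘ₗ (LinearMap.inr ℝ ℝ (ℝ × (ℝ × E3))) ∘ₗ (LinearMap.inr ℝ ℝ (ℝ × E3)), fun _ => rfl⟩
  have hΛd : ∀ α β w, Λ (α, β, w) = α * c₁ + β * c₂ + lm w := by
    intro α β w
    have : ((α, β, w) : ℝ × ℝ × (ℝ × E3)) = α • (1, 0, 0) + β • (0, 1, 0) + (0, 0, w) := by simp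
    rw [this, map_add, map_add, map_smul, map_smul, hlm]
    rfl
  have hid : ∀ (δ : E3) (V₁ V₂ : ℝ × E3),
      fderiv ℝ (M.kinetic x₀) (z, X₁) ((0, δ), V₁) * c₁ +
      fderiv ℝ (M.kinetic x₀) (z, X₂) ((0, δ), V₂) * c₂ +
      (lm (Φ₁' ((0, δ), V₁)).1 - lm (Φ₂' ((0, δ), V₂)).1) +
        μ * (Φ₁' ((0, δ), V₁)).1.1 = 0 := by
    intro δ V₁ V₂
    have := hΛ (δ, V₁, V₂)
    rw [← map_sub, ← hΛd]
    exact this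
  have hfv₁ := hΦ₁.firstVariation
  have hfv₂ := hΦ₂.firstVariation
  rw [hend₁] at hfv₁
  rw [hend₂] at hfv₂
  simp only [one_mul] at hfv₁ hfv₂
  set z' : ℝ × E3 := (q.1, chart x₁ q.2) with hz'
  have hcov₁ : ∀ W, lm W + μ * W.1 = -c₁ * M.chartMetric x₁ z' X₁' W := by
    intro W
    obtain ⟨V, rfl⟩ := hsurj₁ W
    have e1 := hid 0 V 0
    have e2 := hfv₁ (0, V)
    have e3 : (((0, 0), V) : (ℝ × E3) × (ℝ × E3)) = (0, V) := rfl
    have e4 : (((0, 0), 0) : (ℝ × E3) × (ℝ × E3)) = 0 := rfl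
    rw [e3, e4, map_zero, map_zero] at e1
    rw [e2]
    simp only [map_zero, Prod.fst_zero] at e1 ⊢
    linarith
  have hcov₂ : ∀ W, lm W = c₂ * M.chartMetric x₁ z' X₂' W := by
    intro W
    obtain ⟨V, rfl⟩ := hsurj₂ W
    have e1 := hid 0 0 V
    have e2 := hfv₂ (0, V)
    have e3 : (((0, 0), V) : (ℝ × E3) × (ℝ × E3)) = (0, V) := rfl
    have e4 : (((0, 0), 0) : (ℝ × E3) × (ℝ × E3)) = 0 := rfl
    rw [e3, e4, map_zero, map_zero] at e1
    rw [e2]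
    simp only [map_zero, Prod.fst_zero] at e1 ⊢
    linarith
  refine ⟨c₁, c₂, ?_, ?_, ?_⟩
  -- With c₁ = c₂ = 0 the covector `lm` vanishes, and testing against ∂_t gives μ = 0; then all
  -- multipliers vanish.
  · by_contra hcon
    push Not at hcon
    obtain ⟨hz₁, hz₂⟩ := hcon
    have hlm0 : ∀ W, lm W = 0 := fun W => by rw [hcov₂, hz₂, zero_mul]
    have hμ : μ = 0 := by
      have := hcov₁ (1, 0)
      rw [hlm0, hz₁] at this
      simpa using this
    apply hne
    refine Prod.ext (LinearMap.ext ?_) hμ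
    rintro ⟨α, β, w⟩
    rw [hΛd, hz₁, hz₂, hlm0]
    simp
  -- The vertex is moved in the direction of the combination V itself. The energy terms cancel
  -- between the multiplier identity and the first variation formulas, leaving g(V, V) = 0.
  · have hJ : p.1 ∈ M.J := M.I_subset_J h.left.left_mem
    obtain ⟨V, hV⟩ : ∃ V, V = c₁ • leafVelocity γ₁ 0 + c₂ • leafVelocity γ₂ 0 := ⟨_, rfl⟩
    rw [← hV]
    by_contra hV0
    have hpos := M.leafMetric_pos hJ ((chart x₀).symm z.2) hV0
    set δ := chartDeriv x₀ ((chart x₀).symm z.2) V with hδ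
    have hδV : chartSymmDeriv x₀ z.2 δ = V := chartSymmDeriv_chartDeriv' hpn₁.mem.2 V
    have e1 := hid δ 0 0
    have e2 := hfv₁ ((0, δ), 0)
    have e3 := hfv₂ ((0, δ), 0)
    have e4 := hcov₁ (Φ₁' ((0, δ), 0)).1
    have e5 := hcov₂ (Φ₂' ((0, δ), 0)).1
    rw [e2] at e4
    rw [e3] at e5
    rw [chartMetric_apply, hδV] at e4 e5
    simp only [mul_zero, zero_add] at e4 e5
    have e6 : M.leafMetric p.1 ((chart x₀).symm z.2) V V = 0 := by
      nth_rw 1 [hV]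
      rw [hv₁, hv₂, map_add, map_smul, map_smul, add_apply, smul_apply, smul_apply, smul_eq_mul,
        smul_eq_mul]
      change c₁ * M.leafMetric z.1 ((chart x₀).symm z.2) (chartSymmDeriv x₀ z.2 X₁.2) V +
        c₂ * M.leafMetric z.1 ((chart x₀).symm z.2) (chartSymmDeriv x₀ z.2 X₂.2) V = 0
      linarith
    exact hpos.ne' e6
  -- The end covectors are compared on vectors tangent to the leaf, whose time component is zero, so
  -- that μ drops out.
  · have hJ : q.1 ∈ M.J := M.I_subset_J h.left.right_mem
    have hqt : z'.2 ∈ (chart x₁).target := (chart x₁).map_source hqs'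
    obtain ⟨V, hV⟩ : ∃ V, V = c₁ • leafVelocity γ₁ 1 + c₂ • leafVelocity γ₂ 1 := ⟨_, rfl⟩
    rw [← hV]
    by_contra hV0
    have hpos := M.leafMetric_pos hJ ((chart x₁).symm z'.2) hV0
    set δ := chartDeriv x₁ ((chart x₁).symm z'.2) V with hδ
    have hδV : chartSymmDeriv x₁ z'.2 δ = V := chartSymmDeriv_chartDeriv' hqt V
    have e4 := hcov₁ (0, δ)
    have e5 := hcov₂ (0, δ)
    rw [chartMetric_apply, hδV] at e4 e5
    simp only [mul_zero, zero_add, add_zero] at e4 e5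
    have e6 : M.leafMetric q.1 ((chart x₁).symm z'.2) V V = 0 := by
      nth_rw 1 [hV]
      rw [hk₁, hk₂, map_add, map_smul, map_smul, add_apply, smul_apply, smul_apply, smul_eq_mul,
        smul_eq_mul]
      change c₁ * M.leafMetric z'.1 ((chart x₁).symm z'.2) (chartSymmDeriv x₁ z'.2 X₁'.2) V +
        c₂ * M.leafMetric z'.1 ((chart x₁).symm z'.2) (chartSymmDeriv x₁ z'.2 X₂'.2) V = 0
      linarith
    exact hpos.ne' e6

/-- The two geodesics of a crossing have different directions. -/
lemma Crossing.not_parallel {p q : ℝ × S} {γ₁ γ₂ : ℝ → ℝ × S} (h : M.Crossing p q γ₁ γ₂) {κ : ℝ}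
    (hκ : 0 < κ) : leafVelocity γ₂ 0 ≠ κ • leafVelocity γ₁ 0 := by
  intro heq
  have h1 := (h.left.comp_mul hκ).unique h.right
    ((h.left.leafVelocity_comp_mul κ).trans heq.symm) rfl
  have h2 : κ = 1 := by
    have := h1.1
    field_simp at this
    exact this.symm
  rw [h2, one_smul] at heq
  exact h.ne heq.symm

/-- Normalizing two past null geodesics with different images yields a crossing. -/
lemma crossing_of_image_ne {p q : ℝ × S} {γ₁ γ₂ : ℝ → ℝ × S} {b₁ b₂ : ℝ} (h₁ : M.Joins γ₁ b₁ p q)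
    (h₂ : M.Joins γ₂ b₂ p q) (hne : γ₁ '' Set.Icc 0 b₁ ≠ γ₂ '' Set.Icc 0 b₂) :
    M.Crossing p q (fun r => γ₁ (b₁ * r)) (fun r => γ₂ (b₂ * r)) := by
  refine ⟨h₁.normalize, h₂.normalize, fun heq => hne ?_⟩
  have himg : ∀ (γ : ℝ → ℝ × S) (b : ℝ), 0 < b →
      γ '' Set.Icc 0 b = (fun r => γ (b * r)) '' Set.Icc 0 1 := by
    intro γ b hb
    have h1 : (fun r => γ (b * r)) = γ ∘ fun r => b * r := rfl
    rw [h1, Set.image_comp, Set.image_mul_left_Icc hb.le zero_le_one, mul_zero, mul_one]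
  rw [himg γ₁ b₁ h₁.1.pos, himg γ₂ b₂ h₂.1.pos]
  exact Set.image_congr fun s hs => (h₁.normalize.sameState h₂.normalize heq hs hs).1

end FoliatedSpacetime
end

/-! ### The minimal crossing is opposite at both ends. -/

theorem proposition3p6 {S : Type*} [TopologicalSpace S] [T2Space S] [SecondCountableTopology S]
    [ChartedSpace E3 S] [IsManifold 𝓘(ℝ, E3) ∞ S] (M : FoliatedSpacetime S)
    -- the leaves are complete, the lapse and the deformation tensor are bounded
    (hcomplete : ∀ t ∈ M.I, M.IsCompleteLeaf t)
    (N₀ K₀ : ℝ) (hN₀ : 0 < N₀)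
    (hlapse : ∀ t ∈ M.I, ∀ x, N₀⁻¹ ≤ M.lapse t x ∧ M.lapse t x ≤ N₀)
    (hdeform : ∀ t ∈ M.I, ∀ x v, |M.deformation t x v v| ≤ K₀ * M.metric t x v v)
    -- assumption A4
    (D : Set (ℝ × S)) (δ₀ : ℝ) (hD : IsCompact D) (hDM : D ⊆ M.region) (hδ₀ : 0 < δ₀)
    (hA4 : ∀ p ∈ M.region, p ∉ D → (δ₀ : EReal) < M.intersectionRadius p)
    -- the constant `δ_*`
    (δs : ℝ) (hδs : 0 < δs) (hδsδ₀ : δs ≤ δ₀)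
    (hconj : ∀ p ∈ M.region, min (M.intersectionRadius p) (δs : EReal) < M.conjugacyRadius p)
    -- two distinct null geodesics meeting at `p₀` and `q₀`
    (p₀ q₀ : ℝ × S) (γ₀ lam₀ : ℝ → ℝ × S) (b₀ c₀ : ℝ)
    (hγ₀ : M.Joins γ₀ b₀ p₀ q₀) (hlam₀ : M.Joins lam₀ c₀ p₀ q₀)
    (hdistinct : γ₀ '' Set.Icc 0 b₀ ≠ lam₀ '' Set.Icc 0 c₀)
    (htime : 0 < p₀.1 - q₀.1 ∧ p₀.1 - q₀.1 < δs) :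
    ∃ (p q : ℝ × S) (γ lam : ℝ → ℝ × S) (b c : ℝ),
      M.Joins γ b p q ∧ M.Joins lam c p q ∧
      q₀.1 ≤ q.1 ∧ q.1 < p.1 ∧ p.1 ≤ p₀.1 ∧
      FoliatedSpacetime.OppositeAt γ 0 lam 0 ∧ FoliatedSpacetime.OppositeAt γ b lam c := by
  have hex : ∀ p : ℝ × S, p.1 ∈ M.I → ∀ v : E3, v ≠ 0 → ∀ t ∈ M.I, t < p.1 →
      ∃ y, M.Reaches p v t y := fun p hp v hv t ht htp =>
    FoliatedSpacetime.exists_reaches hcomplete hN₀ hlapse hdeform hp hv ht htp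
  obtain ⟨p, q, γ, lam, hcr, hq, hp, hmin⟩ :=
    FoliatedSpacetime.exists_minimal_crossing hex hD hDM hA4 hδsδ₀ hconj
      (FoliatedSpacetime.crossing_of_image_ne hγ₀ hlam₀ hdistinct) htime.2
  -- With the time of the upper vertex held fixed, least extent means latest arrival; a later
  -- arrival stays above t(q₀), so the minimality applies to it.
  have hmax : ∀ x q' γ' lam', M.Crossing (p.1, x) q' γ' lam' → q'.1 ≤ q.1 := by
    intro x q' γ' lam' hc
    by_contra hlt
    have hlt : q.1 < q'.1 := not_le.1 hlt
    have := hmin (p.1, x) q' γ' lam' hc (hq.trans hlt.le) hp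
    dsimp only at this
    linarith
  have hpq : p.1 - q.1 < δs :=
    (hmin p₀ q₀ _ _ (FoliatedSpacetime.crossing_of_image_ne hγ₀ hlam₀ hdistinct)
      le_rfl le_rfl).trans_lt htime.2
  obtain ⟨c₁, c₂, hc, hv, hk⟩ := hcr.exists_multipliers hmax fun γ' hj Φ Φ' hΦ W hW =>
    hj.flow_injective (hconj p hcr.left.left_mem) hpq (fun q' γ' lam' h => hmax p.2 q' γ' lam' h)
      (mem_extChartAt_source _) (mem_extChartAt_source _) hΦ hW
  have h0 : (0 : ℝ) ∈ Set.Icc 0 1 := ⟨le_rfl, zero_le_one⟩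
  have h1 : (1 : ℝ) ∈ Set.Icc 0 1 := ⟨zero_le_one, le_rfl⟩
  -- The relation at the top cannot involve only one geodesic, as leaf velocities of null geodesics
  -- do not vanish.
  have hc₂ : c₂ ≠ 0 := by
    rintro rfl
    rw [zero_smul, add_zero] at hv
    rcases hc with hc | hc
    · exact (smul_ne_zero hc (hcr.left.1.leafVelocity_ne_zero h0)) hv
    · exact hc rfl
  have hsolve : ∀ v w : E3, c₁ • v + c₂ • w = 0 → w = -(c₁ / c₂) • v := fun v w h => by
    have h2 : c₂ • w = -c₁ • v := by rw [neg_smul]; exact eq_neg_of_add_eq_zero_right h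
    rw [← inv_smul_smul₀ hc₂ w, h2, smul_smul]
    congr 1
    field_simp
  have hv' := hsolve _ _ hv
  have hk' := hsolve _ _ hk
  -- A negative ratio would give the two geodesics the same initial direction, which
  -- `Crossing.not_parallel` excludes. The sign is determined at the top and holds at the bottom
  -- because the coefficients are the same.
  have hκ : 0 < c₁ / c₂ := by
    by_contra hle
    rcases (not_lt.1 hle).lt_or_eq with hlt | heq
    · exact hcr.not_parallel (neg_pos.2 hlt) hv'
    · rw [heq, neg_zero, zero_smul] at hv'
      exact hcr.right.1.leafVelocity_ne_zero h0 hv'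
  exact ⟨p, q, γ, lam, 1, 1, hcr.left, hcr.right, hq, hcr.left.time_lt, hp,
    ⟨hcr.left.1.leafVelocity_ne_zero h0, _, hκ, hv'⟩,
    ⟨hcr.left.1.leafVelocity_ne_zero h1, _, hκ, hk'⟩⟩
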